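/- **Metric graphs.** A metric graph $\Gamma$ is a finite simple graph with vertices $V(\Gamma)=\{V_1,\dots,V_N\}$ and a length $l_{ij}\ge 0$ for each edge $e_{ij}=\{V_i,V_j\}$; its length $l(\Gamma)$ is the sum of the $l_{ij}$ over the edges. A function $u$ on $\Gamma$ is a family of functions $u_{ij}$ on $[0,l_{ij}]$, one for each oriented edge, with $u_{ji}(x)=u_{ij}(l_{ij}-x)$ and such that $u(V_i):=u_{ij}(0)$ does not depend on $j$. For $\mathcal V\subset V(\Gamma)$ let $$\mathcal E(\Gamma;\mathcal V)=\inf\Big\{\tfrac12\int_\Gamma |u'|^2dx-\int_\Gamma u\,dx\ :\ u\in H^1(\Gamma),\ u=0\text{ on }\mathcal V\Big\},$$ where $u\in H^1(\Gamma)$ means $u_{ij}\in H^1([0,l_{ij}])$ for each edge. An immersion $\gamma:\Gamma\to\mathbb R^2$ is a continuous function on $\Gamma$ for which each $\gamma_{ij}$ is an injective arc-length parametrized curve. It is an embedding if, moreover, it is injective (distinct vertices have distinct images, and the interior of an edge does not meet any other edge). **The problem.** Let $D_1=(-\frac{\sqrt3}{3},0)$, $D_2=(\frac{\sqrt3}{6},-\frac12)$,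 $D_3=(\frac{\sqrt3}{6},\frac12)$, $\mathcal D=\{D_1,D_2,D_3\}$, and let $l\ge\sqrt3$. A competitor is a triple $(\Gamma,\mathcal V,\gamma)$ where $\Gamma$ is a connected metric graph with $l(\Gamma)=l$, $\mathcal V\subset V(\Gamma)$, and $\gamma:\Gamma\to\mathbb R^2$ is an immersion with $\gamma(\mathcal V)=\mathcal D$. A solution is a competitor for which $\mathcal E(\Gamma;\mathcal V)$ is minimal among all competitors. Call $(\Gamma,\mathcal V)$ reduced if all edges have positive length and all vertices of degree two belong to $\mathcal V$. Let $\rho$ be the rotation by $2\pi/3$ around the origin, so that $\rho D_1=D_2$, $\rho D_2=D_3$, $\rho D_3=D_1$. **The trees.** In both trees the Dirichlet vertices are $\mathcal V=\{V_1,V_2,V_3\}$. * $\Gamma_1$, with parameter $x$: vertices $V_1,\dots,V_4$, edges $e_{14},e_{24},e_{34}$, lengths $l_{24}=l_{34}=x$ and $l_{14}=\frac{\sqrt3}{2}-\sqrt{x^2-\frac14}$. The vertex $V_4$ is of Kirchhoff type. * $\Gamma_3$, with parameter $x$: vertices $V_1,\dots,V_6$, edges $e_{15},e_{24},e_{34},e_{45},e_{56}$,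 lengths $l_{24}=l_{34}=x$, $l_{15}=\frac{lx}{2(2l-3x)}+\frac{\sqrt3}{4}-\frac14\sqrt{4x^2-1}$, $l_{45}=\frac{\sqrt3}{4}-\frac{lx}{2(2l-3x)}-\frac14\sqrt{4x^2-1}$ and $l_{56}=l-2x-\frac{\sqrt3}{2}+\frac12\sqrt{4x^2-1}$. The vertices $V_4$, $V_5$ are of Kirchhoff type (non-Dirichlet, of degree three) and $V_6$ is a Neumann vertex (non-Dirichlet, of degree one). **Claim.** 1. Let $\sqrt3\le l\le 1+\frac{\sqrt3}{2}$. There is exactly one $x\in[\frac12,\frac1{\sqrt3}]$ for which $\Gamma_1$ has length $l$. For this $x$ there is a solution whose graph is $\Gamma_1$, reduced, with $\gamma$ an embedding and $\gamma(V_i)=D_i$ for $i=1,2,3$. In particular, it is also a minimizer among the competitors for which $\gamma$ is an embedding. 2. Let $l>1+\frac{\sqrt3}{2}$. There is exactly one $x\in[\frac12,\frac1{\sqrt3}]$ for which some solution has the graph $\Gamma_3$ with parameter $x$. For this $x$ there is a solution whose graph is $\Gamma_3$, reduced, with $\gamma$ an embedding and $\gamma(V_i)=D_i$ for $i=1,2,3$.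 In particular, it is also a minimizer among the competitors for which $\gamma$ is an embedding. 3. In both cases the solution is unique up to rotation: if $(\Gamma,\mathcal V,\gamma)$ is a reduced solution, then, with the $x$ above, the vertices of $\Gamma$ can be named so that $(\Gamma,\mathcal V)$ is $\Gamma_1$ (respectively $\Gamma_3$) with its Dirichlet vertices, and for some integer $k\ge0$ we have $\gamma(V_i)=\rho^kD_i$ for $i=1,2,3$. 4. If $l>\sqrt3$, the solutions do not have the symmetry of the triangle: for a reduced solution $(\Gamma,\mathcal V,\gamma)$ there is no length-preserving automorphism $\varphi$ of $\Gamma$ which maps $\mathcal V$ into itself with $\gamma(\varphi(V))=\rho(\gamma(V))$ for all $V\in\mathcal V$. Moreover, if $\gamma$ is an embedding, then $\rho(\gamma(\Gamma))\ne\gamma(\Gamma)$. -/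

import Mathlib

open Set MeasureTheory
open scoped NNReal

/-- A (finite) metric graph: a combinatorial graph with vertices `V_0, …, V_{N-1}`, together with a
non-negative length for each edge. Values of `len` outside the edge set are irrelevant. -/
structure MetricGraph (N : ℕ) where
  /-- the underlying combinatorial graph -/
  graph : SimpleGraph (Fin N)
  /-- the lengths of the edges -/
  len : Sym2 (Fin N) → ℝ≥0

namespace MetricGraph

variable {N : ℕ}

/-- The pairs `(i, j)` with `i < j` such that `{V_i, V_j}` is an edge: every edge occurs once. -/
noncomputable def edges (Γ : MetricGraph N) : Finset (Fin N × Fin N) := by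
  classical exact Finset.univ.filter fun p => p.1 < p.2 ∧ Γ.graph.Adj p.1 p.2

/-- The total length `l(Γ)`. -/
noncomputable def length (Γ : MetricGraph N) : ℝ :=
  ∑ p ∈ Γ.edges, (Γ.len s(p.1, p.2) : ℝ)

/-- An `E`-valued function on the metric graph: for each edge `{V_i, V_j}` a function `u_ij` on
`[0, l_ij]` with `u_ji x = u_ij (l_ij - x)`, such that the value `u_ij 0 = u (V_i)` does not depend
on `j`. (`edge i j` is relevant only for adjacent `i`, `j`, and only on `[0, l_ij]`.) -/
structure Fun (Γ : MetricGraph N) (E : Type*) where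
  /-- the values at the vertices -/
  vert : Fin N → E
  /-- the functions on the oriented edges -/
  edge : Fin N → Fin N → ℝ → E
  edge_zero : ∀ i j, Γ.graph.Adj i j → edge i j 0 = vert i
  edge_symm : ∀ i j, Γ.graph.Adj i j → ∀ x ∈ Icc (0 : ℝ) (Γ.len s(i, j)),
    edge j i x = edge i j (Γ.len s(i, j) - x)

namespace Fun

variable {Γ : MetricGraph N}

/-- Membership in `H¹(Γ)`: on each edge, `u_ij ∈ H¹([0, l_ij])`, i.e. `u_ij` is absolutely
continuous on `[0, l_ij]` with derivative in `L²(0, l_ij)`. -/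
def MemH1 (u : Γ.Fun ℝ) : Prop :=
  ∀ i j, Γ.graph.Adj i j →
    AbsolutelyContinuousOnInterval (u.edge i j) 0 (Γ.len s(i, j)) ∧
    MemLp (deriv (u.edge i j)) 2 (volume.restrict (Ioo (0 : ℝ) (Γ.len s(i, j))))

/-- Membership in `H¹₀(Γ; W)`. -/
def MemH10 (u : Γ.Fun ℝ) (W : Set (Fin N)) : Prop :=
  u.MemH1 ∧ ∀ i ∈ W, u.vert i = 0

/-- The functional `J(u) = ½ ∫_Γ |u'|² dx - ∫_Γ u dx`. -/
noncomputable def J (u : Γ.Fun ℝ) : ℝ :=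
  ∑ p ∈ Γ.edges,
    ((1 / 2) * (∫ x in (0 : ℝ)..(Γ.len s(p.1, p.2)), (deriv (u.edge p.1 p.2) x) ^ 2)
      - ∫ x in (0 : ℝ)..(Γ.len s(p.1, p.2)), u.edge p.1 p.2 x)

/-- An immersion of a metric graph: a continuous function each of whose edge functions is an
injective curve parametrized by arc length. -/
def IsImmersion {E : Type*} [PseudoEMetricSpace E] (γ : Γ.Fun E) : Prop :=
  ∀ i j, Γ.graph.Adj i j →
    ContinuousOn (γ.edge i j) (Icc 0 (Γ.len s(i, j))) ∧
    InjOn (γ.edge i j) (Icc 0 (Γ.len s(i, j))) ∧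
    HasUnitSpeedOn (γ.edge i j) (Icc 0 (Γ.len s(i, j)))

/-- An embedding: an immersion which is injective, i.e. the interior of an edge does not meet any
other (closed) edge, and distinct vertices have distinct images. -/
def IsEmbedding {E : Type*} [PseudoEMetricSpace E] (γ : Γ.Fun E) : Prop :=
  γ.IsImmersion ∧
  (∀ i j i' j', Γ.graph.Adj i j → Γ.graph.Adj i' j' → s(i, j) ≠ s(i', j') →
    Disjoint (γ.edge i j '' Ioo 0 (Γ.len s(i, j)))
      (γ.edge i' j' '' Icc 0 (Γ.len s(i', j')))) ∧
  Function.Injective γ.vert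

/-- The image `γ(Γ)`. -/
def image {E : Type*} (γ : Γ.Fun E) : Set E :=
  {p | ∃ i j, Γ.graph.Adj i j ∧ p ∈ γ.edge i j '' Icc 0 (Γ.len s(i, j))}

end Fun

/-- The Dirichlet energy `ℰ(Γ; W)`. (The infimum is finite when `Γ` is connected and `W ≠ ∅`, the
only case in which it is used below.) -/
noncomputable def energy (Γ : MetricGraph N) (W : Set (Fin N)) : ℝ :=
  sInf {t | ∃ u : Γ.Fun ℝ, u.MemH10 W ∧ u.J = t}

/-- Reduced metric graphs with Dirichlet vertices `W`: all the edges have positive length, and all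
the vertices of degree two belong to `W`. -/
def IsReduced (Γ : MetricGraph N) (W : Set (Fin N)) : Prop :=
  (∀ i j, Γ.graph.Adj i j → 0 < Γ.len s(i, j)) ∧
  ∀ i, (Γ.graph.neighborSet i).ncard = 2 → i ∈ W

end MetricGraph

/-- The Euclidean plane. -/
abbrev Plane : Type := EuclideanSpace ℝ (Fin 2)

/-- `(Γ, W, γ)` is a competitor for the Dirichlet points `D ⊆ ℝ²` and the length `l`: `Γ` is
connected of length `l`, and `γ` is an immersion which maps the set `W` of vertices onto `D`. -/
def IsCompetitor (D : Set Plane) (l : ℝ) {N : ℕ} (Γ : MetricGraph N) (W : Set (Fin N))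
    (γ : Γ.Fun Plane) : Prop :=
  Γ.graph.Connected ∧ Γ.length = l ∧ γ.IsImmersion ∧ γ.vert '' W = D

/-- `(Γ, W, γ)` minimizes the Dirichlet energy among all the immersed competitors. -/
def IsSolution (D : Set Plane) (l : ℝ) {N : ℕ} (Γ : MetricGraph N) (W : Set (Fin N))
    (γ : Γ.Fun Plane) : Prop :=
  IsCompetitor D l Γ W γ ∧
  ∀ (N' : ℕ) (Γ' : MetricGraph N') (W' : Set (Fin N')) (γ' : Γ'.Fun Plane),
    IsCompetitor D l Γ' W' γ' → Γ.energy W ≤ Γ'.energy W'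

/-- `(Γ, W, γ)` minimizes the Dirichlet energy among all the embedded competitors. -/
def IsEmbeddedSolution (D : Set Plane) (l : ℝ) {N : ℕ} (Γ : MetricGraph N) (W : Set (Fin N))
    (γ : Γ.Fun Plane) : Prop :=
  (IsCompetitor D l Γ W γ ∧ γ.IsEmbedding) ∧
  ∀ (N' : ℕ) (Γ' : MetricGraph N') (W' : Set (Fin N')) (γ' : Γ'.Fun Plane),
    IsCompetitor D l Γ' W' γ' → γ'.IsEmbedding → Γ.energy W ≤ Γ'.energy W'

/-- The vertices `D_1, D_2, D_3` of an equilateral triangle of side one, centred at the origin. -/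
noncomputable def triangle : Fin 3 → Plane :=
  ![!₂[-(√3 / 3), 0], !₂[√3 / 6, -(1 / 2)], !₂[√3 / 6, 1 / 2]]

/-- The counterclockwise rotation of the plane by `2π/3` around the origin. -/
noncomputable def rot (p : Plane) : Plane :=
  !₂[-(1 / 2) * p 0 - √3 / 2 * p 1, √3 / 2 * p 0 - 1 / 2 * p 1]

/-- `Γ`, with Dirichlet vertices `W`, is the metric tree `Γ_1` of parameter `x`. The vertex called
`V_{a+1}` there is `e a` here. There are no Neumann vertices (non-Dirichlet vertices of degree
one); `e 3` is the only non-Dirichlet (Kirchhoff) vertex. -/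
structure IsGamma1 (x : ℝ) {N : ℕ} (Γ : MetricGraph N) (W : Set (Fin N)) (e : Fin 4 ≃ Fin N) :
    Prop where
  adj : ∀ a b, Γ.graph.Adj (e a) (e b) ↔
    s(a, b) ∈ ({s(0, 3), s(1, 3), s(2, 3)} : Set (Sym2 (Fin 4)))
  dirichlet : W = {e 0, e 1, e 2}
  len_14 : (Γ.len s(e 0, e 3) : ℝ) = √3 / 2 - √(x ^ 2 - 1 / 4)
  len_24 : (Γ.len s(e 1, e 3) : ℝ) = x
  len_34 : (Γ.len s(e 2, e 3) : ℝ) = x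

/-- `Γ`, with Dirichlet vertices `W`, is the metric tree `Γ_3` of total length `l` and parameter
`x`. The vertex called `V_{a+1}` there is `e a` here. The vertices `e 3` and `e 4` are
non-Dirichlet vertices of degree three (Kirchhoff vertices), and `e 5` is a non-Dirichlet vertex of
degree one (Neumann vertex). -/
structure IsGamma3 (l x : ℝ) {N : ℕ} (Γ : MetricGraph N) (W : Set (Fin N)) (e : Fin 6 ≃ Fin N) :
    Prop where
  adj : ∀ a b, Γ.graph.Adj (e a) (e b) ↔
    s(a, b) ∈ ({s(0, 4), s(1, 3), s(2, 3), s(3, 4), s(4, 5)} : Set (Sym2 (Fin 6)))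
  dirichlet : W = {e 0, e 1, e 2}
  len_15 : (Γ.len s(e 0, e 4) : ℝ) =
    l * x / (2 * (2 * l - 3 * x)) + √3 / 4 - 1 / 4 * √(4 * x ^ 2 - 1)
  len_24 : (Γ.len s(e 1, e 3) : ℝ) = x
  len_34 : (Γ.len s(e 2, e 3) : ℝ) = x
  len_45 : (Γ.len s(e 3, e 4) : ℝ) =
    √3 / 4 - l * x / (2 * (2 * l - 3 * x)) - 1 / 4 * √(4 * x ^ 2 - 1)
  len_56 : (Γ.len s(e 4, e 5) : ℝ) = l - 2 * x - √3 / 2 + 1 / 2 * √(4 * x ^ 2 - 1)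

/-! The lower bound for the energy comes from duality. On an edge, integrating ½(u' + φ + x)² ≥ 0
and integrating by parts bounds the energy from below by boundary terms, with flux φ at the start
and φ + L at the end, minus a cubic cost (`flux_le_integral`). In a sum over edges whose fluxes
satisfy Kirchhoff's law the values at the vertices cancel too, so every admissible flux gives a
bound in terms of lengths alone.

In a connected graph, vertices over the three points are joined by a tripod: three paths from a
common centre, otherwise disjoint (`exists_tripod`). Let r be the total length of the remaining
edges, and let v be maximal on the tripod at p. The remaining edges have at least the energy of one
Neumann edge of length r attached at p (`neg_sub_cube_le_sum_vertexEnergy`). This leaves a tree with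
three legs, a Neumann edge and the position τ of p on its leg. A suitable flux, chosen independently
of τ (`exists_flux`), bounds its energy by -½ `treeBound l m r`, where m is the mean length of two
of the legs: unequal legs and a badly placed Neumann edge only raise the energy.

The geometry enters through the fact that legs are at least as long as the distances of their ends.
A triangle with base 1 and other sides of sum 2m is highest when isosceles
(`sub_sqrt_le_of_coordinates`); hence r ≤ `neumannLength l w`, where w is the height of that
triangle and m = `sideLength w`. It remains to maximize `heightBound l` over w. Heights beyond the
Fermat point w = √3/6 lose against √3/6. Below it, with r = `neumannLength l w` ≥ 0, the derivative
has the sign of `criticalFun`. For l ≥ 1 + √3/2 this function is strictly decreasing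
(`criticalFun_strictAntiOn`), so there is one maximizer w₀. For smaller l it is negative wherever r
> 0 (`criticalFun_neg_of_le`), so the best choice is r = 0. This is the transition between the two
trees.

Uniqueness is the analysis of equality. The lengths of the legs and r are those given by w₀, the
Neumann edge is a single edge in its best position, and all flux bounds are tight, which determines
v along the tripod. There v is positive away from the ends, whereas a vertex of degree two in a
reduced graph is Dirichlet; so no path of the tree is subdivided (`eq_edge_of_tight`,
`eq_singleton_of_sum_vertexEnergy_le`). A straight drawing attains the bound.

For l > √3 one has w₀ < √3/6, which excludes the symmetries: the centre is not the Fermat point, so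
the rotated centre is off the straight tripod, and a neighbourhood of it, containing three arcs from
one point, cannot be covered by the Neumann edge alone (`not_triod`). -/

/-! ### One edge: minimal energy and flux bounds -/

/-- The minimal energy `½ ∫ u'² - ∫ u` on an interval of length `L` with end values `a` and `b`. -/
noncomputable def edgeEnergy (L a b : ℝ) : ℝ :=
  (a - b) ^ 2 / (2 * L) - L * (a + b) / 2 - L ^ 3 / 24

theorem edgeEnergy_comm (L a b : ℝ) : edgeEnergy L a b = edgeEnergy L b a := by
  unfold edgeEnergy; ring

/-- The gap is the square of (a - b) - Lφ - L²/2, divided by 2L. For L = 0 the division by zero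
makes `edgeEnergy` vanish, and the bound holds because then a = b. -/
theorem flux_le_edgeEnergy {L a b : ℝ} (hL : 0 ≤ L) (h0 : L = 0 → a = b) (φ : ℝ) :
    φ * a - (φ + L) * b - ((φ + L) ^ 3 - φ ^ 3) / 6 ≤ edgeEnergy L a b := by
  unfold edgeEnergy
  rcases hL.eq_or_lt with h | h
  · have := h0 h.symm
    subst this; subst h
    simp
  · have : (a - b) ^ 2 / (2 * L) - L * (a + b) / 2 - L ^ 3 / 24
        - (φ * a - (φ + L) * b - ((φ + L) ^ 3 - φ ^ 3) / 6)
        = ((a - b) - L * φ - L ^ 2 / 2) ^ 2 / (2 * L) := by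
      field_simp; ring
    have h2 : 0 ≤ ((a - b) - L * φ - L ^ 2 / 2) ^ 2 / (2 * L) := by positivity
    linarith

theorem absolutelyContinuousOnInterval_const_add_id (φ a b : ℝ) :
    AbsolutelyContinuousOnInterval (fun x => φ + x) a b := by
  have : LipschitzWith 1 (fun x : ℝ => φ + x) := by
    apply LipschitzWith.of_dist_le_mul; intro x y; simp
  exact this.lipschitzOnWith.absolutelyContinuousOnInterval

/-- Integrate ½(u' + φ + x)² ≥ 0 and treat the mixed term by parts. The case of equality is u' = -(φ
+ x): φ is the flux at the start, and it grows by one per unit of length. -/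
theorem flux_le_integral {L : ℝ} {u : ℝ → ℝ} (hL : 0 ≤ L)
    (hu : AbsolutelyContinuousOnInterval u 0 L)
    (hu2 : MemLp (deriv u) 2 (volume.restrict (Ioo (0 : ℝ) L))) (φ : ℝ) :
    φ * u 0 - (φ + L) * u L - ((φ + L) ^ 3 - φ ^ 3) / 6 ≤
      (1 / 2) * (∫ x in (0 : ℝ)..L, (deriv u x) ^ 2) - ∫ x in (0 : ℝ)..L, u x := by
  have hsq : IntervalIntegrable (fun x => (deriv u x) ^ 2) volume 0 L := by
    rw [intervalIntegrable_iff_integrableOn_Ioo_of_le hL]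
    exact hu2.integrable_sq
  have hid := absolutelyContinuousOnInterval_const_add_id φ 0 L
  have hparts := hid.integral_mul_deriv_eq_deriv_mul hu
  have hd : deriv (fun x : ℝ => φ + x) = fun _ => 1 := by
    funext x; simp
  simp only [hd, one_mul, add_zero] at hparts
  have hi1 : IntervalIntegrable (fun x => (φ + x) * deriv u x) volume 0 L :=
    hu.intervalIntegrable_deriv.continuousOn_mul (by fun_prop)
  have hi2 : IntervalIntegrable (fun x : ℝ => (φ + x) ^ 2) volume 0 L :=
    Continuous.intervalIntegrable (by fun_prop) _ _
  have hnn : 0 ≤ ∫ x in (0 : ℝ)..L, ((1 / 2) * (deriv u x) ^ 2 + (φ + x) * deriv u x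
      + (1 / 2) * (φ + x) ^ 2) := by
    apply intervalIntegral.integral_nonneg hL
    intro x _
    nlinarith [sq_nonneg (deriv u x + (φ + x))]
  rw [intervalIntegral.integral_add ((hsq.const_mul _).add hi1) (hi2.const_mul _),
    intervalIntegral.integral_add (hsq.const_mul _) hi1, intervalIntegral.integral_const_mul,
    intervalIntegral.integral_const_mul, hparts] at hnn
  have hcube : ∫ x in (0 : ℝ)..L, (φ + x) ^ 2 = ((φ + L) ^ 3 - φ ^ 3) / 3 := by
    rw [intervalIntegral.integral_comp_add_left (fun x => x ^ 2) φ, integral_pow]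
    norm_num
  rw [hcube] at hnn
  linarith

theorem edgeEnergy_le_integral {L : ℝ} {u : ℝ → ℝ} (hL : 0 ≤ L)
    (hu : AbsolutelyContinuousOnInterval u 0 L)
    (hu2 : MemLp (deriv u) 2 (volume.restrict (Ioo (0 : ℝ) L))) :
    edgeEnergy L (u 0) (u L) ≤
      (1 / 2) * (∫ x in (0 : ℝ)..L, (deriv u x) ^ 2) - ∫ x in (0 : ℝ)..L, u x := by
  rcases hL.eq_or_lt with h | h
  · subst h; simp [edgeEnergy]
  -- This φ maximizes the flux bound: it makes the square in `flux_le_edgeEnergy` vanish.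
  · refine le_trans (le_of_eq ?_) (flux_le_integral hL hu hu2 ((u 0 - u L) / L - L / 2))
    unfold edgeEnergy; field_simp; ring

/-- The function on `[0, L]` with end values `a`, `b` and second derivative `-1`. -/
noncomputable def parabola (L a b x : ℝ) : ℝ := a + (b - a) / L * x + x * (L - x) / 2

theorem hasDerivAt_parabola (L a b x : ℝ) :
    HasDerivAt (parabola L a b) ((b - a) / L + (L - 2 * x) / 2) x := by
  unfold parabola
  have h := ((hasDerivAt_const x a).add ((hasDerivAt_id x).const_mul ((b - a) / L))).add
    (((hasDerivAt_id x).mul ((hasDerivAt_const x L).sub (hasDerivAt_id x))).div_const 2)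
  convert! h using 1
  simp; ring

theorem deriv_parabola (L a b : ℝ) :
    deriv (parabola L a b) = fun x => (b - a) / L + (L - 2 * x) / 2 := by
  funext x; exact (hasDerivAt_parabola L a b x).deriv

theorem absolutelyContinuousOnInterval_parabola (L a b c d : ℝ) :
    AbsolutelyContinuousOnInterval (parabola L a b) c d := by
  have hcd : ContDiff ℝ 1 (parabola L a b) := by unfold parabola; fun_prop
  obtain ⟨K, hK⟩ := hcd.locallyLipschitz.locallyLipschitzOn.exists_lipschitzOnWith_of_compact
    (isCompact_uIcc (a := c) (b := d))
  exact hK.absolutelyContinuousOnInterval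

theorem memLp_deriv_parabola (L a b c d : ℝ) :
    MemLp (deriv (parabola L a b)) 2 (volume.restrict (Ioo c d)) := by
  rw [deriv_parabola]
  have hc : Continuous fun x : ℝ => (b - a) / L + (L - 2 * x) / 2 := by fun_prop
  obtain ⟨C, hC⟩ := isCompact_Icc.exists_bound_of_continuousOn (s := Icc c d) hc.continuousOn
  refine MemLp.of_bound hc.aestronglyMeasurable C ?_
  filter_upwards [ae_restrict_mem measurableSet_Ioo] with x hx
  exact hC x (Ioo_subset_Icc_self hx)

theorem integral_parabola {L : ℝ} (hL : 0 < L) (a b : ℝ) :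
    (1 / 2) * (∫ x in (0 : ℝ)..L, (deriv (parabola L a b) x) ^ 2)
      - ∫ x in (0 : ℝ)..L, parabola L a b x = edgeEnergy L a b := by
  have h1 : ∫ x in (0 : ℝ)..L, (deriv (parabola L a b) x) ^ 2
      = (b - a) ^ 2 / L + L ^ 3 / 12 := by
    rw [deriv_parabola]
    have : ∀ x ∈ uIcc 0 L, HasDerivAt (fun x => ((b - a) / L + L / 2) ^ 2 * x
        - ((b - a) / L + L / 2) * x ^ 2 + x ^ 3 / 3) (((b - a) / L + (L - 2 * x) / 2) ^ 2) x := by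
      intro x _
      have h := (((hasDerivAt_id x).const_mul (((b - a) / L + L / 2) ^ 2)).sub
        ((hasDerivAt_pow 2 x).const_mul ((b - a) / L + L / 2))).add
        ((hasDerivAt_pow 3 x).div_const 3)
      convert! h using 1
      simp; ring
    rw [intervalIntegral.integral_eq_sub_of_hasDerivAt this
      (Continuous.intervalIntegrable (by fun_prop) _ _)]
    field_simp; ring
  have h2 : ∫ x in (0 : ℝ)..L, parabola L a b x = L * (a + b) / 2 + L ^ 3 / 12 := by
    have : ∀ x ∈ uIcc 0 L, HasDerivAt (fun x => a * x + ((b - a) / L) * x ^ 2 / 2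
        + L * x ^ 2 / 4 - x ^ 3 / 6) (parabola L a b x) x := by
      intro x _
      have h := ((((hasDerivAt_id x).const_mul a).add
        (((hasDerivAt_pow 2 x).const_mul ((b - a) / L)).div_const 2)).add
        (((hasDerivAt_pow 2 x).const_mul L).div_const 4)).sub ((hasDerivAt_pow 3 x).div_const 6)
      convert! h using 1
      simp [parabola]; ring
    rw [intervalIntegral.integral_eq_sub_of_hasDerivAt this
      (Continuous.intervalIntegrable (by unfold parabola; fun_prop) _ _)]
    field_simp; ring
  rw [h1, h2]
  unfold edgeEnergy; field_simp; ring

/-! ### Reduction to the values at the vertices -/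

namespace MetricGraph

variable {N : ℕ}

/-- The minimal energy of an edge, as a function of the values at the vertices. -/
noncomputable def vertexEnergy (Γ : MetricGraph N) (v : Fin N → ℝ) : Sym2 (Fin N) → ℝ :=
  Sym2.lift ⟨fun i j => edgeEnergy (Γ.len s(i, j)) (v i) (v j), fun i j => by
    change edgeEnergy (Γ.len s(i, j)) (v i) (v j) = edgeEnergy (Γ.len s(j, i)) (v j) (v i)
    rw [edgeEnergy_comm, Sym2.eq_swap]⟩

theorem vertexEnergy_mk (Γ : MetricGraph N) (v : Fin N → ℝ) (i j : Fin N) :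
    Γ.vertexEnergy v s(i, j) = edgeEnergy (Γ.len s(i, j)) (v i) (v j) := rfl

/-- The edges as a set of unordered pairs. -/
noncomputable def edgeSet' (Γ : MetricGraph N) : Finset (Sym2 (Fin N)) := by
  classical exact Γ.graph.edgeFinset

theorem mem_edgeSet' {Γ : MetricGraph N} {i j : Fin N} :
    s(i, j) ∈ Γ.edgeSet' ↔ Γ.graph.Adj i j := by
  classical
  unfold edgeSet'
  simp

theorem sum_edges_eq (Γ : MetricGraph N) (f : Sym2 (Fin N) → ℝ) :
    ∑ p ∈ Γ.edges, f s(p.1, p.2) = ∑ e ∈ Γ.edgeSet', f e := by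
  classical
  refine Finset.sum_bij' (fun p _ => s(p.1, p.2)) (fun e _ => (e.inf, e.sup)) ?_ ?_ ?_ ?_ ?_
  · intro p hp
    simp only [edges, Finset.mem_filter] at hp
    exact mem_edgeSet'.2 hp.2.2
  · intro e he
    induction e with | _ i j
    have := mem_edgeSet'.1 he
    simp only [edges, Finset.mem_filter, Finset.mem_univ, true_and, Sym2.inf_mk, Sym2.sup_mk]
    rcases lt_or_gt_of_ne this.ne with h | h
    · simp [inf_eq_left.2 h.le, sup_eq_right.2 h.le, h, this]
    · simp [inf_eq_right.2 h.le, sup_eq_left.2 h.le, h, this.symm]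
  · intro p hp
    simp only [edges, Finset.mem_filter] at hp
    simp [inf_eq_left.2 hp.2.1.le, sup_eq_right.2 hp.2.1.le]
  · intro e he
    induction e with | _ i j
    rcases le_total i j with h | h
    · simp [inf_eq_left.2 h, sup_eq_right.2 h]
    · simp [inf_eq_right.2 h, sup_eq_left.2 h, Sym2.eq_swap]
  · intro p hp; rfl

theorem length_eq (Γ : MetricGraph N) : Γ.length = ∑ e ∈ Γ.edgeSet', (Γ.len e : ℝ) :=
  Γ.sum_edges_eq fun e => (Γ.len e : ℝ)

/-- The values at the two ends of an edge of length zero agree. -/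
def Compatible (Γ : MetricGraph N) (v : Fin N → ℝ) : Prop :=
  ∀ i j, Γ.graph.Adj i j → Γ.len s(i, j) = 0 → v i = v j

theorem Fun.edge_len {Γ : MetricGraph N} {E : Type*} (u : Γ.Fun E) {i j : Fin N}
    (h : Γ.graph.Adj i j) : u.edge i j (Γ.len s(i, j)) = u.vert j := by
  have h1 := u.edge_symm i j h 0 ⟨le_rfl, NNReal.coe_nonneg _⟩
  rw [u.edge_zero j i h.symm, sub_zero] at h1
  exact h1.symm

theorem Fun.compatible {Γ : MetricGraph N} (u : Γ.Fun ℝ) : Γ.Compatible u.vert := by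
  intro i j h h0
  have h1 := u.edge_len h
  rw [h0, NNReal.coe_zero, u.edge_zero i j h] at h1
  exact h1

theorem sum_vertexEnergy_le_J {Γ : MetricGraph N} {u : Γ.Fun ℝ} (hu : u.MemH1) :
    ∑ e ∈ Γ.edgeSet', Γ.vertexEnergy u.vert e ≤ u.J := by
  rw [← sum_edges_eq]
  refine Finset.sum_le_sum fun p hp => ?_
  classical
  simp only [edges, Finset.mem_filter] at hp
  have := hu p.1 p.2 hp.2.2
  have h := edgeEnergy_le_integral (NNReal.coe_nonneg _) this.1 this.2
  rwa [u.edge_len hp.2.2, u.edge_zero _ _ hp.2.2] at h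

/-- The piecewise quadratic function with prescribed values at the vertices. -/
noncomputable def quadraticFun (Γ : MetricGraph N)
    (hΓ : ∀ i j, Γ.graph.Adj i j → 0 < Γ.len s(i, j)) (v : Fin N → ℝ) : Γ.Fun ℝ where
  vert := v
  edge i j := parabola (Γ.len s(i, j)) (v i) (v j)
  edge_zero i j _ := by simp [parabola]
  edge_symm i j h x _ := by
    have : (0 : ℝ) < Γ.len s(i, j) := hΓ i j h
    rw [Sym2.eq_swap (a := j) (b := i)]
    unfold parabola; field_simp; ring

theorem memH1_quadraticFun (Γ : MetricGraph N)
    (hΓ : ∀ i j, Γ.graph.Adj i j → 0 < Γ.len s(i, j)) (v : Fin N → ℝ) :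
    (Γ.quadraticFun hΓ v).MemH1 := fun _ _ _ =>
  ⟨absolutelyContinuousOnInterval_parabola _ _ _ _ _, memLp_deriv_parabola _ _ _ _ _⟩

theorem J_quadraticFun (Γ : MetricGraph N)
    (hΓ : ∀ i j, Γ.graph.Adj i j → 0 < Γ.len s(i, j)) (v : Fin N → ℝ) :
    (Γ.quadraticFun hΓ v).J = ∑ e ∈ Γ.edgeSet', Γ.vertexEnergy v e := by
  rw [← sum_edges_eq]
  refine Finset.sum_congr rfl fun p hp => ?_
  classical
  simp only [edges, Finset.mem_filter] at hp
  exact integral_parabola (L := (Γ.len s(p.1, p.2) : ℝ))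
    (NNReal.coe_pos.2 (hΓ _ _ hp.2.2)) (v p.1) (v p.2)

/-- A lower bound for the energy from a bound for the values at the vertices. -/
theorem le_energy {Γ : MetricGraph N} {W : Set (Fin N)} {c : ℝ}
    (h : ∀ v : Fin N → ℝ, Γ.Compatible v → (∀ i ∈ W, v i = 0) →
      c ≤ ∑ e ∈ Γ.edgeSet', Γ.vertexEnergy v e) : c ≤ Γ.energy W := by
  refine le_csInf ?_ ?_
  · refine ⟨_, ⟨fun _ => 0, fun _ _ _ => 0, by simp, by simp⟩, ⟨?_, by simp⟩, rfl⟩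
    intro i j _
    simp only
    have hc : LipschitzWith 0 (fun _ : ℝ => (0 : ℝ)) := LipschitzWith.const 0
    refine ⟨hc.lipschitzOnWith.absolutelyContinuousOnInterval, ?_⟩
    simp
  · rintro t ⟨u, hu, rfl⟩
    exact (h _ u.compatible hu.2).trans (sum_vertexEnergy_le_J hu.1)

/-- An `sInf` lies below the members of its set only if the set is bounded below; `hb` supplies that
bound. -/
theorem energy_le {Γ : MetricGraph N} {W : Set (Fin N)} {c : ℝ}
    (hb : ∀ v : Fin N → ℝ, Γ.Compatible v → (∀ i ∈ W, v i = 0) →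
      c ≤ ∑ e ∈ Γ.edgeSet', Γ.vertexEnergy v e)
    (hΓ : ∀ i j, Γ.graph.Adj i j → 0 < Γ.len s(i, j)) (v : Fin N → ℝ) (hv : ∀ i ∈ W, v i = 0) :
    Γ.energy W ≤ ∑ e ∈ Γ.edgeSet', Γ.vertexEnergy v e := by
  rw [← J_quadraticFun Γ hΓ]
  refine csInf_le ⟨c, ?_⟩ ⟨_, ⟨memH1_quadraticFun Γ hΓ v, hv⟩, rfl⟩
  rintro t ⟨u, hu, rfl⟩
  exact (hb _ u.compatible hu.2).trans (sum_vertexEnergy_le_J hu.1)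

end MetricGraph

/-! ### Flux bounds along walks -/

namespace MetricGraph

variable {N : ℕ}

/-- The total length of a walk. -/
noncomputable def walkLength (Γ : MetricGraph N) {x y : Fin N} (p : Γ.graph.Walk x y) : ℝ :=
  (p.edges.map fun e => (Γ.len e : ℝ)).sum

/-- The minimal energy along a walk with prescribed values at the vertices. -/
noncomputable def walkEnergy (Γ : MetricGraph N) (v : Fin N → ℝ) {x y : Fin N}
    (p : Γ.graph.Walk x y) : ℝ :=
  (p.edges.map (Γ.vertexEnergy v)).sum

variable {Γ : MetricGraph N} {v : Fin N → ℝ}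

@[simp] theorem walkLength_nil {x : Fin N} : Γ.walkLength (.nil : Γ.graph.Walk x x) = 0 := by
  simp [walkLength]

@[simp] theorem walkLength_cons {x y z : Fin N} (h : Γ.graph.Adj x y) (p : Γ.graph.Walk y z) :
    Γ.walkLength (.cons h p) = Γ.len s(x, y) + Γ.walkLength p := by
  simp [walkLength]

@[simp] theorem walkEnergy_nil {x : Fin N} : Γ.walkEnergy v (.nil : Γ.graph.Walk x x) = 0 := by
  simp [walkEnergy]

@[simp] theorem walkEnergy_cons {x y z : Fin N} (h : Γ.graph.Adj x y) (p : Γ.graph.Walk y z) :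
    Γ.walkEnergy v (.cons h p) = edgeEnergy (Γ.len s(x, y)) (v x) (v y) + Γ.walkEnergy v p := by
  simp [walkEnergy, vertexEnergy_mk]

theorem walkLength_append {x y z : Fin N} (p : Γ.graph.Walk x y) (q : Γ.graph.Walk y z) :
    Γ.walkLength (p.append q) = Γ.walkLength p + Γ.walkLength q := by
  simp [walkLength, SimpleGraph.Walk.edges_append]

theorem walkEnergy_append {x y z : Fin N} (p : Γ.graph.Walk x y) (q : Γ.graph.Walk y z) :
    Γ.walkEnergy v (p.append q) = Γ.walkEnergy v p + Γ.walkEnergy v q := by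
  simp [walkEnergy, SimpleGraph.Walk.edges_append]

theorem walkLength_reverse {x y : Fin N} (p : Γ.graph.Walk x y) :
    Γ.walkLength p.reverse = Γ.walkLength p := by
  simp [walkLength]

theorem walkEnergy_reverse {x y : Fin N} (p : Γ.graph.Walk x y) :
    Γ.walkEnergy v p.reverse = Γ.walkEnergy v p := by
  simp [walkEnergy]

theorem walkLength_nonneg {x y : Fin N} (p : Γ.graph.Walk x y) : 0 ≤ Γ.walkLength p := by
  induction p with
  | nil => simp
  | cons h p ih => rw [walkLength_cons]; positivity

theorem Compatible.flux_le {i j : Fin N} (hv : Γ.Compatible v) (h : Γ.graph.Adj i j) (φ : ℝ) :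
    φ * v i - (φ + Γ.len s(i, j)) * v j - ((φ + Γ.len s(i, j)) ^ 3 - φ ^ 3) / 6 ≤
      edgeEnergy (Γ.len s(i, j)) (v i) (v j) :=
  flux_le_edgeEnergy (NNReal.coe_nonneg _) (fun h0 => hv i j h (by exact_mod_cast h0)) φ

/-- The energy of a walk is bounded by the flux along the walk. -/
theorem flux_le_walkEnergy (hv : Γ.Compatible v) {x y : Fin N} (p : Γ.graph.Walk x y) (φ : ℝ) :
    φ * v x - (φ + Γ.walkLength p) * v y - ((φ + Γ.walkLength p) ^ 3 - φ ^ 3) / 6 ≤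
      Γ.walkEnergy v p := by
  induction p generalizing φ with
  | nil => simp
  | @cons a b _ h p ih =>
    have h1 := ih (φ + Γ.len s(a, b))
    have h2 := hv.flux_le h φ
    rw [walkEnergy_cons, walkLength_cons, ← add_assoc]
    linarith

/-- The bound of `flux_le_walkEnergy` is a concave quadratic in φ that never exceeds the energy.
Where it reaches the energy its derivative vanishes, and that is the stated relation. -/
theorem sub_eq_of_walkEnergy_le_flux (hv : Γ.Compatible v) {x y : Fin N} {p : Γ.graph.Walk x y}
    {φ : ℝ} (h : Γ.walkEnergy v p ≤
      φ * v x - (φ + Γ.walkLength p) * v y - ((φ + Γ.walkLength p) ^ 3 - φ ^ 3) / 6) :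
    v x - v y = Γ.walkLength p * φ + Γ.walkLength p ^ 2 / 2 := by
  set L := Γ.walkLength p
  have hL : 0 ≤ L := walkLength_nonneg p
  set D := v x - v y - (L * φ + L ^ 2 / 2) with hD
  have key : ∀ ε : ℝ, D * ε - ε ^ 2 * L / 2 ≤ 0 := by
    intro ε
    have h1 := flux_le_walkEnergy hv p (φ + ε)
    have : (φ + ε) * v x - (φ + ε + L) * v y - ((φ + ε + L) ^ 3 - (φ + ε) ^ 3) / 6
      - (φ * v x - (φ + L) * v y - ((φ + L) ^ 3 - φ ^ 3) / 6) = D * ε - ε ^ 2 * L / 2 := by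
      rw [hD]; ring
    linarith
  have hD0 : D = 0 := by
    -- For this ε the left side of `key` is positive unless D = 0; the `+ 1` covers L = 0.
    have h1 := key (D / (L + 1))
    have h2 : D * (D / (L + 1)) - (D / (L + 1)) ^ 2 * L / 2
        = D ^ 2 * (L + 2) / (2 * (L + 1) ^ 2) := by field_simp; ring
    rw [h2, div_le_iff₀ (by positivity), zero_mul] at h1
    have h3 : D ^ 2 ≤ 0 := by nlinarith [sq_nonneg D]
    exact pow_eq_zero_iff (two_ne_zero) |>.1 (le_antisymm h3 (sq_nonneg _))
  linarith

/-- A tight bound for a sum is tight for each summand; on the tail the initial flux has grown by the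
length of the first edge. -/
theorem walkEnergy_tail_le_flux (hv : Γ.Compatible v) {x y z : Fin N} {h : Γ.graph.Adj x y}
    {p : Γ.graph.Walk y z} {φ : ℝ} (hle : Γ.walkEnergy v (.cons h p) ≤
      φ * v x - (φ + Γ.walkLength (.cons h p)) * v z
        - ((φ + Γ.walkLength (.cons h p)) ^ 3 - φ ^ 3) / 6) :
    Γ.walkEnergy v p ≤ (φ + Γ.len s(x, y)) * v y - (φ + Γ.len s(x, y) + Γ.walkLength p) * v z
        - ((φ + Γ.len s(x, y) + Γ.walkLength p) ^ 3 - (φ + Γ.len s(x, y)) ^ 3) / 6 := by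
  have h2 := hv.flux_le h φ
  rw [walkEnergy_cons, walkLength_cons, ← add_assoc] at hle
  linarith

theorem exists_boundary_adj (hc : Γ.graph.Connected) {X : Set (Fin N)} (hX : X.Nonempty)
    (hX' : X ≠ univ) : ∃ x ∈ X, ∃ y ∉ X, Γ.graph.Adj x y := by
  obtain ⟨a, ha⟩ := hX
  obtain ⟨b, hb⟩ := (ne_univ_iff_exists_notMem X).1 hX'
  obtain ⟨p⟩ := hc.preconnected a b
  obtain ⟨d, _, h1, h2⟩ := p.exists_boundary_dart X ha hb
  exact ⟨_, h1, _, h2, d.adj⟩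

/-! ### The remaining edges compared with one Neumann edge -/

/-- The part of the graph outside a set of vertices on which `v ≤ M` has at least the energy of a
single edge of the same length. -/
theorem neg_sub_cube_le_sum_vertexEnergy (hc : Γ.graph.Connected) (hv : Γ.Compatible v) (n : ℕ) :
    ∀ (X : Set (Fin N)) (F : Finset (Sym2 (Fin N))) (M : ℝ), F.card = n → X.Nonempty →
      F ⊆ Γ.edgeSet' → (∀ i j, Γ.graph.Adj i j → i ∉ X → s(i, j) ∈ F) → (∀ i ∈ X, v i ≤ M) →
      -M * (∑ e ∈ F, (Γ.len e : ℝ)) - (∑ e ∈ F, (Γ.len e : ℝ)) ^ 3 / 6 ≤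
        ∑ e ∈ F, Γ.vertexEnergy v e := by
  classical
  induction n with
  | zero =>
    intro X F M hF _ _ _ _
    rw [Finset.card_eq_zero] at hF
    simp [hF]
  | succ n ih =>
    intro X F M hF hX hFe hFX hM
    by_cases hXu : X = univ
    · obtain ⟨e, he⟩ : F.Nonempty := Finset.card_pos.1 (by omega)
      induction e with | _ x y
      have hadj := mem_edgeSet'.1 (hFe he)
      have hF' := ih X (F.erase s(x, y)) M (by rw [Finset.card_erase_of_mem he]; omega) hX
        ((Finset.erase_subset _ _).trans hFe) (fun i _ _ hi => absurd (hXu ▸ mem_univ i) hi) hM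
      rw [← Finset.add_sum_erase F _ he, ← Finset.add_sum_erase F _ he, vertexEnergy_mk]
      -- No vertex is left outside: any edge is cut off with flux 0 at one end. The total improves,
      -- since (L + m)³ ≥ L³ + m³.
      have h1 := hv.flux_le hadj 0
      have hm : 0 ≤ ∑ e ∈ F.erase s(x, y), (Γ.len e : ℝ) :=
        Finset.sum_nonneg fun _ _ => NNReal.coe_nonneg _
      set m := ∑ e ∈ F.erase s(x, y), (Γ.len e : ℝ)
      have hL : (0 : ℝ) ≤ Γ.len s(x, y) := NNReal.coe_nonneg _
      set L := (Γ.len s(x, y) : ℝ)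
      have hy : v y ≤ M := hM y (hXu ▸ mem_univ y)
      have h3 : 0 ≤ L * m * (L + m) := by positivity
      nlinarith [mul_le_mul_of_nonneg_left hy hL]
    · obtain ⟨x, hx, y, hy, hadj⟩ := exists_boundary_adj hc hX hXu
      have he : s(x, y) ∈ F := Sym2.eq_swap (a := y) ▸ hFX y x hadj.symm hy
      have hF' := ih (insert y X) (F.erase s(x, y)) (max M (v y))
        (by rw [Finset.card_erase_of_mem he]; omega) (insert_nonempty _ _)
        ((Finset.erase_subset _ _).trans hFe) (fun i j hij hi => ?_) ?_
      · rw [← Finset.add_sum_erase F _ he, ← Finset.add_sum_erase F _ he, vertexEnergy_mk]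
        have hm : 0 ≤ ∑ e ∈ F.erase s(x, y), (Γ.len e : ℝ) :=
          Finset.sum_nonneg fun _ _ => NNReal.coe_nonneg _
        set m := ∑ e ∈ F.erase s(x, y), (Γ.len e : ℝ)
        have h1 := fun φ => hv.flux_le hadj.symm φ
        rw [Sym2.eq_swap, edgeEnergy_comm] at h1
        have hL : (0 : ℝ) ≤ Γ.len s(x, y) := NNReal.coe_nonneg _
        set L := (Γ.len s(x, y) : ℝ)
        have hxM : v x ≤ M := hM x hx
        rcases le_total (v y) M with hyM | hyM
        · rw [max_eq_left hyM] at hF'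
          have h2 := h1 0
          have h3 : 0 ≤ L * m * (L + m) := by positivity
          nlinarith [mul_le_mul_of_nonneg_left hxM hL]
        · rw [max_eq_right hyM] at hF'
          -- Now y bounds the values on the enlarged set, and the other edges, of length m, count as
          -- a Neumann edge at y. Their flux m enters the edge to x, the terms at y cancel and the
          -- cubes telescope.
          have h2 := h1 m
          nlinarith [mul_le_mul_of_nonneg_left hxM (add_nonneg hm hL)]
      · rw [mem_insert_iff, not_or] at hi
        refine Finset.mem_erase.2 ⟨fun h => ?_, hFX i j hij hi.2⟩
        rcases Sym2.eq_iff.1 h with h | h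
        · exact hi.2 (h.1 ▸ hx)
        · exact hi.1 h.1
      · rintro i (rfl | hi)
        · exact le_max_right _ _
        · exact (hM i hi).trans (le_max_left _ _)

/-- In the case of equality, the part of the graph outside is a single edge. -/
theorem eq_singleton_of_sum_vertexEnergy_le (hc : Γ.graph.Connected)
    (hpos : ∀ i j, Γ.graph.Adj i j → 0 < Γ.len s(i, j)) (n : ℕ) :
    ∀ (X : Set (Fin N)) (F : Finset (Sym2 (Fin N))) (M : ℝ), F.card = n → X.Nonempty →
      F ⊆ Γ.edgeSet' → (∀ i j, Γ.graph.Adj i j → i ∉ X → s(i, j) ∈ F) → (∀ i ∈ X, v i ≤ M) →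
      0 ≤ M → (∀ i ∉ X, (Γ.graph.neighborSet i).ncard = 2 → v i = 0) →
      ∑ e ∈ F, Γ.vertexEnergy v e ≤
        -M * (∑ e ∈ F, (Γ.len e : ℝ)) - (∑ e ∈ F, (Γ.len e : ℝ)) ^ 3 / 6 →
      F = ∅ ∨ ∃ x ∈ X, ∃ y ∉ X, F = {s(x, y)} ∧ v x = M ∧ M < v y := by
  classical
  have hv : Γ.Compatible v := fun i j h h0 => absurd h0 (hpos i j h).ne'
  induction n with
  | zero =>
    intro X F M hF _ _ _ _ _ _ _
    exact Or.inl (Finset.card_eq_zero.1 hF)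
  | succ n ih =>
    intro X F M hF hX hFe hFX hM hM0 hdeg hle
    right
    by_cases hXu : X = univ
    · exfalso
      obtain ⟨e, he⟩ : F.Nonempty := Finset.card_pos.1 (by omega)
      induction e with | _ x y
      have hadj := mem_edgeSet'.1 (hFe he)
      have hF' := neg_sub_cube_le_sum_vertexEnergy hc hv _ X (F.erase s(x, y)) M rfl hX
        ((Finset.erase_subset _ _).trans hFe) (fun i _ _ hi => absurd (hXu ▸ mem_univ i) hi) hM
      rw [← Finset.add_sum_erase F _ he, ← Finset.add_sum_erase F _ he, vertexEnergy_mk] at hle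
      have hL : (0 : ℝ) < Γ.len s(x, y) := hpos x y hadj
      -- The symmetric flux -L/2 costs L³/24 instead of L³/6, so the bound becomes strict and
      -- equality is excluded.
      have h1 := hv.flux_le hadj (-(Γ.len s(x, y) : ℝ) / 2)
      have hm : 0 ≤ ∑ e ∈ F.erase s(x, y), (Γ.len e : ℝ) :=
        Finset.sum_nonneg fun _ _ => NNReal.coe_nonneg _
      set m := ∑ e ∈ F.erase s(x, y), (Γ.len e : ℝ)
      set L := (Γ.len s(x, y) : ℝ)
      have hy : v y ≤ M := hM y (hXu ▸ mem_univ y)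
      have hx : v x ≤ M := hM x (hXu ▸ mem_univ x)
      have h3 : 0 ≤ L * m * (L + m) := by positivity
      have h4 : 0 < L ^ 3 := by positivity
      nlinarith [mul_le_mul_of_nonneg_left hy hL.le, mul_le_mul_of_nonneg_left hx hL.le]
    · obtain ⟨x, hx, y, hy, hadj⟩ := exists_boundary_adj hc hX hXu
      have he : s(x, y) ∈ F := Sym2.eq_swap (a := y) ▸ hFX y x hadj.symm hy
      have hFX' : ∀ i j, Γ.graph.Adj i j → i ∉ insert y X → s(i, j) ∈ F.erase s(x, y) := by
        intro i j hij hi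
        rw [mem_insert_iff, not_or] at hi
        refine Finset.mem_erase.2 ⟨fun h => ?_, hFX i j hij hi.2⟩
        rcases Sym2.eq_iff.1 h with h | h
        · exact hi.2 (h.1 ▸ hx)
        · exact hi.1 h.1
      have hM' : ∀ i ∈ insert y X, v i ≤ max M (v y) := by
        rintro i (rfl | hi)
        · exact le_max_right _ _
        · exact (hM i hi).trans (le_max_left _ _)
      have hF' := neg_sub_cube_le_sum_vertexEnergy hc hv _ (insert y X) (F.erase s(x, y))
        (max M (v y)) rfl (insert_nonempty _ _) ((Finset.erase_subset _ _).trans hFe) hFX' hM'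
      have ih' := ih (insert y X) (F.erase s(x, y)) (max M (v y))
        (by rw [Finset.card_erase_of_mem he]; omega) (insert_nonempty _ _)
        ((Finset.erase_subset _ _).trans hFe) hFX' hM' (hM0.trans (le_max_left _ _))
        (fun i hi => hdeg i fun h => hi (mem_insert_of_mem _ h))
      rw [← Finset.add_sum_erase F _ he, ← Finset.add_sum_erase F _ he, vertexEnergy_mk] at hle
      have hm : 0 ≤ ∑ e ∈ F.erase s(x, y), (Γ.len e : ℝ) :=
        Finset.sum_nonneg fun _ _ => NNReal.coe_nonneg _
      set m := ∑ e ∈ F.erase s(x, y), (Γ.len e : ℝ)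
      have h1 := fun φ => hv.flux_le hadj.symm φ
      rw [Sym2.eq_swap, edgeEnergy_comm] at h1
      have hL : (0 : ℝ) < Γ.len s(x, y) := hpos x y hadj
      set L := (Γ.len s(x, y) : ℝ)
      have hxM : v x ≤ M := hM x hx
      rcases le_or_gt (v y) M with hyM | hyM
      · exfalso
        rw [max_eq_left hyM] at hF'
        have h2 := h1 (-L / 2)
        have h3 : 0 ≤ L * m * (L + m) := by positivity
        have h4 : 0 < L ^ 3 := by positivity
        nlinarith [mul_le_mul_of_nonneg_left hyM hL.le, mul_le_mul_of_nonneg_left hxM hL.le]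
      · rw [max_eq_right hyM.le] at hF' ih'
        have h2 := h1 m
        have hxM' : v x = M := by
          refine le_antisymm hxM (le_of_not_gt fun hlt => ?_)
          nlinarith [mul_lt_mul_of_pos_left hlt (add_pos_of_nonneg_of_pos hm hL)]
        rcases ih' (by rw [hxM'] at h2 hle; linarith) with h | ⟨x', hx', y', hy', h, hx'v, hy'v⟩
        · refine ⟨x, hx, y, hy, ?_, hxM', hyM⟩
          rw [← Finset.insert_erase he, h]; rfl
        · exfalso
          rcases hx' with rfl | hx'
          -- If the last edge starts at the newly added vertex, that vertex has exactly two
          -- neighbours, so its value is 0; but the value exceeds M ≥ 0.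
          · have hns : Γ.graph.neighborSet x' = {x, y'} := by
              ext j
              rw [SimpleGraph.mem_neighborSet]
              constructor
              · intro hj
                have := hFX x' j hj hy
                rw [← Finset.insert_erase he, h, Finset.mem_insert, Finset.mem_singleton] at this
                rcases this with h | h
                · rcases Sym2.eq_iff.1 h with h | h
                  · exact absurd h.1 hadj.ne'
                  · exact Or.inl h.2
                · rcases Sym2.eq_iff.1 h with h | h
                  · exact Or.inr h.2
                  · exact absurd (h.1 ▸ mem_insert _ _) hy'
              · rintro (rfl | rfl)
                · exact hadj.symm
                · have : s(x', j) ∈ F.erase s(x, x') := h ▸ Finset.mem_singleton_self _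
                  exact mem_edgeSet'.1 (hFe (Finset.mem_of_mem_erase this))
            have hne : x ≠ y' := fun h => hy' (h ▸ mem_insert_of_mem _ hx)
            have := hdeg x' hy (by rw [hns, Set.ncard_pair hne])
            linarith
          · linarith [hM x' hx']

end MetricGraph

/-! ### Tripods and the flux bound for the whole graph -/

theorem Fin.sum_univ_three_of_ne {M : Type*} [AddCommMonoid M] {i j k : Fin 3} (hij : i ≠ j)
    (hik : i ≠ k) (hjk : j ≠ k) (f : Fin 3 → M) : ∑ a, f a = f i + f j + f k := by
  have : (Finset.univ : Finset (Fin 3)) = {i, j, k} := by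
    revert i j k; decide
  rw [this, Finset.sum_insert (by simp [hij, hik]), Finset.sum_pair hjk, add_assoc]

/-- Three times the dual energy of a segment of length `a` with flux `α` at the inner end is
`(α + a) ^ 3 - α ^ 3`. -/
noncomputable def legCost (a α : ℝ) : ℝ := ((α + a) ^ 3 - α ^ 3) / 3

namespace MetricGraph

variable {N : ℕ}

/-- Three paths with a common starting point and otherwise disjoint. -/
structure Tripod (Γ : MetricGraph N) (w : Fin 3 → Fin N) where
  /-- the common starting point -/
  center : Fin N
  /-- the paths -/
  leg : ∀ i, Γ.graph.Walk center (w i)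
  isPath : ∀ i, (leg i).IsPath
  eq_center : ∀ i j, i ≠ j → ∀ x ∈ (leg i).support, x ∈ (leg j).support → x = center

/-- Take a path from w₀ to w₁, its vertex c nearest to w₂, and a shortest walk from c to w₂. This
walk meets the path only at c, since a later meeting point would be nearer. Legs may be trivial. -/
theorem exists_tripod {Γ : MetricGraph N} (hc : Γ.graph.Connected) (w : Fin 3 → Fin N) :
    Nonempty (Γ.Tripod w) := by
  classical
  obtain ⟨P, hP⟩ := (hc.preconnected (w 0) (w 1)).exists_isPath
  obtain ⟨c, hcP, hmin⟩ := P.support.toFinset.exists_min_image (fun x => Γ.graph.dist x (w 2))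
    ⟨w 0, by simp⟩
  rw [List.mem_toFinset] at hcP
  obtain ⟨q, hq⟩ := hc.exists_walk_length_eq_dist c (w 2)
  have hqp : q.IsPath := q.isPath_of_length_eq_dist hq
  have hqP : ∀ x ∈ q.support, x ∈ P.support → x = c := by
    intro x hx hxP
    by_contra hne
    have h1 := SimpleGraph.Walk.length_dropUntil_lt_length hx hne
    have h2 := hmin x (by simpa using hxP)
    have h3 := SimpleGraph.dist_le (q.dropUntil x hx)
    omega
  have hPP : ∀ x ∈ (P.takeUntil c hcP).support, x ∈ (P.dropUntil c hcP).support → x = c := by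
    intro x hx hx'
    by_contra hne
    have hpath : ((P.takeUntil c hcP).append (P.dropUntil c hcP)).IsPath := by
      rwa [SimpleGraph.Walk.take_spec]
    exact hpath.ne_of_mem_support_of_append hne hx hx' rfl
  have h0 := P.support_takeUntil_subset_support hcP
  have h1 := P.support_dropUntil_subset_support hcP
  let legs : ∀ i, Γ.graph.Walk c (w i) := fun i => match i with
    | 0 => (P.takeUntil c hcP).reverse
    | 1 => P.dropUntil c hcP
    | 2 => q
  refine ⟨⟨c, legs, ?_, ?_⟩⟩
  · intro i
    fin_cases i
    · exact (hP.takeUntil hcP).reverse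
    · exact hP.dropUntil hcP
    · exact hqp
  · have s0 : ∀ x, x ∈ (legs 0).support ↔ x ∈ (P.takeUntil c hcP).support := by
      intro x; simp [legs]
    have s1 : ∀ x, x ∈ (legs 1).support ↔ x ∈ (P.dropUntil c hcP).support := fun x => Iff.rfl
    have s2 : ∀ x, x ∈ (legs 2).support ↔ x ∈ q.support := fun x => Iff.rfl
    intro i j hij x hi hj
    fin_cases i <;> fin_cases j <;>
      simp only [Fin.zero_eta, Fin.mk_one, Fin.reduceFinMk, s0, s1, s2, ne_eq, not_true_eq_false]
        at hij hi hj
    · exact hPP x hi hj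
    · exact hqP x hj (h0 hi)
    · exact hPP x hj hi
    · exact hqP x hj (h1 hi)
    · exact hqP x hi (h0 hj)
    · exact hqP x hi (h1 hj)

namespace Tripod

variable {Γ : MetricGraph N} {w : Fin 3 → Fin N} (T : Γ.Tripod w)

/-- The vertices of the tripod. -/
def verts : Set (Fin N) := {x | ∃ i, x ∈ (T.leg i).support}

/-- The edges which do not belong to the tripod. -/
noncomputable def rest : Finset (Sym2 (Fin N)) := by
  classical exact Γ.edgeSet' \ Finset.univ.biUnion fun i => (T.leg i).edges.toFinset

/-- The total length of the edges which do not belong to the tripod. -/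
noncomputable def restLength : ℝ := ∑ e ∈ T.rest, (Γ.len e : ℝ)

theorem rest_subset : T.rest ⊆ Γ.edgeSet' := by
  classical exact Finset.sdiff_subset

theorem center_mem_verts : T.center ∈ T.verts := ⟨0, SimpleGraph.Walk.start_mem_support _⟩

theorem mem_rest_or {e : Sym2 (Fin N)} (he : e ∈ Γ.edgeSet') :
    e ∈ T.rest ∨ ∃ i, e ∈ (T.leg i).edges := by
  classical
  by_cases h : ∃ i, e ∈ (T.leg i).edges
  · exact Or.inr h
  · left
    unfold rest
    simp only [Finset.mem_sdiff, Finset.mem_biUnion, Finset.mem_univ, true_and,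
      List.mem_toFinset]
    exact ⟨he, h⟩

theorem mem_rest_of_notMem {i j : Fin N} (h : Γ.graph.Adj i j) (hi : i ∉ T.verts) :
    s(i, j) ∈ T.rest := by
  rcases T.mem_rest_or (mem_edgeSet'.2 h) with h | ⟨a, ha⟩
  · exact h
  · exact absurd ⟨a, SimpleGraph.Walk.fst_mem_support_of_mem_edges _ ha⟩ hi

theorem sum_edgeSet' (f : Sym2 (Fin N) → ℝ) :
    ∑ e ∈ Γ.edgeSet', f e = ∑ e ∈ T.rest, f e + ∑ i, ((T.leg i).edges.map f).sum := by
  classical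
  have hsub : (Finset.univ.biUnion fun i => (T.leg i).edges.toFinset) ⊆ Γ.edgeSet' := by
    intro e he
    simp only [Finset.mem_biUnion, Finset.mem_univ, true_and, List.mem_toFinset] at he
    obtain ⟨i, hi⟩ := he
    induction e with | _ x y
    exact mem_edgeSet'.2 ((T.leg i).adj_of_mem_edges hi)
  rw [← Finset.sum_sdiff hsub]
  congr 1
  rw [Finset.sum_biUnion]
  · refine Finset.sum_congr rfl fun i _ => ?_
    rw [List.sum_toFinset _ (T.isPath i).isTrail.edges_nodup]
  · intro i _ j _ hij
    rw [Function.onFun, Finset.disjoint_left]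
    intro e hi hj
    rw [List.mem_toFinset] at hi hj
    induction e with | _ x y
    have hx := T.eq_center i j hij x (SimpleGraph.Walk.fst_mem_support_of_mem_edges _ hi)
      (SimpleGraph.Walk.fst_mem_support_of_mem_edges _ hj)
    have hy := T.eq_center i j hij y (SimpleGraph.Walk.snd_mem_support_of_mem_edges _ hi)
      (SimpleGraph.Walk.snd_mem_support_of_mem_edges _ hj)
    exact ((T.leg i).adj_of_mem_edges hi).ne (hx.trans hy.symm)

theorem length_eq : Γ.length = T.restLength + ∑ i, Γ.walkLength (T.leg i) := by
  rw [MetricGraph.length_eq, T.sum_edgeSet']; rfl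

theorem restLength_nonneg : 0 ≤ T.restLength := Finset.sum_nonneg fun _ _ => NNReal.coe_nonneg _

theorem rest_le (hc : Γ.graph.Connected) {v : Fin N → ℝ} (hv : Γ.Compatible v) {M : ℝ}
    (hM : ∀ x ∈ T.verts, v x ≤ M) :
    -M * T.restLength - T.restLength ^ 3 / 6 ≤ ∑ e ∈ T.rest, Γ.vertexEnergy v e :=
  neg_sub_cube_le_sum_vertexEnergy hc hv _ T.verts T.rest M rfl ⟨_, T.center_mem_verts⟩
    T.rest_subset (fun _ _ h hi => T.mem_rest_of_notMem h hi) hM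

variable {T} {i j k : Fin 3} {p : Fin N} {q₁ : Γ.graph.Walk T.center p}
  {q₂ : Γ.graph.Walk p (w i)} {v : Fin N → ℝ} {α : Fin 3 → ℝ}

/-- The lower bound for the energy given by a flux on the tripod, when the remaining edges are
replaced by a Neumann edge at the vertex `p` of the leg `i`. -/
theorem cost_le_sum_vertexEnergy (hv : Γ.Compatible v)
    (hij : i ≠ j) (hik : i ≠ k) (hjk : j ≠ k) (hw : ∀ a, v (w a) = 0)
    (hq : T.leg i = q₁.append q₂)
    (h0 : -v p * T.restLength - T.restLength ^ 3 / 6 ≤ ∑ e ∈ T.rest, Γ.vertexEnergy v e)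
    (hα : α i + α j + α k = T.restLength) :
    -(1 / 2) * (T.restLength ^ 3 / 3 + (legCost (Γ.walkLength (T.leg i)) (α i)
        + legCost (Γ.walkLength (T.leg j)) (α j) + legCost (Γ.walkLength (T.leg k)) (α k))
        + T.restLength * (Γ.walkLength q₁ * (T.restLength - 2 * α i - Γ.walkLength q₁))) ≤
      ∑ e ∈ Γ.edgeSet', Γ.vertexEnergy v e := by
  -- The flux r of the Neumann edge divides at p: r - α i - τ starts towards the centre, with τ the
  -- length of `q₁`, and α i + τ starts outwards. The centre receives r - α i = α j + α k. Hence v p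
  -- and the value at the centre drop out of the sum.
  have h1 := flux_le_walkEnergy hv q₁.reverse (T.restLength - α i - Γ.walkLength q₁)
  have h2 := flux_le_walkEnergy hv q₂ (α i + Γ.walkLength q₁)
  have h3 := flux_le_walkEnergy hv (T.leg j) (α j)
  have h4 := flux_le_walkEnergy hv (T.leg k) (α k)
  rw [walkLength_reverse, walkEnergy_reverse] at h1
  have hs := T.sum_edgeSet' (Γ.vertexEnergy v)
  rw [Fin.sum_univ_three_of_ne hij hik hjk] at hs
  have he : ((T.leg i).edges.map (Γ.vertexEnergy v)).sum
      = Γ.walkEnergy v q₁ + Γ.walkEnergy v q₂ := by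
    rw [← walkEnergy_append, ← hq]; rfl
  have hl : Γ.walkLength (T.leg i) = Γ.walkLength q₁ + Γ.walkLength q₂ := by
    rw [← walkLength_append, ← hq]
  rw [he] at hs
  rw [hs, hl]
  simp only [hw] at h2 h3 h4
  change Γ.walkEnergy v (T.leg j) ≥ _ at h3
  change Γ.walkEnergy v (T.leg k) ≥ _ at h4
  change _ ≤ _ + (Γ.walkEnergy v q₁ + Γ.walkEnergy v q₂ + Γ.walkEnergy v (T.leg j)
    + Γ.walkEnergy v (T.leg k))
  have hk : α k = T.restLength - α i - α j := by linarith
  have h5 := add_le_add h0 (add_le_add (add_le_add h1 h2) (add_le_add h3 h4))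
  unfold legCost
  rw [hk] at h5 ⊢
  refine le_trans (le_of_eq ?_) (h5.trans (le_of_eq ?_)) <;> ring

/-- In the case of equality the bounds for the parts of the graph are equalities. -/
theorem tight_of_sum_vertexEnergy_le (hv : Γ.Compatible v)
    (hij : i ≠ j) (hik : i ≠ k) (hjk : j ≠ k) (hw : ∀ a, v (w a) = 0)
    (hq : T.leg i = q₁.append q₂)
    (h0 : -v p * T.restLength - T.restLength ^ 3 / 6 ≤ ∑ e ∈ T.rest, Γ.vertexEnergy v e)
    (hα : α i + α j + α k = T.restLength)
    (hle : ∑ e ∈ Γ.edgeSet', Γ.vertexEnergy v e ≤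
      -(1 / 2) * (T.restLength ^ 3 / 3 + (legCost (Γ.walkLength (T.leg i)) (α i)
        + legCost (Γ.walkLength (T.leg j)) (α j) + legCost (Γ.walkLength (T.leg k)) (α k))
        + T.restLength * (Γ.walkLength q₁ * (T.restLength - 2 * α i - Γ.walkLength q₁)))) :
    (∑ e ∈ T.rest, Γ.vertexEnergy v e ≤ -v p * T.restLength - T.restLength ^ 3 / 6) ∧
    (let φ := T.restLength - α i - Γ.walkLength q₁;
      Γ.walkEnergy v q₁.reverse ≤ φ * v p - (φ + Γ.walkLength q₁.reverse) * v T.center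
        - ((φ + Γ.walkLength q₁.reverse) ^ 3 - φ ^ 3) / 6) ∧
    (let φ := α i + Γ.walkLength q₁;
      Γ.walkEnergy v q₂ ≤ φ * v p - (φ + Γ.walkLength q₂) * v (w i)
        - ((φ + Γ.walkLength q₂) ^ 3 - φ ^ 3) / 6) ∧
    (Γ.walkEnergy v (T.leg j) ≤ α j * v T.center - (α j + Γ.walkLength (T.leg j)) * v (w j)
        - ((α j + Γ.walkLength (T.leg j)) ^ 3 - α j ^ 3) / 6) ∧
    (Γ.walkEnergy v (T.leg k) ≤ α k * v T.center - (α k + Γ.walkLength (T.leg k)) * v (w k)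
        - ((α k + Γ.walkLength (T.leg k)) ^ 3 - α k ^ 3) / 6) := by
  have h1 := flux_le_walkEnergy hv q₁.reverse (T.restLength - α i - Γ.walkLength q₁)
  have h2 := flux_le_walkEnergy hv q₂ (α i + Γ.walkLength q₁)
  have h3 := flux_le_walkEnergy hv (T.leg j) (α j)
  have h4 := flux_le_walkEnergy hv (T.leg k) (α k)
  have hs := T.sum_edgeSet' (Γ.vertexEnergy v)
  rw [Fin.sum_univ_three_of_ne hij hik hjk] at hs
  have he : ((T.leg i).edges.map (Γ.vertexEnergy v)).sum
      = Γ.walkEnergy v q₁.reverse + Γ.walkEnergy v q₂ := by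
    rw [walkEnergy_reverse, ← walkEnergy_append, ← hq]; rfl
  have hl : Γ.walkLength (T.leg i) = Γ.walkLength q₁ + Γ.walkLength q₂ := by
    rw [← walkLength_append, ← hq]
  rw [he] at hs
  change _ = _ + (Γ.walkEnergy v q₁.reverse + Γ.walkEnergy v q₂ + Γ.walkEnergy v (T.leg j)
    + Γ.walkEnergy v (T.leg k)) at hs
  rw [hs, hl] at hle
  have hk : α k = T.restLength - α i - α j := by linarith
  unfold legCost at hle
  simp only [hw, walkLength_reverse] at h1 h2 h3 h4 ⊢
  rw [hk] at h4 hle ⊢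
  refine ⟨?_, ?_, ?_, ?_, ?_⟩ <;> linarith only [h0, h1, h2, h3, h4, hle]

end Tripod

/-- The distance of the images of the ends is bounded by the length of the walk. -/
theorem Fun.IsImmersion.dist_le_walkLength {Γ : MetricGraph N} {γ : Γ.Fun Plane}
    (hγ : γ.IsImmersion) {x y : Fin N} (p : Γ.graph.Walk x y) :
    dist (γ.vert x) (γ.vert y) ≤ Γ.walkLength p := by
  induction p with
  | nil => simp
  | @cons a b _ h p ih =>
    rw [walkLength_cons]
    refine (dist_triangle _ (γ.vert b) _).trans (add_le_add ?_ ih)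
    have h1 := (hγ a b h).2.2
    have h0 : (0 : ℝ) ≤ Γ.len s(a, b) := NNReal.coe_nonneg _
    have hl : (0 : ℝ) ∈ Icc (0 : ℝ) (Γ.len s(a, b)) := ⟨le_rfl, h0⟩
    have hr : (Γ.len s(a, b) : ℝ) ∈ Icc (0 : ℝ) (Γ.len s(a, b)) := ⟨h0, le_rfl⟩
    have h2 := h1 hl hr
    rw [inter_self, NNReal.coe_one, one_mul, sub_zero] at h2
    have h3 := eVariationOn.edist_le (γ.edge a b) hl hr
    rw [h2, γ.edge_zero a b h, γ.edge_len h, edist_dist] at h3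
    exact (ENNReal.ofReal_le_ofReal_iff h0).1 h3

end MetricGraph

/-! ### Choice of the fluxes -/

/-- The value of twice the dual energy for a tree of total length `l` with a Neumann edge of length
`r` in its best position, when two of the legs have length `m`. -/
noncomputable def treeBound (l m r : ℝ) : ℝ :=
  r ^ 3 / 4 + ((l - 2 * m) ^ 3 / 12 + m ^ 3 / 6 + m * l ^ 2 * (l - 2 * m) / (4 * (2 * l - 3 * m)))

/-- The distance of the best position of the Neumann edge on a leg of length `a` from the centre. -/
noncomputable def bestShift (l m a : ℝ) : ℝ := (a - m * l / (2 * l - 3 * m)) / 2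

/-- The flux into the leg of length `b`, when the other one has length `c` and the total flux is
`Q`. -/
noncomputable def splitFlux (Q b c : ℝ) : ℝ := (c * Q + (b + c) / 2 * (c - b)) / (b + c)

theorem splitFlux_add {Q b c : ℝ} (h : 0 < b + c) : splitFlux Q b c + splitFlux Q c b = Q := by
  unfold splitFlux; rw [add_comm c b, ← add_div]; field_simp; ring

/-- `splitFlux` makes bα + b²/2 equal on both legs, that is, both legs give the same value at the
centre; this minimizes the convex total cost. The right side is the cost of two legs of the mean
length, and the difference is an explicit nonnegative multiple of (b - c)². -/
theorem legCost_splitFlux_le {Q b c : ℝ} (h : 0 < b + c) (hQ : 0 ≤ Q) :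
    legCost b (splitFlux Q b c) + legCost c (splitFlux Q c b) ≤
      (b + c) / 4 * (Q + (b + c) / 2) ^ 2 + ((b + c) / 2) ^ 3 / 6 := by
  have : legCost b (splitFlux Q b c) + legCost c (splitFlux Q c b)
      = (b + c) / 4 * (Q + (b + c) / 2) ^ 2 + ((b + c) / 2) ^ 3 / 6
        - (b - c) ^ 2 * Q * (Q + (b + c)) / (4 * (b + c)) := by
    unfold legCost splitFlux; rw [add_comm c b]; field_simp; ring
  rw [this]
  have : 0 ≤ (b - c) ^ 2 * Q * (Q + (b + c)) / (4 * (b + c)) := by positivity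
  linarith

/-- The left side is the flux that reaches the centre from the leg with the Neumann edge. For m < l
it is nonnegative exactly when 3m ≤ l, which is the origin of that condition below. -/
theorem half_add_bestShift {l m a r : ℝ} (hy : 0 < 2 * l - 3 * m) (hl : l = r + a + 2 * m) :
    r / 2 + bestShift l m a = (l - m) * (l - 3 * m) / (2 * l - 3 * m) := by
  obtain ⟨y, rfl⟩ : ∃ y, l = (y + 3 * m) / 2 := ⟨2 * l - 3 * m, by ring⟩
  have hyy : 2 * ((y + 3 * m) / 2) - 3 * m = y := by ring
  obtain rfl : r = (y + 3 * m) / 2 - a - 2 * m := by linarith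
  rw [hyy] at hy
  have := hy.ne'
  unfold bestShift; rw [hyy]; field_simp; ring

/-- After eliminating a, the cost separates into a cubic in r and a function of l and m alone. -/
theorem cost_eq_treeBound {l m a r : ℝ} (hy : 0 < 2 * l - 3 * m) (hl : l = r + a + 2 * m) :
    r ^ 3 / 3 + (legCost a (r / 2 - bestShift l m a)
      + (m / 2 * (r / 2 + bestShift l m a + m) ^ 2 + m ^ 3 / 6)) + r * bestShift l m a ^ 2
      = treeBound l m r := by
  -- Making the denominator 2l - 3m a variable turns the claim into a simple rational identity.
  obtain ⟨y, rfl⟩ : ∃ y, l = (y + 3 * m) / 2 := ⟨2 * l - 3 * m, by ring⟩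
  have hyy : 2 * ((y + 3 * m) / 2) - 3 * m = y := by ring
  obtain rfl : r = (y + 3 * m) / 2 - a - 2 * m := by linarith
  rw [hyy] at hy
  have := hy.ne'
  unfold legCost bestShift treeBound; rw [hyy]; field_simp; ring

theorem cost_le_treeBound {l a b c r : ℝ} (hbc : 0 < b + c)
    (hl : l = r + a + b + c) (h3 : 3 * ((b + c) / 2) ≤ l) :
    r ^ 3 / 3 + (legCost a (r / 2 - bestShift l ((b + c) / 2) a)
      + legCost b (splitFlux (r / 2 + bestShift l ((b + c) / 2) a) b c)
      + legCost c (splitFlux (r / 2 + bestShift l ((b + c) / 2) a) c b))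
      + r * bestShift l ((b + c) / 2) a ^ 2 ≤ treeBound l ((b + c) / 2) r := by
  have hy : 0 < 2 * l - 3 * ((b + c) / 2) := by linarith
  have hl' : l = r + a + 2 * ((b + c) / 2) := by linarith
  rw [← cost_eq_treeBound hy hl']
  have hQ : 0 ≤ r / 2 + bestShift l ((b + c) / 2) a := by
    rw [half_add_bestShift hy hl']
    refine div_nonneg (mul_nonneg ?_ ?_) hy.le <;> linarith
  have := legCost_splitFlux_le hbc hQ
  linarith

/-- This is for a Neumann edge on the leg of length b when the flux used is the one adapted to the
longer leg a. By `h3` the flux adapted to b itself would be negative at the centre. The conclusion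
says that the flux into b is at least r/2 - t, with t the best shift on a, as `shift_cost_le`
requires. -/
theorem le_add_splitFlux {l a b c r : ℝ} (hc : 0 ≤ c) (hr : 0 ≤ r)
    (hbc : 0 < b + c) (hac : c ≤ a) (hl : l = r + a + b + c)
    (h3 : l < 3 * ((a + c) / 2)) :
    let Q := r / 2 + bestShift l ((b + c) / 2) a
    r ≤ Q + splitFlux Q b c ∧ (0 < r → r < Q + splitFlux Q b c) := by
  intro Q
  have hy : 0 < 2 * l - 3 * ((b + c) / 2) := by linarith
  have hl' : l = r + a + 2 * ((b + c) / 2) := by linarith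
  have hQ1 : r / 2 + (a - (b + c) / 2) / 2 ≤ Q := by
    have : Q = (l - (b + c) / 2) * (l - 3 * ((b + c) / 2)) / (2 * l - 3 * ((b + c) / 2)) :=
      half_add_bestShift hy hl'
    rw [this, le_div_iff₀ hy, hl']
    nlinarith [mul_nonneg hbc.le (by linarith : 0 ≤ a - (b + c) / 2), mul_nonneg hbc.le hr]
  rcases le_total b c with h | h
  · have h1 : Q / 2 + (c - b) / 2 ≤ splitFlux Q b c := by
      unfold splitFlux
      rw [le_div_iff₀ hbc]
      nlinarith [mul_nonneg (sub_nonneg.2 h) (by linarith : 0 ≤ Q)]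
    constructor
    · linarith
    · intro h; linarith
  · have h1 : (c - b) / 2 ≤ splitFlux Q b c := by
      unfold splitFlux
      rw [le_div_iff₀ hbc]
      nlinarith [mul_nonneg hc (by linarith : 0 ≤ Q)]
    constructor
    · linarith
    · intro h; linarith

/-- Since r - 2α ≤ 2t, the position τ contributes at most rτ(2t - τ), which is at most rt². -/
theorem shift_cost_le {r τ α t : ℝ} (hr : 0 ≤ r) (hτ : 0 ≤ τ) (h : r / 2 - t ≤ α) :
    r * (τ * (r - 2 * α - τ)) ≤ r * t ^ 2 := by
  refine mul_le_mul_of_nonneg_left ?_ hr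
  nlinarith [sq_nonneg (τ - t)]

theorem shift_cost_lt {r τ α t : ℝ} (hr : 0 < r) (hτ : 0 ≤ τ) (h : r / 2 - t < α) (ht : 0 ≤ t) :
    r * (τ * (r - 2 * α - τ)) < r * t ^ 2 ∨ t = 0 ∧ τ = 0 := by
  by_cases h0 : t = 0 ∧ τ = 0
  · exact Or.inr h0
  · left
    refine mul_lt_mul_of_pos_left ?_ hr
    rcases hτ.eq_or_lt with h1 | h1
    · subst h1
      have : 0 < t := lt_of_le_of_ne ht fun h => h0 ⟨h.symm, rfl⟩
      nlinarith
    · nlinarith [sq_nonneg (τ - t), mul_pos h1 (sub_pos.2 h)]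

theorem bestShift_nonneg {l m a : ℝ} (hm : 0 ≤ m) (hma : m ≤ a) (h3 : 3 * m ≤ l) (hl : 0 < l) :
    0 ≤ bestShift l m a := by
  unfold bestShift
  have hy : 0 < 2 * l - 3 * m := by linarith
  have : m * l / (2 * l - 3 * m) ≤ a := by
    rw [div_le_iff₀ hy]; nlinarith [mul_le_mul_of_nonneg_right hma hy.le]
  linarith

theorem Fin.exists_two_ne : ∀ i : Fin 3, ∃ k n : Fin 3, i ≠ k ∧ i ≠ n ∧ k ≠ n := by decide

theorem Fin.exists_ne_ne : ∀ i j : Fin 3, ∃ n : Fin 3, i ≠ n ∧ j ≠ n := by decide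

/-- The flux for the best position of the Neumann edge on one of the legs bounds the energy. -/
theorem exists_flux {a : Fin 3 → ℝ} {r l : ℝ} (ha : ∀ i, 0 ≤ a i) (hr : 0 ≤ r)
    (hpos : ∀ i j, i ≠ j → 0 < a i + a j) (hl : l = r + ∑ i, a i) (i : Fin 3) :
    ∃ j, ∃ α : Fin 3 → ℝ, ∑ k, α k = r ∧ 3 * ((l - r - a j) / 2) ≤ l ∧
      (∀ τ, 0 ≤ τ → r ^ 3 / 3 + ∑ k, legCost (a k) (α k) + r * (τ * (r - 2 * α i - τ)) ≤
        treeBound l ((l - r - a j) / 2) r) ∧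
      (j ≠ i → 0 < r → 0 < bestShift l ((l - r - a j) / 2) (a j) → ∀ τ, 0 ≤ τ →
        r ^ 3 / 3 + ∑ k, legCost (a k) (α k) + r * (τ * (r - 2 * α i - τ)) <
        treeBound l ((l - r - a j) / 2) r) := by
  have key : ∀ j k n : Fin 3, j ≠ k → j ≠ n → k ≠ n →
      3 * ((a k + a n) / 2) ≤ l → ∃ α : Fin 3 → ℝ, α j = r / 2 - bestShift l ((a k + a n) / 2) (a j)
        ∧ α k = splitFlux (r / 2 + bestShift l ((a k + a n) / 2) (a j)) (a k) (a n)
        ∧ ∑ i, α i = r ∧ r ^ 3 / 3 + ∑ i, legCost (a i) (α i)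
          + r * bestShift l ((a k + a n) / 2) (a j) ^ 2 ≤ treeBound l ((a k + a n) / 2) r := by
    intro j k n hjk hjn hkn h3
    set t := bestShift l ((a k + a n) / 2) (a j) with ht
    rw [Fin.sum_univ_three_of_ne hjk hjn hkn] at hl
    refine ⟨fun i => if i = j then r / 2 - t else if i = k then splitFlux (r / 2 + t) (a k) (a n)
      else splitFlux (r / 2 + t) (a n) (a k), by simp, by simp [hjk.symm], ?_, ?_⟩
    · rw [Fin.sum_univ_three_of_ne hjk hjn hkn]
      simp only [if_true, hjk.symm, hjn.symm, hkn.symm, if_false]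
      have := splitFlux_add (Q := r / 2 + t) (hpos k n hkn)
      linarith
    · rw [Fin.sum_univ_three_of_ne hjk hjn hkn]
      simp only [if_true, hjk.symm, hjn.symm, hkn.symm, if_false]
      exact cost_le_treeBound (hpos k n hkn) (by linarith) h3
  have hother : ∀ j k n : Fin 3, j ≠ k → j ≠ n → k ≠ n → (l - r - a j) / 2 = (a k + a n) / 2 := by
    intro j k n hjk hjn hkn
    rw [Fin.sum_univ_three_of_ne hjk hjn hkn] at hl
    linarith
  -- If the flux adapted to leg i is nonnegative at the centre, it is used. Otherwise the flux
  -- adapted to the longest leg also bounds Neumann edges on leg i.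
  by_cases h3 : 3 * ((l - r - a i) / 2) ≤ l
  · obtain ⟨k, n, hik, hin, hkn⟩ : ∃ k n : Fin 3, i ≠ k ∧ i ≠ n ∧ k ≠ n :=
      Fin.exists_two_ne i
    rw [hother i k n hik hin hkn] at h3
    obtain ⟨α, h1, _, h2, h4⟩ := key i k n hik hin hkn h3
    refine ⟨i, α, h2, ?_, fun τ hτ => ?_, fun h => absurd rfl h⟩
    · rwa [hother i k n hik hin hkn]
    · rw [hother i k n hik hin hkn, h1]
      refine le_trans (add_le_add_right ?_ _) h4
      refine mul_le_mul_of_nonneg_left ?_ hr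
      nlinarith [sq_nonneg (τ - bestShift l ((a k + a n) / 2) (a i))]
  · obtain ⟨j, -, hj⟩ := Finset.exists_max_image Finset.univ a ⟨0, Finset.mem_univ _⟩
    have hji : j ≠ i := by
      rintro rfl
      apply h3
      obtain ⟨k, n, hik, hin, hkn⟩ : ∃ k n : Fin 3, j ≠ k ∧ j ≠ n ∧ k ≠ n :=
        Fin.exists_two_ne j
      rw [hother j k n hik hin hkn]
      rw [Fin.sum_univ_three_of_ne hik hin hkn] at hl
      have := hj k (Finset.mem_univ _)
      have := hj n (Finset.mem_univ _)
      linarith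
    obtain ⟨n, hjn, hin⟩ : ∃ n : Fin 3, j ≠ n ∧ i ≠ n := Fin.exists_ne_ne j i
    rw [hother i j n hji.symm hin hjn, not_le] at h3
    have hl' := hl
    rw [Fin.sum_univ_three_of_ne hji hjn hin] at hl'
    have h1 := hj i (Finset.mem_univ _)
    have h2 := hj n (Finset.mem_univ _)
    have h4 : 3 * ((a i + a n) / 2) ≤ l := by linarith
    have h5 := hpos i n hin
    obtain ⟨α, hα1, hα2, hα3, hα4⟩ := key j i n hji hjn hin h4
    have h6 := le_add_splitFlux (ha n) hr h5 h2 (by linarith) h3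
    have h7 : 0 ≤ bestShift l ((a i + a n) / 2) (a j) :=
      bestShift_nonneg (by linarith) (by linarith) h4 (by linarith [ha j])
    simp only [← hα2] at h6
    refine ⟨j, α, hα3, ?_, fun τ hτ => ?_, fun _ hr' ht τ hτ => ?_⟩
    · rwa [hother j i n hji hjn hin]
    · rw [hother j i n hji hjn hin]
      refine le_trans (add_le_add_right ?_ _) hα4
      exact shift_cost_le hr hτ (by linarith [h6.1])
    · rw [hother j i n hji hjn hin] at ht ⊢
      refine lt_of_lt_of_le (add_lt_add_right ?_ _) hα4
      exact (shift_cost_lt hr' hτ (by linarith [h6.2 hr']) h7).resolve_right fun h => ht.ne' h.1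

/-! ### Optimization of the height -/

/-- The flux at the branch point as a function of the total length and the length of the legs. -/
noncomputable def branchFlux (l m : ℝ) : ℝ := (l - m) * (l - 3 * m) / (2 * l - 3 * m)

/-- The part of `treeBound` which does not depend on the length of the Neumann edge. -/
noncomputable def treeBoundZero (l m : ℝ) : ℝ :=
  (l - 2 * m) ^ 3 / 12 + m ^ 3 / 6 + m * l ^ 2 * (l - 2 * m) / (4 * (2 * l - 3 * m))

theorem treeBound_eq (l m r : ℝ) : treeBound l m r = r ^ 3 / 4 + treeBoundZero l m := rfl

theorem hasDerivAt_branchFlux {l m : ℝ} (h : 2 * l - 3 * m ≠ 0) :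
    HasDerivAt (branchFlux l) (-(5 * l ^ 2 - 12 * l * m + 9 * m ^ 2) / (2 * l - 3 * m) ^ 2) m := by
  have h1 := (((hasDerivAt_id m).const_sub l).mul (((hasDerivAt_id m).const_mul 3).const_sub l)).div
    (((hasDerivAt_id m).const_mul 3).const_sub (2 * l)) h
  refine h1.congr_deriv ?_
  simp only [id]
  congr 1
  simp; ring

theorem hasDerivAt_treeBoundZero {l m : ℝ} (h : 2 * l - 3 * m ≠ 0) :
    HasDerivAt (treeBoundZero l) (-(3 / 2) * branchFlux l m ^ 2) m := by
  have hid := hasDerivAt_id m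
  have h1 := ((((hid.const_mul 2).const_sub l).pow 3).div_const 12).add
    ((hid.pow 3).div_const 6)
  have h2 := ((hid.mul_const (l ^ 2)).mul ((hid.const_mul 2).const_sub l)).div
    (((hid.const_mul 3).const_sub (2 * l)).const_mul 4) (by simpa using h)
  refine ((h1.add h2).congr_deriv ?_)
  unfold branchFlux
  obtain ⟨y, rfl⟩ : ∃ y, l = (y + 3 * m) / 2 := ⟨2 * l - 3 * m, by ring⟩
  have hyy : 2 * ((y + 3 * m) / 2) - 3 * m = y := by ring
  rw [hyy] at h
  simp only [id, hyy]
  field_simp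
  norm_num
  ring

theorem treeBoundZero_antitone {l m m' : ℝ} (hl : 0 < l) (hm : m ≤ m') (h3 : 3 * m' ≤ l) :
    treeBoundZero l m' ≤ treeBoundZero l m := by
  have hne : ∀ x ∈ Icc m m', 2 * l - 3 * x ≠ 0 := fun x hx => by
    have := hx.2; intro h; linarith
  have : AntitoneOn (treeBoundZero l) (Icc m m') := by
    refine antitoneOn_of_deriv_nonpos (convex_Icc _ _)
      (fun x hx => (hasDerivAt_treeBoundZero (hne x hx)).continuousAt.continuousWithinAt)
      (fun x hx => (hasDerivAt_treeBoundZero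
        (hne x (interior_subset hx))).differentiableAt.differentiableWithinAt) fun x hx => ?_
    rw [(hasDerivAt_treeBoundZero (hne x (interior_subset hx))).deriv]
    nlinarith [sq_nonneg (branchFlux l x)]
  exact this ⟨le_rfl, hm⟩ ⟨hm, le_rfl⟩ hm

/-- The length of a side of the isosceles triangle with base `1` and height `w`. -/
noncomputable def sideLength (w : ℝ) : ℝ := √(w ^ 2 + 1 / 4)

theorem sideLength_sq (w : ℝ) : sideLength w ^ 2 = w ^ 2 + 1 / 4 := Real.sq_sqrt (by positivity)

theorem sideLength_pos (w : ℝ) : 0 < sideLength w := Real.sqrt_pos.2 (by positivity)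

theorem half_le_sideLength (w : ℝ) : 1 / 2 ≤ sideLength w := by
  nlinarith [sideLength_sq w, sideLength_pos w, sq_nonneg w]

theorem sideLength_le (w : ℝ) : sideLength w ≤ 1 / 2 + w ^ 2 := by
  nlinarith [sideLength_sq w, sideLength_pos w, sq_nonneg w, sq_nonneg (w ^ 2)]

theorem hasDerivAt_sideLength (w : ℝ) : HasDerivAt sideLength (w / sideLength w) w := by
  have h := (((hasDerivAt_id w).pow 2).add_const (1 / 4)).sqrt (by simp; positivity)
  refine h.congr_deriv ?_
  simp only [id, sideLength]
  have := (sideLength_pos w).ne'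
  unfold sideLength at this
  simp
  field_simp

theorem sqrt_three_sq : (√3 : ℝ) ^ 2 = 3 := Real.sq_sqrt (by norm_num)

theorem sqrt_three_pos : (0 : ℝ) < √3 := Real.sqrt_pos.2 (by norm_num)

theorem lt_sqrt_three : (1732 / 1000 : ℝ) < √3 := Real.lt_sqrt_of_sq_lt (by norm_num)

theorem sqrt_three_lt : (√3 : ℝ) < 17321 / 10000 := by
  rw [Real.sqrt_lt' (by norm_num)]; norm_num

/-- The height √3/6 belongs to the Fermat point, where the edges meet at 120°. Below it the Neumann
edge lengthens as w grows. -/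
theorem two_mul_lt_sideLength {w : ℝ} (h0 : 0 ≤ w) (h : w < √3 / 6) : 2 * w < sideLength w := by
  have := sideLength_sq w
  have := sideLength_pos w
  nlinarith [sqrt_three_sq, sqrt_three_pos]

/-- The length of the Neumann edge. -/
noncomputable def neumannLength (l w : ℝ) : ℝ := l - √3 / 2 - 2 * sideLength w + w

theorem hasDerivAt_neumannLength (l w : ℝ) :
    HasDerivAt (neumannLength l) ((sideLength w - 2 * w) / sideLength w) w := by
  have h := (((hasDerivAt_sideLength w).const_mul 2).const_sub (l - √3 / 2)).add (hasDerivAt_id w)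
  refine h.congr_deriv ?_
  have := (sideLength_pos w).ne'
  field_simp; ring

theorem neumannLength_strictMonoOn (l : ℝ) :
    StrictMonoOn (neumannLength l) (Icc 0 (√3 / 6)) := by
  refine strictMonoOn_of_deriv_pos (convex_Icc _ _)
      (fun x _ => (hasDerivAt_neumannLength l x).continuousAt.continuousWithinAt) fun x hx => ?_
  rw [interior_Icc] at hx
  rw [(hasDerivAt_neumannLength l x).deriv]
  have := two_mul_lt_sideLength hx.1.le hx.2
  exact div_pos (by linarith) (sideLength_pos x)

theorem sideLength_sqrt_three_div_six : sideLength (√3 / 6) = √3 / 3 := by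
  unfold sideLength
  rw [Real.sqrt_eq_iff_mul_self_eq (by positivity) (by positivity)]
  nlinarith [sqrt_three_sq]

theorem neumannLength_sqrt_three_div_six (l : ℝ) : neumannLength l (√3 / 6) = l - √3 := by
  unfold neumannLength; rw [sideLength_sqrt_three_div_six]; ring

theorem neumannLength_zero (l : ℝ) : neumannLength l 0 = l - (1 + √3 / 2) := by
  unfold neumannLength sideLength
  rw [show (0 : ℝ) ^ 2 + 1 / 4 = (1 / 2) ^ 2 by norm_num, Real.sqrt_sq (by norm_num)]; ring

/-- The quotient of fluxes at the critical point. -/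
noncomputable def criticalRatio (w : ℝ) : ℝ := √(2 * w / (sideLength w - 2 * w))

theorem hasDerivAt_criticalRatio {w : ℝ} (h0 : 0 < w) (h : w < √3 / 6) :
    HasDerivAt criticalRatio (1 / (4 * sideLength w * (sideLength w - 2 * w) ^ 2
      * criticalRatio w)) w := by
  have hM := sideLength_pos w
  have hM2 := sideLength_sq w
  have hn : 0 < sideLength w - 2 * w := by linarith [two_mul_lt_sideLength h0.le h]
  have h1 := (((hasDerivAt_id w).const_mul 2).div ((hasDerivAt_sideLength w).sub
    ((hasDerivAt_id w).const_mul 2)) hn.ne').sqrt (by simp; constructor <;> positivity)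
  refine h1.congr_deriv ?_
  simp only [id]
  change _ / (2 * criticalRatio w) = _
  have hS : 0 < criticalRatio w := Real.sqrt_pos.2 (by positivity)
  simp only [Pi.sub_apply, id] at *
  field_simp
  nlinarith

theorem continuousOn_criticalRatio : ContinuousOn criticalRatio (Ico 0 (√3 / 6)) := by
  intro w hw
  have hn : 0 < sideLength w - 2 * w := by linarith [two_mul_lt_sideLength hw.1 hw.2]
  refine ContinuousAt.continuousWithinAt ?_
  refine Real.continuous_sqrt.continuousAt.comp ?_
  exact (continuousAt_const.mul continuousAt_id).div
    ((hasDerivAt_sideLength w).continuousAt.sub (continuousAt_const.mul continuousAt_id)) hn.ne'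

/-- The difference of the two sides of the equation for the critical point. -/
noncomputable def criticalFun (l w : ℝ) : ℝ :=
  neumannLength l w - branchFlux l (sideLength w) * criticalRatio w

/-- A linear minorant in m for the relevant range: 1866/1000 is below 1 + √3/2, and 5834/10000 is
above √3/3. -/
theorem le_branchFlux {l m : ℝ} (hl : 1866 / 1000 ≤ l) (hm : 1 / 2 ≤ m) (hm' : m ≤ 5834 / 10000) :
    22 / 100 - 178 / 100 * (m - 1 / 2) ≤ branchFlux l m := by
  have hy : 0 < 2 * l - 3 * m := by linarith
  unfold branchFlux
  rw [le_div_iff₀ hy]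
  obtain ⟨e, he, rfl⟩ : ∃ e, 0 ≤ e ∧ l = 1866 / 1000 + e := ⟨l - 1866 / 1000, by linarith, by ring⟩
  nlinarith [mul_nonneg he (sub_nonneg.2 hm), mul_nonneg he (sub_nonneg.2 hm'),
    mul_nonneg (sub_nonneg.2 hm) (sub_nonneg.2 hm'), mul_nonneg he he]

/-- Positivity on [0, 29/100] is read off the Bernstein form of degree 6: all coefficients of w^k
(29/100 - w)^(6-k) are positive. -/
theorem cubic_bound {w : ℝ} (h0 : 0 ≤ w) (h1 : w ≤ 29 / 100) :
    4 / 3 * (1 / 2 + w ^ 2 - 2 * w) ^ 3 + 6 * w * (1 / 2 + w ^ 2 - 2 * w) ^ 2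
      + 152 / 10 * w ^ 2 * (1 / 2 + w ^ 2 - 2 * w) < 22 / 100 - 178 / 100 * w ^ 2 := by
  have h2 : 0 ≤ 29 / 100 - w := by linarith
  have key : 22 / 100 - 178 / 100 * w ^ 2 - (4 / 3 * (1 / 2 + w ^ 2 - 2 * w) ^ 3
      + 6 * w * (1 / 2 + w ^ 2 - 2 * w) ^ 2 + 152 / 10 * w ^ 2 * (1 / 2 + w ^ 2 - 2 * w)) =
      160000000000 / 1784469963 * (w ^ 0 * (29 / 100 - w) ^ 6) +
      465000000000 / 594823321 * (w ^ 1 * (29 / 100 - w) ^ 5) +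
      988442000000 / 594823321 * (w ^ 2 * (29 / 100 - w) ^ 4) +
      835451600000 / 594823321 * (w ^ 3 * (29 / 100 - w) ^ 3) +
      360632948000 / 594823321 * (w ^ 4 * (29 / 100 - w) ^ 2) +
      167781325800 / 594823321 * (w ^ 5 * (29 / 100 - w) ^ 1) +
      195094640116 / 1784469963 * (w ^ 6 * (29 / 100 - w) ^ 0) := by ring
  have : 0 < 22 / 100 - 178 / 100 * w ^ 2 - (4 / 3 * (1 / 2 + w ^ 2 - 2 * w) ^ 3
      + 6 * w * (1 / 2 + w ^ 2 - 2 * w) ^ 2 + 152 / 10 * w ^ 2 * (1 / 2 + w ^ 2 - 2 * w)) := by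
    rw [key]
    rcases h0.eq_or_lt with h | h
    · subst h; norm_num
    · positivity
  linarith

/-- Write n = M - 2w and let -K be the slope of the branch flux B in M. Since S²n = 2w, the
derivative has the sign of 4n³S + 8Kw²n - B. The estimates K ≤ 19/10, S ≤ 1/3 + (3/4)S², M ≤ 1/2 +
w² and `le_branchFlux` reduce its negativity to `cubic_bound`. -/
theorem criticalFun_strictAntiOn {l : ℝ} (hl : 1 + √3 / 2 ≤ l) :
    StrictAntiOn (criticalFun l) (Ico 0 (√3 / 6)) := by
  have h3 := lt_sqrt_three
  have h3' := sqrt_three_lt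
  have hder : ∀ w ∈ Ioo 0 (√3 / 6), ∃ d < 0, HasDerivAt (criticalFun l) d w := by
    intro w hw
    have hM := sideLength_pos w
    have hM2 := sideLength_sq w
    have hMl := half_le_sideLength w
    have hMu := sideLength_le w
    have hw0 := hw.1
    have hw1 : w ≤ 29 / 100 := by linarith [hw.2]
    have hMu' : sideLength w ≤ 5779 / 10000 := by
      have : sideLength w ^ 2 ≤ (5779 / 10000) ^ 2 := by
        rw [hM2]
        have h1 : w < 17321 / 60000 := by linarith [hw.2]
        nlinarith
      exact le_of_sq_le_sq this (by norm_num)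
    have hn : 0 < sideLength w - 2 * w := by linarith [two_mul_lt_sideLength hw.1.le hw.2]
    have hy : 0 < 2 * l - 3 * sideLength w := by linarith
    have hS : 0 < criticalRatio w := Real.sqrt_pos.2 (by positivity)
    have hS2 : criticalRatio w ^ 2 * (sideLength w - 2 * w) = 2 * w := by
      unfold criticalRatio
      rw [Real.sq_sqrt (by positivity)]; field_simp
    have hB := le_branchFlux (l := l) (by linarith) hMl (by linarith)
    refine ⟨_, ?_, (hasDerivAt_neumannLength l w).sub
      (((hasDerivAt_branchFlux hy.ne').comp w (hasDerivAt_sideLength w)).mul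
        (hasDerivAt_criticalRatio hw.1 hw.2))⟩
    simp only [Function.comp]
    have hslope : (5 * l ^ 2 - 12 * l * sideLength w + 9 * sideLength w ^ 2)
        / (2 * l - 3 * sideLength w) ^ 2 ≤ 19 / 10 := by
      rw [div_le_iff₀ (by positivity)]
      nlinarith
    have hcub := cubic_bound hw0.le hw1
    set M := sideLength w
    set S := criticalRatio w
    set B := branchFlux l M
    set K := (5 * l ^ 2 - 12 * l * M + 9 * M ^ 2) / (2 * l - 3 * M) ^ 2 with hK
    have hexp : (M - 2 * w) / M - (-(5 * l ^ 2 - 12 * l * M + 9 * M ^ 2) / (2 * l - 3 * M) ^ 2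
        * (w / M) * S + B * (1 / (4 * M * (M - 2 * w) ^ 2 * S)))
        = (4 * (M - 2 * w) ^ 3 * S + 4 * K * w * (S ^ 2 * (M - 2 * w)) * (M - 2 * w) - B)
          / (4 * M * (M - 2 * w) ^ 2 * S) := by
      rw [hK]; field_simp; ring
    rw [hexp]
    refine div_neg_of_neg_of_pos ?_ (by positivity)
    rw [hS2]
    have hn' : M - 2 * w ≤ 1 / 2 + w ^ 2 - 2 * w := by linarith
    have e1 : 4 * (M - 2 * w) ^ 3 * S ≤ 4 / 3 * (M - 2 * w) ^ 3 + 6 * w * (M - 2 * w) ^ 2 := by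
      have : 4 * (M - 2 * w) ^ 3 * S
          -- The square root is removed by (S - 2/3)² ≥ 0, so that only S², which is rational in M
          -- and w, remains.
          ≤ 4 * (M - 2 * w) ^ 3 * ((2 / 3 + 3 / 2 * S ^ 2) / 2) := by
        refine mul_le_mul_of_nonneg_left ?_ (by positivity)
        nlinarith [sq_nonneg (S - 2 / 3)]
      refine this.trans (le_of_eq ?_)
      have : 4 * (M - 2 * w) ^ 3 * ((2 / 3 + 3 / 2 * S ^ 2) / 2)
        = 4 / 3 * (M - 2 * w) ^ 3 + 3 * (S ^ 2 * (M - 2 * w)) * (M - 2 * w) ^ 2 := by ring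
      rw [this, hS2]; ring
    have e2 : 4 * K * w * (2 * w) * (M - 2 * w) ≤ 152 / 10 * w ^ 2 * (M - 2 * w) := by
      have : 0 ≤ w ^ 2 * (M - 2 * w) := by positivity
      nlinarith
    have e3 : (M - 2 * w) ^ 3 ≤ (1 / 2 + w ^ 2 - 2 * w) ^ 3 := pow_le_pow_left₀ hn.le hn' 3
    have e4 : (M - 2 * w) ^ 2 ≤ (1 / 2 + w ^ 2 - 2 * w) ^ 2 := pow_le_pow_left₀ hn.le hn' 2
    have e5 := mul_le_mul_of_nonneg_left e4 hw0.le
    have e6 := mul_le_mul_of_nonneg_left hn' (sq_nonneg w)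
    linarith
  refine strictAntiOn_of_deriv_neg (convex_Ico _ _) ?_ ?_
  · refine ContinuousOn.sub (fun w _ => (hasDerivAt_neumannLength l w).continuousAt.continuousWithinAt)
      (ContinuousOn.mul (fun w hw => ContinuousAt.continuousWithinAt ?_) continuousOn_criticalRatio)
    have hy : 2 * l - 3 * sideLength w ≠ 0 := by
      have h1 := sideLength_sq w
      have h2 : w < 17321 / 60000 := by linarith [hw.2]
      have : sideLength w ^ 2 < 1 := by rw [h1]; nlinarith [hw.1]
      have : sideLength w < 1 := by nlinarith [sideLength_pos w]
      intro h; linarith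
    exact ((hasDerivAt_branchFlux hy).comp w (hasDerivAt_sideLength w)).continuousAt
  · intro w hw
    rw [interior_Ico] at hw
    obtain ⟨d, hd, h⟩ := hder w hw
    rwa [h.deriv]

/-- The value of `treeBound` as a function of the height of the isosceles triangle. -/
noncomputable def heightBound (l w : ℝ) : ℝ := treeBound l (sideLength w) (neumannLength l w)

theorem sideLength_le_of_le {w : ℝ} (h0 : 0 ≤ w) (h : w ≤ √3 / 6) : sideLength w ≤ √3 / 3 := by
  rw [← sideLength_sqrt_three_div_six]
  exact Real.sqrt_le_sqrt (by nlinarith)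

theorem sideLength_lt_of_lt {w : ℝ} (h0 : 0 ≤ w) (h : w < √3 / 6) : sideLength w < √3 / 3 := by
  rw [← sideLength_sqrt_three_div_six]
  exact Real.sqrt_lt_sqrt (by positivity) (by nlinarith)

theorem hasDerivAt_heightBound {l w : ℝ} (hl : √3 ≤ l) (h0 : 0 ≤ w) (h : w ≤ √3 / 6) :
    HasDerivAt (heightBound l) (3 / (4 * sideLength w) *
      (neumannLength l w ^ 2 * (sideLength w - 2 * w)
        - 2 * w * branchFlux l (sideLength w) ^ 2)) w := by
  have hM := sideLength_le_of_le h0 h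
  have hy : 2 * l - 3 * sideLength w ≠ 0 := by
    intro h; linarith [sqrt_three_pos]
  have h1 := (((hasDerivAt_neumannLength l w).pow 3).div_const 4).add
    ((hasDerivAt_treeBoundZero hy).comp w (hasDerivAt_sideLength w))
  refine h1.congr_deriv ?_
  have := (sideLength_pos w).ne'
  field_simp; norm_num; ring

theorem branchFlux_pos {l m : ℝ} (hm : 0 < m) (h : 3 * m < l) : 0 < branchFlux l m := by
  unfold branchFlux
  refine div_pos (mul_pos ?_ ?_) ?_ <;> linarith

theorem branchFlux_nonneg {l m : ℝ} (hm : 0 < m) (h : 3 * m ≤ l) : 0 ≤ branchFlux l m := by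
  unfold branchFlux
  refine div_nonneg (mul_nonneg ?_ ?_) ?_ <;> linarith

theorem deriv_heightBound_eq {l w : ℝ} (h0 : 0 ≤ w) (h : w < √3 / 6) :
    neumannLength l w ^ 2 * (sideLength w - 2 * w) - 2 * w * branchFlux l (sideLength w) ^ 2 =
      (sideLength w - 2 * w) * (neumannLength l w ^ 2
        - (branchFlux l (sideLength w) * criticalRatio w) ^ 2) := by
  have hn : 0 < sideLength w - 2 * w := by linarith [two_mul_lt_sideLength h0 h]
  have hS2 : criticalRatio w ^ 2 * (sideLength w - 2 * w) = 2 * w := by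
    unfold criticalRatio
    rw [Real.sq_sqrt (by positivity)]; field_simp
  rw [mul_pow]
  linear_combination (branchFlux l (sideLength w)) ^ 2 * hS2

theorem deriv_heightBound_pos {l w : ℝ} (hl : √3 ≤ l) (h0 : 0 < w) (h : w < √3 / 6)
    (hc : 0 < criticalFun l w) : 0 < deriv (heightBound l) w := by
  rw [(hasDerivAt_heightBound hl h0.le h.le).deriv, deriv_heightBound_eq h0.le h]
  have hn : 0 < sideLength w - 2 * w := by linarith [two_mul_lt_sideLength h0.le h]
  have hM := sideLength_lt_of_lt h0.le h
  have hB := branchFlux_pos (sideLength_pos w) (l := l) (by linarith)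
  have hS : 0 ≤ criticalRatio w := Real.sqrt_nonneg _
  have : (branchFlux l (sideLength w) * criticalRatio w) ^ 2 < neumannLength l w ^ 2 := by
    refine pow_lt_pow_left₀ ?_ (by positivity) two_ne_zero
    unfold criticalFun at hc; linarith
  have hMp := sideLength_pos w
  exact mul_pos (by positivity) (mul_pos hn (by linarith))

theorem deriv_heightBound_neg {l w : ℝ} (hl : √3 ≤ l) (h0 : 0 < w) (h : w < √3 / 6)
    (hr : 0 ≤ neumannLength l w) (hc : criticalFun l w < 0) : deriv (heightBound l) w < 0 := by
  rw [(hasDerivAt_heightBound hl h0.le h.le).deriv, deriv_heightBound_eq h0.le h]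
  have hn : 0 < sideLength w - 2 * w := by linarith [two_mul_lt_sideLength h0.le h]
  have : neumannLength l w ^ 2 < (branchFlux l (sideLength w) * criticalRatio w) ^ 2 := by
    refine pow_lt_pow_left₀ ?_ hr two_ne_zero
    unfold criticalFun at hc; linarith
  have hMp := sideLength_pos w
  exact mul_neg_of_pos_of_neg (by positivity) (mul_neg_of_pos_of_neg hn (by linarith))

theorem continuousOn_heightBound {l : ℝ} (hl : √3 ≤ l) :
    ContinuousOn (heightBound l) (Icc 0 (√3 / 6)) := fun _ hw =>
  (hasDerivAt_heightBound hl hw.1 hw.2).continuousAt.continuousWithinAt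

/-- For the threshold length 1 + √3/2 the function vanishes at w = 0 and decreases, so it is
negative for w > 0. The ratio of the branch flux to the Neumann length only grows when l is lowered
(`key`), and this transfers the sign. -/
theorem criticalFun_neg_of_le {l w : ℝ} (hl : l ≤ 1 + √3 / 2) (h0 : 0 < w) (h : w < √3 / 6)
    (hr : 0 < neumannLength l w) : criticalFun l w < 0 := by
  have h1 := criticalFun_strictAntiOn (le_refl (1 + √3 / 2)) ⟨le_rfl, by positivity⟩ ⟨h0.le, h⟩ h0
  have h2 : criticalFun (1 + √3 / 2) 0 = 0 := by
    unfold criticalFun criticalRatio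
    rw [neumannLength_zero]; simp
  rw [h2] at h1
  unfold criticalFun at h1 ⊢
  set l₁ := 1 + √3 / 2 with hl1
  have hM := sideLength_lt_of_lt h0.le h
  have hMp := sideLength_pos w
  have hS : 0 ≤ criticalRatio w := Real.sqrt_nonneg _
  have hp : 0 ≤ √3 / 2 + 2 * sideLength w - w - 3 * sideLength w := by linarith
  set u := neumannLength l w with hu
  set u₁ := neumannLength l₁ w with hu1
  set M := sideLength w
  set p := √3 / 2 + 2 * M - w - 3 * M
  have e1 : l = p + 3 * M + u := by rw [hu]; unfold neumannLength; ring
  have e2 : l₁ = p + 3 * M + u₁ := by rw [hu1]; unfold neumannLength; ring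
  have huu : u ≤ u₁ := by linarith
  have key : branchFlux l₁ M * u ≤ branchFlux l M * u₁ := by
    unfold branchFlux
    rw [div_mul_eq_mul_div, div_mul_eq_mul_div, div_le_div_iff₀ (by linarith) (by linarith), e1, e2]
    have : 0 ≤ (u₁ - u) * (p * (p + 2 * M) * (2 * p + 3 * M + 2 * (u₁ + u))
        + (2 * p + M) * u * u₁) := by
      have : 0 < u₁ := by linarith
      have : 0 ≤ u₁ - u := by linarith
      positivity
    linarith
  have hu1p : 0 < u₁ := by linarith
  have h3 : u * u₁ < branchFlux l M * criticalRatio w * u₁ := by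
    have := mul_le_mul_of_nonneg_right key hS
    nlinarith
  have := lt_of_mul_lt_mul_right h3 hu1p.le
  linarith

/-- At w = √3/6 the factor M - 2w vanishes and the derivative of `heightBound` is negative. By
continuity it stays negative just below √3/6, which forces the sign of `criticalFun` there. -/
theorem exists_criticalFun_neg {l : ℝ} (hl : √3 < l) :
    ∃ d ∈ Ioo 0 (√3 / 6), criticalFun l d < 0 := by
  have h6 : 0 < √3 / 6 := by have := sqrt_three_pos; positivity
  have hy : 2 * l - 3 * sideLength (√3 / 6) ≠ 0 := by
    rw [sideLength_sqrt_three_div_six]; intro h; linarith [sqrt_three_pos]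
  have hcont : ContinuousAt (fun w => neumannLength l w ^ 2 * (sideLength w - 2 * w)
      - 2 * w * branchFlux l (sideLength w) ^ 2) (√3 / 6) := by
    have h1 := (hasDerivAt_neumannLength l (√3 / 6)).continuousAt
    have h2 := (hasDerivAt_sideLength (√3 / 6)).continuousAt
    have h3 := ((hasDerivAt_branchFlux hy).comp (√3 / 6)
      (hasDerivAt_sideLength (√3 / 6))).continuousAt
    exact ((h1.pow 2).mul (h2.sub (continuousAt_const.mul continuousAt_id))).sub
      ((continuousAt_const.mul continuousAt_id).mul (h3.pow 2))
  have hneg : neumannLength l (√3 / 6) ^ 2 * (sideLength (√3 / 6) - 2 * (√3 / 6))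
      - 2 * (√3 / 6) * branchFlux l (sideLength (√3 / 6)) ^ 2 < 0 := by
    have := branchFlux_pos (sideLength_pos (√3 / 6)) (l := l)
      (by rw [sideLength_sqrt_three_div_six]; linarith)
    have h0 : sideLength (√3 / 6) - 2 * (√3 / 6) = 0 := by
      rw [sideLength_sqrt_three_div_six]; ring
    rw [h0, mul_zero, zero_sub, neg_lt_zero]
    positivity
  have hev := hcont.eventually_lt continuousAt_const hneg
  have hev2 : ∀ᶠ w in nhdsWithin (√3 / 6) (Iio (√3 / 6)), w ∈ Ioo 0 (√3 / 6) :=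
    Ioo_mem_nhdsLT h6
  obtain ⟨d, hd1, hd2⟩ := ((hev.filter_mono nhdsWithin_le_nhds).and hev2).exists
  refine ⟨d, hd2, ?_⟩
  by_contra hc
  rw [not_lt] at hc
  rw [deriv_heightBound_eq hd2.1.le hd2.2] at hd1
  have hn : 0 < sideLength d - 2 * d := by linarith [two_mul_lt_sideLength hd2.1.le hd2.2]
  have hM := sideLength_lt_of_lt hd2.1.le hd2.2
  have hB := branchFlux_pos (sideLength_pos d) (l := l) (by linarith)
  have hS : 0 ≤ criticalRatio d := Real.sqrt_nonneg _
  have : (branchFlux l (sideLength d) * criticalRatio d) ^ 2 ≤ neumannLength l d ^ 2 := by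
    refine pow_le_pow_left₀ (by positivity) ?_ 2
    unfold criticalFun at hc; linarith
  nlinarith

/-- The optimal height among those at most `√3 / 6`. -/
theorem exists_max_heightBound {l : ℝ} (hl : √3 ≤ l) :
    ∃ w₀ ∈ Icc 0 (√3 / 6), (l ≤ 1 + √3 / 2 → neumannLength l w₀ = 0) ∧
      0 ≤ neumannLength l w₀ ∧ (√3 < l → w₀ < √3 / 6) ∧
      ∀ w ∈ Icc 0 (√3 / 6), 0 ≤ neumannLength l w → w ≠ w₀ →
        heightBound l w < heightBound l w₀ := by
  have h6 : 0 < √3 / 6 := by have := sqrt_three_pos; positivity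
  have hcont : ContinuousOn (neumannLength l) (Icc 0 (√3 / 6)) := fun x _ =>
    (hasDerivAt_neumannLength l x).continuousAt.continuousWithinAt
  rcases le_or_gt l (1 + √3 / 2) with hle | hgt
  · have hivt : (0 : ℝ) ∈ neumannLength l '' Icc 0 (√3 / 6) := by
      refine intermediate_value_Icc h6.le hcont ⟨?_, ?_⟩
      · rw [neumannLength_zero]; linarith
      · rw [neumannLength_sqrt_three_div_six]; linarith
    obtain ⟨w₀, hw₀, h0⟩ := hivt
    refine ⟨w₀, hw₀, fun _ => h0, h0.ge, fun hlt => ?_, fun w hw hr hne => ?_⟩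
    · refine lt_of_le_of_ne hw₀.2 fun h => ?_
      rw [h, neumannLength_sqrt_three_div_six] at h0; linarith
    · have hlt : w₀ < w := by
        refine lt_of_le_of_ne ?_ hne.symm
        rw [← h0] at hr
        exact ((neumannLength_strictMonoOn l).le_iff_le hw₀ hw).1 hr
      have hanti : StrictAntiOn (heightBound l) (Icc w₀ (√3 / 6)) := by
        refine strictAntiOn_of_deriv_neg (convex_Icc _ _)
          ((continuousOn_heightBound hl).mono (Icc_subset_Icc_left hw₀.1)) fun x hx => ?_
        rw [interior_Icc] at hx
        have hx0 : 0 < x := hw₀.1.trans_lt hx.1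
        have hxr : 0 < neumannLength l x := by
          rw [← h0]
          exact neumannLength_strictMonoOn l hw₀ ⟨hx0.le, hx.2.le⟩ hx.1
        exact deriv_heightBound_neg hl hx0 hx.2 hxr.le (criticalFun_neg_of_le hle hx0 hx.2 hxr)
      exact hanti ⟨le_rfl, hw₀.2⟩ ⟨hlt.le, hw.2⟩ hlt
  · have hl3 : √3 < l := by linarith [sqrt_three_lt]
    have hpos : ∀ w ∈ Icc 0 (√3 / 6), 0 < neumannLength l w := by
      intro w hw
      have := (neumannLength_strictMonoOn l).monotoneOn ⟨le_rfl, h6.le⟩ hw hw.1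
      rw [neumannLength_zero] at this
      linarith
    have hanti := criticalFun_strictAntiOn hgt.le
    have hdec : ∀ d, 0 ≤ d → d < √3 / 6 → criticalFun l d ≤ 0 →
        StrictAntiOn (heightBound l) (Icc d (√3 / 6)) := by
      intro d hd hd6 hneg
      refine strictAntiOn_of_deriv_neg (convex_Icc _ _)
          ((continuousOn_heightBound hl).mono (Icc_subset_Icc_left hd)) fun x hx => ?_
      rw [interior_Icc] at hx
      have hx0 : 0 < x := hd.trans_lt hx.1
      refine deriv_heightBound_neg hl hx0 hx.2 (hpos x ⟨hx0.le, hx.2.le⟩).le ?_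
      exact (hanti ⟨hd, hd6⟩ ⟨hx0.le, hx.2⟩ hx.1).trans_le hneg
    have hinc : ∀ d, 0 ≤ d → d < √3 / 6 → 0 ≤ criticalFun l d →
        StrictMonoOn (heightBound l) (Icc 0 d) := by
      intro d hd hd6 hge
      refine strictMonoOn_of_deriv_pos (convex_Icc _ _)
          ((continuousOn_heightBound hl).mono (Icc_subset_Icc_right hd6.le)) fun x hx => ?_
      rw [interior_Icc] at hx
      refine deriv_heightBound_pos hl hx.1 (hx.2.trans hd6) ?_
      exact hge.trans_lt (hanti ⟨hx.1.le, hx.2.trans hd6⟩ ⟨hd, hd6⟩ hx.2)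
    obtain ⟨w₀, hw₀, hmax⟩ := isCompact_Icc.exists_isMaxOn (nonempty_Icc.2 h6.le)
      (continuousOn_heightBound hl)
    -- Two maximizers are impossible: according to the sign of `criticalFun` at their midpoint,
    -- `heightBound` increases strictly up to it or decreases strictly after it.
    have hmid : ∀ u ∈ Icc 0 (√3 / 6), ∀ v ∈ Icc 0 (√3 / 6), u < v →
        heightBound l u = heightBound l w₀ → heightBound l v = heightBound l w₀ → False := by
      intro u hu v hv huv hu' hv'
      have hc0 : 0 ≤ (u + v) / 2 := by linarith [hu.1, hv.1]
      have hc6 : (u + v) / 2 < √3 / 6 := by linarith [hv.2]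
      have hc : heightBound l ((u + v) / 2) ≤ heightBound l w₀ := hmax ⟨hc0, hc6.le⟩
      rcases le_total 0 (criticalFun l ((u + v) / 2)) with h | h
      · have := hinc _ hc0 hc6 h ⟨hu.1, by linarith⟩ ⟨hc0, le_rfl⟩ (by linarith)
        linarith
      · have := hdec _ hc0 hc6 h ⟨le_rfl, hc6.le⟩ ⟨by linarith, hv.2⟩ (by linarith)
        linarith
    refine ⟨w₀, hw₀, fun h => absurd h hgt.not_ge, (hpos w₀ hw₀).le, fun _ => ?_,
      fun w hw _ hne => ?_⟩
    · refine lt_of_le_of_ne hw₀.2 fun h => ?_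
      obtain ⟨d, hd, hd'⟩ := exists_criticalFun_neg hl3
      have h1 := hdec d hd.1.le hd.2 hd'.le ⟨le_rfl, hd.2.le⟩ ⟨hd.2.le, le_rfl⟩ hd.2
      have h2 : heightBound l d ≤ heightBound l w₀ := hmax ⟨hd.1.le, hd.2.le⟩
      rw [h] at h2
      linarith
    · refine lt_of_le_of_ne (hmax hw) fun h => ?_
      rcases lt_or_gt_of_ne hne with h1 | h1
      · exact hmid w hw w₀ hw₀ h1 h rfl
      · exact hmid w₀ hw₀ w hw h1 rfl h

theorem sideLength_sqrt {m : ℝ} (hm : 1 / 2 ≤ m) : sideLength √(m ^ 2 - 1 / 4) = m := by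
  unfold sideLength
  rw [Real.sq_sqrt (by nlinarith), sub_add_cancel, Real.sqrt_sq (by linarith)]

theorem sqrt_sideLength {w : ℝ} (hw : 0 ≤ w) : √(sideLength w ^ 2 - 1 / 4) = w := by
  rw [sideLength_sq, add_sub_cancel_right, Real.sqrt_sq hw]

/-- The difference (2M)² - (√3/2 + w)² is (6w - √3)²/12: a tripod has length at least √3, with
equality at the Fermat point. -/
theorem neumannLength_le (l w : ℝ) : neumannLength l w ≤ l - √3 := by
  unfold neumannLength
  have h1 := sideLength_sq w
  have h2 := sideLength_pos w
  have h3 := sqrt_three_sq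
  have h4 := sqrt_three_pos
  have : (√3 / 2 + w) ^ 2 ≤ (2 * sideLength w) ^ 2 := by
    nlinarith [sq_nonneg (6 * w - √3)]
  linarith [(le_abs_self _).trans (abs_le_of_sq_le_sq this (by positivity))]

theorem neumannLength_lt {l w : ℝ} (h : √3 / 6 < w) : neumannLength l w < l - √3 := by
  unfold neumannLength
  have h1 := sideLength_sq w
  have h2 := sideLength_pos w
  have h3 := sqrt_three_sq
  have h4 := sqrt_three_pos
  have h5 : 0 < 6 * w - √3 := by linarith
  have : (√3 / 2 + w) ^ 2 < (2 * sideLength w) ^ 2 := by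
    nlinarith [mul_pos h5 h5]
  linarith [(le_abs_self _).trans_lt (abs_lt_of_sq_lt_sq this (by positivity))]

/-- The optimal height. -/
theorem exists_optimal_height {l : ℝ} (hl : √3 ≤ l) :
    ∃ w₀ ∈ Icc 0 (√3 / 6), (l ≤ 1 + √3 / 2 → neumannLength l w₀ = 0) ∧
      0 ≤ neumannLength l w₀ ∧ (√3 < l → w₀ < √3 / 6) ∧
      ∀ m r, 1 / 2 ≤ m → 3 * m ≤ l → 0 ≤ r → r ≤ neumannLength l √(m ^ 2 - 1 / 4) →
        treeBound l m r ≤ heightBound l w₀ ∧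
        (heightBound l w₀ ≤ treeBound l m r → m = sideLength w₀ ∧ r = neumannLength l w₀) := by
  obtain ⟨w₀, hw₀, h1, h2, h3, hmax⟩ := exists_max_heightBound hl
  refine ⟨w₀, hw₀, h1, h2, h3, fun m r hm h3m hr hrn => ?_⟩
  have h6 : 0 < √3 / 6 := by have := sqrt_three_pos; positivity
  have hle : ∀ w ∈ Icc 0 (√3 / 6), 0 ≤ neumannLength l w → heightBound l w ≤ heightBound l w₀ := by
    intro w hw hwr
    rcases eq_or_ne w w₀ with h | h
    · rw [h]
    · exact (hmax w hw hwr h).le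
  set w := √(m ^ 2 - 1 / 4) with hw
  have hwm : sideLength w = m := sideLength_sqrt hm
  have hw0 : 0 ≤ w := Real.sqrt_nonneg _
  rcases le_or_gt w (√3 / 6) with hw6 | hw6
  · have hwr : 0 ≤ neumannLength l w := hr.trans hrn
    have h4 : treeBound l m r ≤ heightBound l w := by
      unfold heightBound
      rw [hwm, treeBound_eq, treeBound_eq]
      have := pow_le_pow_left₀ hr hrn 3
      linarith
    refine ⟨h4.trans (hle w ⟨hw0, hw6⟩ hwr), fun h => ?_⟩
    have hww : w = w₀ := by
      by_contra hne
      have := hmax w ⟨hw0, hw6⟩ hwr hne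
      linarith
    rw [← hww] at h ⊢
    refine ⟨hwm.symm, hrn.antisymm ?_⟩
    unfold heightBound at h
    rw [hwm, treeBound_eq, treeBound_eq] at h
    exact le_of_pow_le_pow_left₀ (n := 3) (by norm_num) hr (by linarith)
  -- Beyond the Fermat point r is smaller than l - √3 and the sides are longer, so neither part of
  -- `treeBound` exceeds its value at √3/6.
  · have h4 : treeBound l m r < heightBound l (√3 / 6) := by
      unfold heightBound
      rw [neumannLength_sqrt_three_div_six, treeBound_eq, treeBound_eq]
      have h5 := pow_lt_pow_left₀ (hrn.trans_lt (neumannLength_lt hw6)) hr three_ne_zero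
      have h7 : sideLength (√3 / 6) ≤ m := by
        rw [← hwm]; exact Real.sqrt_le_sqrt (by nlinarith)
      have := treeBoundZero_antitone (by linarith [sqrt_three_pos]) h7 h3m
      linarith
    have h5 := hle (√3 / 6) ⟨h6.le, le_rfl⟩ (by rw [neumannLength_sqrt_three_div_six]; linarith)
    exact ⟨(h4.trans_le h5).le, fun h => absurd h (h4.trans_le h5).not_ge⟩

/-! ### Geometry of the triangle and bounds for the legs -/

/-- Here e is the signed distance of P from the side opposite to vertex i, and ζ is the coordinate
along that side, measured from its midpoint. -/
theorem exists_coordinates (P : Plane) {i j k : Fin 3} (hij : i ≠ j) (hik : i ≠ k) (hjk : j ≠ k) :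
    ∃ e ζ : ℝ, dist P (triangle i) ^ 2 = (√3 / 2 - e) ^ 2 + ζ ^ 2 ∧
      dist P (triangle j) ^ 2 = e ^ 2 + (ζ + 1 / 2) ^ 2 ∧
      dist P (triangle k) ^ 2 = e ^ 2 + (ζ - 1 / 2) ^ 2 ∧
      ∀ a, P a = (√3 * e - 1 / 2) * triangle i a + ζ * (triangle k a - triangle j a) := by
  have hd : ∀ Q : Plane, dist P Q ^ 2 = (P 0 - Q 0) ^ 2 + (P 1 - Q 1) ^ 2 := by
    intro Q
    rw [EuclideanSpace.dist_sq_eq, Fin.sum_univ_two, Real.dist_eq, Real.dist_eq, sq_abs, sq_abs]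
  have h3 := sqrt_three_sq
  have t0 : (triangle 0) 0 = -(√3 / 3) ∧ (triangle 0) 1 = 0 := by simp [triangle]
  have t1 : (triangle 1) 0 = √3 / 6 ∧ (triangle 1) 1 = -(1 / 2) := by simp [triangle]
  have t2 : (triangle 2) 0 = √3 / 6 ∧ (triangle 2) 1 = 1 / 2 := by simp [triangle]
  refine ⟨√3 / 6 + √3 * (P 0 * triangle i 0 + P 1 * triangle i 1),
    P 0 * (triangle k 0 - triangle j 0) + P 1 * (triangle k 1 - triangle j 1), ?_⟩
  simp only [hd, Fin.forall_fin_two]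
  generalize P 0 = x
  generalize P 1 = y
  have h4 : (√3 : ℝ) ^ 4 = 9 := by rw [show (√3 : ℝ) ^ 4 = (√3 ^ 2) ^ 2 by ring, h3]; norm_num
  have h5 : (√3 : ℝ) ^ 3 = 3 * √3 := by rw [pow_succ, h3]
  fin_cases i <;> fin_cases j <;> first | exact absurd rfl hij | skip
  all_goals fin_cases k <;> first | exact absurd rfl hik | exact absurd rfl hjk | skip
  all_goals
    simp only [Fin.zero_eta, Fin.mk_one, Fin.reduceFinMk, t0, t1, t2]
    refine ⟨?_, ?_, ?_, ?_, ?_⟩ <;> ring_nf <;> simp only [h3, h4, h5] <;> ring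

/-- An isosceles triangle is optimal: the bound for one of the legs in terms of the mean length of
the other two. -/
theorem sub_sqrt_le_of_coordinates {a b c e ζ : ℝ} (ha : 0 ≤ a) (hb : 0 ≤ b) (hc : 0 ≤ c)
    (h1 : (√3 / 2 - e) ^ 2 + ζ ^ 2 ≤ a ^ 2) (h2 : e ^ 2 + (ζ + 1 / 2) ^ 2 ≤ b ^ 2)
    (h3 : e ^ 2 + (ζ - 1 / 2) ^ 2 ≤ c ^ 2) :
    1 / 2 ≤ (b + c) / 2 ∧ √3 / 2 - √(((b + c) / 2) ^ 2 - 1 / 4) ≤ a ∧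
      (a ≤ √3 / 2 - √(((b + c) / 2) ^ 2 - 1 / 4) → e = √(((b + c) / 2) ^ 2 - 1 / 4) ∧ ζ = 0 ∧
        b = (b + c) / 2 ∧ c = (b + c) / 2) := by
  -- The product of the squared distances to the two ends of the base exceeds (e² + 1/4 - ζ²)² by
  -- 4e²ζ². With b² + c² ≥ 2e² + 2ζ² + 1/2 this yields (b + c)² ≥ 4e² + 1.
  have hbc : |e ^ 2 + 1 / 4 - ζ ^ 2| ≤ b * c := by
    refine abs_le_of_sq_le_sq ?_ (by positivity)
    rw [mul_pow]
    have := mul_le_mul h2 h3 (by positivity) (by positivity)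
    nlinarith [sq_nonneg e]
  have hm : e ^ 2 ≤ ((b + c) / 2) ^ 2 - 1 / 4 := by
    have := (le_abs_self _).trans hbc
    nlinarith
  have hm2 : 1 / 2 ≤ (b + c) / 2 := by nlinarith [sq_nonneg e]
  have hew : |e| ≤ √(((b + c) / 2) ^ 2 - 1 / 4) := Real.abs_le_sqrt hm
  have hae : √3 / 2 - e ≤ a := by
    have := abs_le_of_sq_le_sq (show (√3 / 2 - e) ^ 2 ≤ a ^ 2 by nlinarith [sq_nonneg ζ]) ha
    exact (le_abs_self _).trans this
  have hel := le_abs_self e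
  refine ⟨hm2, by linarith, fun hle => ?_⟩
  have he : e = √(((b + c) / 2) ^ 2 - 1 / 4) := by linarith
  have hζ : ζ = 0 := by
    have : √3 / 2 - e = a := by linarith
    rw [this] at h1
    exact pow_eq_zero_iff two_ne_zero |>.1 (le_antisymm (by linarith) (sq_nonneg _))
  have he2 : e ^ 2 = ((b + c) / 2) ^ 2 - 1 / 4 := by
    rw [he, Real.sq_sqrt ((sq_nonneg e).trans hm)]
  rw [hζ] at h2 h3
  have hb' : (b + c) / 2 ≤ b := le_of_sq_le_sq (by linarith) hb
  have hc' : (b + c) / 2 ≤ c := le_of_sq_le_sq (by linarith) hc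
  exact ⟨he, hζ, by linarith, by linarith⟩

theorem Fin.eq_or_eq_of_ne : ∀ i j k a : Fin 3, i ≠ j → i ≠ k → j ≠ k → a ≠ i → a = j ∨ a = k := by
  decide

namespace MetricGraph.Tripod

variable {N : ℕ} {Γ : MetricGraph N} {w : Fin 3 → Fin N} (T : Γ.Tripod w)

theorem exists_leg_coordinates {γ : Γ.Fun Plane} (hγ : γ.IsImmersion)
    (hw : ∀ i, γ.vert (w i) = triangle i) {i j k : Fin 3} (hij : i ≠ j) (hik : i ≠ k)
    (hjk : j ≠ k) : ∃ e ζ : ℝ, (√3 / 2 - e) ^ 2 + ζ ^ 2 ≤ Γ.walkLength (T.leg i) ^ 2 ∧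
      e ^ 2 + (ζ + 1 / 2) ^ 2 ≤ Γ.walkLength (T.leg j) ^ 2 ∧
      e ^ 2 + (ζ - 1 / 2) ^ 2 ≤ Γ.walkLength (T.leg k) ^ 2 := by
  obtain ⟨e, ζ, h1, h2, h3, -⟩ := exists_coordinates (γ.vert T.center) hij hik hjk
  have hd : ∀ i, dist (γ.vert T.center) (triangle i) ^ 2 ≤ Γ.walkLength (T.leg i) ^ 2 := by
    intro i
    have := hγ.dist_le_walkLength (T.leg i)
    rw [hw] at this
    exact pow_le_pow_left₀ dist_nonneg this 2
  exact ⟨e, ζ, h1 ▸ hd i, h2 ▸ hd j, h3 ▸ hd k⟩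

/-- The constraints for the lengths of the legs. -/
theorem leg_bound {γ : Γ.Fun Plane} (hγ : γ.IsImmersion)
    (hw : ∀ i, γ.vert (w i) = triangle i) {l : ℝ} (hl : Γ.length = l) (i : Fin 3) :
    let m := (l - T.restLength - Γ.walkLength (T.leg i)) / 2
    1 / 2 ≤ m ∧ T.restLength ≤ neumannLength l √(m ^ 2 - 1 / 4) ∧
      (neumannLength l √(m ^ 2 - 1 / 4) ≤ T.restLength →
        Γ.walkLength (T.leg i) = √3 / 2 - √(m ^ 2 - 1 / 4) ∧
        ∀ j, j ≠ i → Γ.walkLength (T.leg j) = m) := by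
  obtain ⟨j, k, hij, hik, hjk⟩ := Fin.exists_two_ne i
  obtain ⟨e, ζ, h1, h2, h3⟩ := T.exists_leg_coordinates hγ hw hij hik hjk
  have hlen := T.length_eq
  rw [Fin.sum_univ_three_of_ne hij hik hjk, hl] at hlen
  intro m
  have hm : m = (Γ.walkLength (T.leg j) + Γ.walkLength (T.leg k)) / 2 := by
    simp only [m]; linarith
  obtain ⟨h4, h5, h6⟩ := sub_sqrt_le_of_coordinates (walkLength_nonneg _) (walkLength_nonneg _)
    (walkLength_nonneg _) h1 h2 h3
  rw [← hm] at h4 h5 h6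
  have hn : neumannLength l √(m ^ 2 - 1 / 4) - T.restLength
      = Γ.walkLength (T.leg i) - (√3 / 2 - √(m ^ 2 - 1 / 4)) := by
    unfold neumannLength
    rw [sideLength_sqrt h4]
    linarith
  refine ⟨h4, by linarith, fun hle => ⟨by linarith, fun a ha => ?_⟩⟩
  obtain ⟨_, _, h7, h8⟩ := h6 (by linarith)
  rcases Fin.eq_or_eq_of_ne i j k a hij hik hjk ha with rfl | rfl
  · exact h7
  · exact h8

theorem leg_add_leg_pos {γ : Γ.Fun Plane} (hγ : γ.IsImmersion)
    (hw : ∀ i, γ.vert (w i) = triangle i) (i j : Fin 3) (hij : i ≠ j) :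
    0 < Γ.walkLength (T.leg i) + Γ.walkLength (T.leg j) := by
  obtain ⟨k, hik, hjk⟩ := Fin.exists_ne_ne i j
  have h := T.leg_bound hγ hw rfl k
  have hlen := T.length_eq
  rw [Fin.sum_univ_three_of_ne hij hik hjk] at hlen
  linarith [h.1]

/-- The vertex of the tripod at which `v` is maximal. -/
theorem exists_max (v : Fin N → ℝ) : ∃ p i, ∃ (q₁ : Γ.graph.Walk T.center p)
    (q₂ : Γ.graph.Walk p (w i)), T.leg i = q₁.append q₂ ∧ ∀ x ∈ T.verts, v x ≤ v p := by
  classical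
  obtain ⟨p, ⟨i, hi⟩, hp⟩ := T.verts.toFinite.exists_maximalFor v T.verts ⟨_, T.center_mem_verts⟩
  obtain ⟨q₁, q₂, hq⟩ := SimpleGraph.Walk.mem_support_iff_exists_append.1 hi
  refine ⟨p, i, q₁, q₂, hq, fun x hx => ?_⟩
  rcases le_total (v x) (v p) with h | h
  · exact h
  · exact hp hx h

variable {T}

/-- The lower bound for the energy in terms of the optimal height, and the lengths of the legs in
the case of equality. -/
theorem heightBound_le {l w₀ : ℝ}
    (hopt : ∀ m r, 1 / 2 ≤ m → 3 * m ≤ l → 0 ≤ r → r ≤ neumannLength l √(m ^ 2 - 1 / 4) →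
        treeBound l m r ≤ heightBound l w₀ ∧
        (heightBound l w₀ ≤ treeBound l m r → m = sideLength w₀ ∧ r = neumannLength l w₀))
    (hw₀ : 0 ≤ w₀) {γ : Γ.Fun Plane} (hγ : γ.IsImmersion) (hγw : ∀ i, γ.vert (w i) = triangle i)
    (hl : Γ.length = l) (hc : Γ.graph.Connected) {v : Fin N → ℝ} (hv : Γ.Compatible v)
    (hvw : ∀ i, v (w i) = 0) {p : Fin N} {i : Fin 3} {q₁ : Γ.graph.Walk T.center p}
    {q₂ : Γ.graph.Walk p (w i)} (hq : T.leg i = q₁.append q₂) (hM : ∀ x ∈ T.verts, v x ≤ v p) :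
    -(1 / 2) * heightBound l w₀ ≤ ∑ e ∈ Γ.edgeSet', Γ.vertexEnergy v e ∧
    (∑ e ∈ Γ.edgeSet', Γ.vertexEnergy v e ≤ -(1 / 2) * heightBound l w₀ →
      ∃ j, Γ.walkLength (T.leg j) = √3 / 2 - w₀ ∧
        (∀ k, k ≠ j → Γ.walkLength (T.leg k) = sideLength w₀) ∧
        T.restLength = neumannLength l w₀ ∧
        (0 < T.restLength → 0 < bestShift l (sideLength w₀) (√3 / 2 - w₀) → j = i)) := by
  obtain ⟨b, c, hib, hic, hbc⟩ := Fin.exists_two_ne i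
  have hlen := T.length_eq
  rw [hl] at hlen
  obtain ⟨j, α, hα, h3, h4, h5⟩ := exists_flux (fun i => walkLength_nonneg (T.leg i))
    T.restLength_nonneg (T.leg_add_leg_pos hγ hγw) hlen i
  have hcost := cost_le_sum_vertexEnergy (α := α) hv hib hic hbc hvw hq (T.rest_le hc hv hM)
    (by rw [← Fin.sum_univ_three_of_ne hib hic hbc]; exact hα)
  rw [← Fin.sum_univ_three_of_ne hib hic hbc
    (fun a => legCost (Γ.walkLength (T.leg a)) (α a))] at hcost
  obtain ⟨h6, h7, h8⟩ := T.leg_bound hγ hγw hl j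
  obtain ⟨h9, h10⟩ := hopt _ _ h6 h3 T.restLength_nonneg h7
  have h11 := h4 _ (walkLength_nonneg q₁)
  refine ⟨by linarith, fun hle => ?_⟩
  obtain ⟨h12, h13⟩ := h10 (by linarith)
  rw [h12, sqrt_sideLength hw₀] at h8
  obtain ⟨h14, h15⟩ := h8 h13.ge
  refine ⟨j, h14, h15, h13, fun hr ht => ?_⟩
  by_contra hne
  -- If the Neumann edge were on another leg, the bound of `exists_flux` would be strict.
  have h16 := h5 hne hr (by rw [h12, h14]; exact ht) _ (walkLength_nonneg q₁)
  linarith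

end MetricGraph.Tripod

theorem rot_triangle (i : Fin 3) : rot (triangle i) = triangle (i + 1) := by
  have h3 := sqrt_three_sq
  fin_cases i <;> ext a <;> fin_cases a <;> simp [rot, triangle] <;> nlinarith

theorem triangle_eq_iterate (i a : Fin 3) : triangle (i + a) = rot^[i.val] (triangle a) := by
  fin_cases i
  · simp
  · simp [rot_triangle, add_comm]
  · simp only [Fin.reduceFinMk, Function.iterate_succ, Function.iterate_zero, Function.comp,
      rot_triangle, id]
    congr 1
    revert a; decide

theorem triangle_injective : Function.Injective triangle := by
  have h3 := sqrt_three_pos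
  intro i j h
  have h0 := congrFun (congrArg WithLp.ofLp h) 0
  have h1 := congrFun (congrArg WithLp.ofLp h) 1
  fin_cases i <;> fin_cases j <;> simp [triangle] at h0 h1 ⊢ <;> linarith

theorem IsCompetitor.exists_vertices {N : ℕ} {Γ : MetricGraph N} {W : Set (Fin N)}
    {γ : Γ.Fun Plane} {l : ℝ} (h : IsCompetitor (range triangle) l Γ W γ) :
    ∃ w : Fin 3 → Fin N, (∀ i, w i ∈ W) ∧ ∀ i, γ.vert (w i) = triangle i := by
  have : ∀ i, ∃ x ∈ W, γ.vert x = triangle i := fun i => by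
    have : triangle i ∈ γ.vert '' W := h.2.2.2 ▸ mem_range_self i
    exact this
  choose w h1 h2 using this
  exact ⟨w, h1, h2⟩

/-! ### Existence of a minimizer and rigidity of tight paths -/

namespace MetricGraph

variable {N : ℕ} {Γ : MetricGraph N} {v : Fin N → ℝ} {W : Set (Fin N)}

/-- Passing from v to v/2 cancels the linear part and leaves the square of the difference: the
source of coercivity in `exists_minimizer`. -/
theorem edgeEnergy_eq_two_mul {L : ℝ} (a b : ℝ) :
    edgeEnergy L a b = 2 * edgeEnergy L (1 / 2 * a) (1 / 2 * b)
      + (a - b) ^ 2 / (4 * L) + L ^ 3 / 24 := by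
  rcases eq_or_ne L 0 with h | h
  · subst h; simp [edgeEnergy]
  · unfold edgeEnergy; field_simp; ring

theorem neg_cube_le_sum (hc : Γ.graph.Connected) (hW : W.Nonempty) (hv : Γ.Compatible v)
    (hv0 : ∀ i ∈ W, v i = 0) : -(Γ.length ^ 3 / 6) ≤ ∑ e ∈ Γ.edgeSet', Γ.vertexEnergy v e := by
  have := neg_sub_cube_le_sum_vertexEnergy hc hv _ W Γ.edgeSet' 0 rfl hW le_rfl
    (fun i j h _ => mem_edgeSet'.2 h) (fun i hi => (hv0 i hi).le)
  rw [← Γ.length_eq] at this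
  linarith

theorem abs_sub_le_of_walk {κ : ℝ} (h : ∀ i j, Γ.graph.Adj i j → |v i - v j| ≤ κ) {x y : Fin N}
    (p : Γ.graph.Walk x y) : |v x - v y| ≤ p.length * κ := by
  induction p with
  | nil => simp
  | @cons a b c hab p ih =>
    have h1 := h a b hab
    have h2 := abs_sub_le (v a) (v b) (v c)
    rw [SimpleGraph.Walk.length_cons]
    push_cast
    linarith

theorem continuous_sum_vertexEnergy (Γ : MetricGraph N) :
    Continuous fun v : Fin N → ℝ => ∑ e ∈ Γ.edgeSet', Γ.vertexEnergy v e := by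
  refine continuous_finsetSum _ fun e _ => ?_
  induction e with | _ i j
  simp only [vertexEnergy_mk]
  unfold edgeEnergy
  simp only [div_eq_mul_inv]
  fun_prop

/-- The energy of v is twice that of v/2 plus the sum of the terms (v i - v j)²/(4L) + L³/24, and
the energy of v/2 is bounded below. A bound for the energy thus bounds all differences along edges;
since v vanishes on W and the graph is connected, it bounds v. A continuous function on a compact
set remains. -/
theorem exists_minimizer (hc : Γ.graph.Connected) (hW : W.Nonempty)
    (hpos : ∀ i j, Γ.graph.Adj i j → 0 < Γ.len s(i, j)) :
    ∃ v : Fin N → ℝ, (∀ i ∈ W, v i = 0) ∧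
      ∑ e ∈ Γ.edgeSet', Γ.vertexEnergy v e ≤ Γ.energy W := by
  have hcomp : ∀ v, Γ.Compatible v := fun v i j h h0 => absurd h0 (hpos i j h).ne'
  set E : (Fin N → ℝ) → ℝ := fun v => ∑ e ∈ Γ.edgeSet', Γ.vertexEnergy v e with hE
  set C := E 0 + 2 * (Γ.length ^ 3 / 6) with hC
  have hl : 0 ≤ Γ.length := by
    rw [Γ.length_eq]; exact Finset.sum_nonneg fun _ _ => NNReal.coe_nonneg _
  have hdiff : ∀ v, (∀ i ∈ W, v i = 0) → E v ≤ E 0 → ∀ i j, Γ.graph.Adj i j →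
      |v i - v j| ≤ √(4 * Γ.length * C) := by
    intro v hv hle i j hij
    refine Real.abs_le_sqrt ?_
    have h1 : E v = 2 * E (fun i => 1 / 2 * v i) + ∑ e ∈ Γ.edgeSet', (Γ.vertexEnergy v e
        - 2 * Γ.vertexEnergy (fun i => 1 / 2 * v i) e) := by
      simp only [hE, Finset.sum_sub_distrib, ← Finset.mul_sum]; ring
    have h2 := neg_cube_le_sum (v := fun i => 1 / 2 * v i) hc hW (hcomp _)
      (fun i hi => by simp [hv i hi])
    have h3 : Γ.vertexEnergy v s(i, j) - 2 * Γ.vertexEnergy (fun i => 1 / 2 * v i) s(i, j)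
        ≤ ∑ e ∈ Γ.edgeSet', (Γ.vertexEnergy v e
        - 2 * Γ.vertexEnergy (fun i => 1 / 2 * v i) e) := by
      refine Finset.single_le_sum (f := fun e => Γ.vertexEnergy v e
        - 2 * Γ.vertexEnergy (fun i => 1 / 2 * v i) e) (fun e _ => ?_) (mem_edgeSet'.2 hij)
      induction e with | _ a b
      simp only [vertexEnergy_mk]
      rw [edgeEnergy_eq_two_mul (v a)]
      have : (0 : ℝ) ≤ Γ.len s(a, b) := NNReal.coe_nonneg _
      have : 0 ≤ (v a - v b) ^ 2 / (4 * (Γ.len s(a, b) : ℝ)) + (Γ.len s(a, b) : ℝ) ^ 3 / 24 := by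
        positivity
      linarith
    rw [vertexEnergy_mk, vertexEnergy_mk, edgeEnergy_eq_two_mul (v i)] at h3
    have hL : (0 : ℝ) < Γ.len s(i, j) := hpos i j hij
    have hL3 : (0 : ℝ) ≤ (Γ.len s(i, j) : ℝ) ^ 3 / 24 := by positivity
    have hLl : (Γ.len s(i, j) : ℝ) ≤ Γ.length := by
      rw [Γ.length_eq]
      exact Finset.single_le_sum (f := fun e => (Γ.len e : ℝ)) (fun _ _ => NNReal.coe_nonneg _)
        (mem_edgeSet'.2 hij)
    have h4 : (v i - v j) ^ 2 / (4 * (Γ.len s(i, j) : ℝ)) ≤ C := by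
      simp only [hE] at h1 hle h2
      simp only [hC]
      linarith
    rw [div_le_iff₀ (by positivity)] at h4
    have hC0 : 0 ≤ C := by
      by_contra hneg
      nlinarith [sq_nonneg (v i - v j)]
    nlinarith
  obtain ⟨w, hw⟩ := hW
  set R := N * √(4 * Γ.length * C)
  have hbound : ∀ v, (∀ i ∈ W, v i = 0) → E v ≤ E 0 → ∀ i, |v i| ≤ R := by
    intro v hv hle i
    obtain ⟨p, hp⟩ := (hc.preconnected i w).exists_isPath
    have h1 := abs_sub_le_of_walk (hdiff v hv hle) p
    rw [hv w hw, sub_zero] at h1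
    refine h1.trans (mul_le_mul_of_nonneg_right ?_ (Real.sqrt_nonneg _))
    have := hp.length_lt
    rw [Fintype.card_fin] at this
    exact_mod_cast this.le
  have hK : IsCompact (Icc (fun _ => -R) (fun _ => R) ∩ {v : Fin N → ℝ | ∀ i ∈ W, v i = 0}) := by
    refine isCompact_Icc.inter_right ?_
    simp only [ofPred_forall]
    exact isClosed_iInter fun i => isClosed_iInter fun _ =>
      isClosed_eq (continuous_apply i) continuous_const
  have hR : 0 ≤ R := by positivity
  obtain ⟨v, hv, hmin⟩ := hK.exists_isMinOn ⟨0, ⟨⟨fun _ => by simpa using hR, fun _ => hR⟩,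
    fun _ _ => rfl⟩⟩ Γ.continuous_sum_vertexEnergy.continuousOn
  refine ⟨v, hv.2, le_energy fun v' _ hv' => ?_⟩
  have h0 : E v ≤ E 0 := hmin ⟨⟨fun _ => by simpa using hR, fun _ => hR⟩, fun _ _ => rfl⟩
  rcases le_total (E v') (E 0) with h | h
  · have := hbound v' hv' h
    exact hmin ⟨⟨fun i => (abs_le.1 (this i)).1, fun i => (abs_le.1 (this i)).2⟩, hv'⟩
  · exact h0.trans h

/-- A path on which the flux is optimal has no inner vertices. -/
theorem eq_edge_of_tight (hred : Γ.IsReduced W) (hvW : ∀ i ∈ W, v i = 0) {u z : Fin N}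
    {p : Γ.graph.Walk u z} (hp : p.IsPath) {φ : ℝ}
    (htight : Γ.walkEnergy v p ≤
      φ * v u - (φ + Γ.walkLength p) * v z - ((φ + Γ.walkLength p) ^ 3 - φ ^ 3) / 6)
    (hint : ∀ y ∈ p.support, y ≠ u → y ≠ z → ∀ n, Γ.graph.Adj y n → s(y, n) ∈ p.edges)
    (hpos : ∀ L₁ L₂, 0 < L₁ → 0 < L₂ → L₁ + L₂ = Γ.walkLength p →
      0 < v z + (L₂ * (φ + L₁) + L₂ ^ 2 / 2)) (hlen : 0 < Γ.walkLength p) :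
    Γ.graph.Adj u z ∧ (Γ.len s(u, z) : ℝ) = Γ.walkLength p ∧ p.edges = [s(u, z)] ∧
      p.support = [u, z] := by
  have hv : Γ.Compatible v := fun i j h h0 => absurd h0 (hred.1 i j h).ne'
  cases p with
  | nil => simp at hlen
  | @cons _ y _ h p =>
    cases p with
    | nil => simp [h]
    | @cons _ y₂ _ h' p' =>
      exfalso
      -- Tightness of the tail gives v y = v z + L₂(φ + L₁) + L₂²/2 at an inner vertex y, which is
      -- positive by `hpos`. But y has only two neighbours, hence is Dirichlet.
      have h1 := walkEnergy_tail_le_flux hv htight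
      have h2 := sub_eq_of_walkEnergy_le_flux hv h1
      rw [SimpleGraph.Walk.cons_isPath_iff, SimpleGraph.Walk.cons_isPath_iff] at hp
      obtain ⟨⟨hp1, hp2⟩, hp3⟩ := hp
      have hyu : y ≠ u := h.ne'
      have hyz : y ≠ z := fun hyz => hp2 (hyz ▸ p'.end_mem_support)
      have hL₁ : (0 : ℝ) < Γ.len s(u, y) := hred.1 _ _ h
      have hL₂ : 0 < Γ.walkLength (.cons h' p') := by
        rw [walkLength_cons]
        have h3 : (0 : ℝ) < Γ.len s(y, y₂) := hred.1 _ _ h'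
        have := walkLength_nonneg p'
        linarith
      have h3 := hpos _ _ hL₁ hL₂ (walkLength_cons h _).symm
      have hns : Γ.graph.neighborSet y = {u, y₂} := by
        ext n
        rw [SimpleGraph.mem_neighborSet]
        constructor
        · intro hn
          have := hint y (by simp) hyu hyz n hn
          rw [SimpleGraph.Walk.edges_cons, SimpleGraph.Walk.edges_cons, List.mem_cons,
            List.mem_cons] at this
          rcases this with h | h | h
          · rcases Sym2.eq_iff.1 h with h | h
            · exact absurd h.1 hyu
            · exact Or.inl h.2
          · rcases Sym2.eq_iff.1 h with h | h
            · exact Or.inr h.2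
            · exact absurd h.1 h'.ne
          · exact absurd (p'.fst_mem_support_of_mem_edges h) hp2
        · rintro (rfl | rfl)
          · exact h.symm
          · exact h'
      have hne : u ≠ y₂ := fun huy => hp3 (by rw [huy]; simp)
      have hy0 := hvW y (hred.2 y (by rw [hns, Set.ncard_pair hne]))
      linarith

end MetricGraph

/-! ### The lower bound and its case of equality -/

/-- The lower bound for the energy of the competitors. -/
theorem IsCompetitor.heightBound_le_energy {l w₀ : ℝ}
    (hopt : ∀ m r, 1 / 2 ≤ m → 3 * m ≤ l → 0 ≤ r → r ≤ neumannLength l √(m ^ 2 - 1 / 4) →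
        treeBound l m r ≤ heightBound l w₀ ∧
        (heightBound l w₀ ≤ treeBound l m r → m = sideLength w₀ ∧ r = neumannLength l w₀))
    (hw₀ : 0 ≤ w₀) {N : ℕ} {Γ : MetricGraph N} {W : Set (Fin N)} {γ : Γ.Fun Plane}
    (h : IsCompetitor (range triangle) l Γ W γ) {v : Fin N → ℝ} (hv : Γ.Compatible v)
    (hvW : ∀ i ∈ W, v i = 0) :
    -(1 / 2) * heightBound l w₀ ≤ ∑ e ∈ Γ.edgeSet', Γ.vertexEnergy v e := by
  obtain ⟨w, hw, hγw⟩ := h.exists_vertices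
  obtain ⟨T⟩ := MetricGraph.exists_tripod h.1 w
  obtain ⟨p, i, q₁, q₂, hq, hM⟩ := T.exists_max v
  exact (MetricGraph.Tripod.heightBound_le hopt hw₀ h.2.2.1 hγw h.2.1 h.1 hv
    (fun i => hvW _ (hw i)) hq hM).1

theorem two_mul_sub_sideLength_pos {l w : ℝ} (hl : √3 ≤ l) (h0 : 0 ≤ w) (h : w ≤ √3 / 6) :
    0 < 2 * l - 3 * sideLength w := by
  have := sideLength_le_of_le h0 h
  have := sqrt_three_pos
  linarith

/-- Together with `two_mul_bestShift_lt` this places the Neumann edge strictly inside its leg,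
nearer to the centre than to the Dirichlet end. -/
theorem bestShift_sideLength_pos {l w : ℝ} (hl : √3 ≤ l) (h0 : 0 ≤ w) (h : w < √3 / 6) :
    0 < bestShift l (sideLength w) (√3 / 2 - w) := by
  have hy := two_mul_sub_sideLength_pos hl h0 h.le
  have hx := sideLength_lt_of_lt h0 h
  have hx0 := sideLength_pos w
  have h3 := sqrt_three_pos
  unfold bestShift
  refine half_pos (sub_pos.2 ?_)
  rw [div_lt_iff₀ hy]
  have ha : √3 / 3 < √3 / 2 - w := by linarith
  generalize √3 / 2 - w = a at ha ⊢
  generalize sideLength w = x at *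
  obtain ⟨s, hs⟩ : ∃ s, s = √3 / 3 := ⟨_, rfl⟩
  have h4 : √3 = 3 * s := by linarith
  have h5 : (3 : ℝ) * s * s = 1 := by nlinarith [sqrt_three_sq]
  rw [← hs] at ha hx
  rw [h4] at hl
  have h6 : 0 < a * (s - x) := mul_pos (by linarith) (by linarith)
  have h7 : 0 < s * (a - x) := mul_pos (by linarith) (by linarith)
  have h8 : 0 ≤ (l - 3 * s) * (2 * a - x) := mul_nonneg (by linarith) (by linarith)
  nlinarith

theorem two_mul_bestShift (l m a : ℝ) : 2 * bestShift l m a = a - m * l / (2 * l - 3 * m) := by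
  unfold bestShift; ring

theorem two_mul_bestShift_lt {l w a : ℝ} (hl : √3 ≤ l) (h0 : 0 ≤ w) (h : w ≤ √3 / 6) :
    2 * bestShift l (sideLength w) a < a := by
  have hy := two_mul_sub_sideLength_pos hl h0 h
  have : 0 < sideLength w * l / (2 * l - 3 * sideLength w) :=
    div_pos (mul_pos (sideLength_pos w) (sqrt_three_pos.trans_le hl)) hy
  rw [two_mul_bestShift]
  linarith

theorem half_add_bestShift_nonneg {l w : ℝ} (hl : √3 ≤ l) (h0 : 0 ≤ w) (h : w ≤ √3 / 6) :
    0 ≤ neumannLength l w / 2 + bestShift l (sideLength w) (√3 / 2 - w) := by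
  have hy := two_mul_sub_sideLength_pos hl h0 h
  have hx := sideLength_le_of_le h0 h
  rw [half_add_bestShift hy (by unfold neumannLength; ring)]
  exact branchFlux_nonneg (sideLength_pos w) (by linarith)

/-- The energy of the optimal tree in terms of the fluxes. -/
theorem cost_eq_heightBound {l w : ℝ} (hl : √3 ≤ l) (h0 : 0 ≤ w) (h : w ≤ √3 / 6) :
    let r := neumannLength l w
    let t := bestShift l (sideLength w) (√3 / 2 - w)
    r ^ 3 / 3 + (legCost (√3 / 2 - w) (r / 2 - t) + legCost (sideLength w) ((r / 2 + t) / 2)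
      + legCost (sideLength w) ((r / 2 + t) / 2)) + r * t ^ 2 = heightBound l w := by
  intro r t
  have hy := two_mul_sub_sideLength_pos hl h0 h
  unfold heightBound
  rw [← cost_eq_treeBound hy (a := √3 / 2 - w) (by unfold neumannLength; ring)]
  change _ = r ^ 3 / 3 + (legCost (√3 / 2 - w) (r / 2 - t)
    + (sideLength w / 2 * (r / 2 + t + sideLength w) ^ 2 + sideLength w ^ 3 / 6)) + r * t ^ 2
  have : legCost (sideLength w) ((r / 2 + t) / 2) + legCost (sideLength w) ((r / 2 + t) / 2)
      = sideLength w / 2 * (r / 2 + t + sideLength w) ^ 2 + sideLength w ^ 3 / 6 := by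
    unfold legCost; ring
  rw [← this]; ring

theorem sqrt_four_mul_sideLength {w : ℝ} (hw : 0 ≤ w) : √(4 * sideLength w ^ 2 - 1) = 2 * w := by
  rw [sideLength_sq, show 4 * (w ^ 2 + 1 / 4) - 1 = (2 * w) ^ 2 by ring,
    Real.sqrt_sq (by linarith)]

namespace MetricGraph

variable {N : ℕ} {Γ : MetricGraph N}

theorem adj_iff_of_edgeSet' {m : ℕ} (e : Fin m ≃ Fin N) {S : Set (Sym2 (Fin m))}
    (h : ∀ z, z ∈ Γ.edgeSet' ↔ ∃ y ∈ S, y.map e = z) (a b : Fin m) :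
    Γ.graph.Adj (e a) (e b) ↔ s(a, b) ∈ S := by
  rw [← mem_edgeSet', h]
  constructor
  · rintro ⟨y, hy, hyz⟩
    rw [← Sym2.map_mk] at hyz
    exact Sym2.map.injective e.injective hyz ▸ hy
  · exact fun h => ⟨_, h, rfl⟩

namespace Tripod

variable {w : Fin 3 → Fin N} {T : Γ.Tripod w}

theorem eq_of_mem_edges {y n : Fin N} {b b' : Fin 3} (hy : y ∈ (T.leg b).support)
    (hyc : y ≠ T.center) (he : s(y, n) ∈ (T.leg b').edges) : b' = b := by
  by_contra hne
  exact hyc (T.eq_center _ _ hne y (SimpleGraph.Walk.fst_mem_support_of_mem_edges _ he) hy)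

theorem mem_edges_of_notMem_rest {y n : Fin N} {b : Fin 3} (hy : y ∈ (T.leg b).support)
    (hyc : y ≠ T.center) (h : Γ.graph.Adj y n) (hr : s(y, n) ∉ T.rest) :
    s(y, n) ∈ (T.leg b).edges := by
  rcases T.mem_rest_or (mem_edgeSet'.2 h) with h | ⟨b', hb'⟩
  · exact absurd h hr
  · exact eq_of_mem_edges hy hyc hb' ▸ hb'

theorem mem_edgeSet'_iff {z : Sym2 (Fin N)} :
    z ∈ Γ.edgeSet' ↔ z ∈ T.rest ∨ ∃ b, z ∈ (T.leg b).edges := by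
  refine ⟨T.mem_rest_or, ?_⟩
  rintro (h | ⟨b, hb⟩)
  · exact T.rest_subset h
  · induction z with | _ x y
    exact mem_edgeSet'.2 ((T.leg b).adj_of_mem_edges hb)

variable {W : Set (Fin N)} {v : Fin N → ℝ} {i j k : Fin 3} {p : Fin N}
  {q₁ : Γ.graph.Walk T.center p} {q₂ : Γ.graph.Walk p (w i)}

/-- In the case of equality, the Neumann edge starts at the best position, and the energies of the
parts of the tree are given by the optimal fluxes. -/
theorem tight_of_le_heightBound {l w₀ : ℝ} (hl : √3 ≤ l) (h0 : 0 ≤ w₀) (hw₀ : w₀ ≤ √3 / 6)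
    (hc : Γ.graph.Connected) (hv : Γ.Compatible v) (hvw : ∀ i, v (w i) = 0)
    (hij : i ≠ j) (hik : i ≠ k) (hjk : j ≠ k)
    (hi : Γ.walkLength (T.leg i) = √3 / 2 - w₀) (hj : Γ.walkLength (T.leg j) = sideLength w₀)
    (hk : Γ.walkLength (T.leg k) = sideLength w₀) (hr : T.restLength = neumannLength l w₀)
    (hle : ∑ e ∈ Γ.edgeSet', Γ.vertexEnergy v e ≤ -(1 / 2) * heightBound l w₀)
    (hq : T.leg i = q₁.append q₂)
    (hM : (∀ x ∈ T.verts, v x ≤ v p) ∨ T.rest = ∅) :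
    let r := neumannLength l w₀
    let t := bestShift l (sideLength w₀) (√3 / 2 - w₀)
    let τ := Γ.walkLength q₁
    (0 < r → τ = t) ∧ (r = 0 ∨ τ = t →
    (∑ e ∈ T.rest, Γ.vertexEnergy v e ≤ -v p * T.restLength - T.restLength ^ 3 / 6) ∧
    (let φ := r / 2 + t - τ;
      Γ.walkEnergy v q₁.reverse ≤ φ * v p - (φ + Γ.walkLength q₁.reverse) * v T.center
        - ((φ + Γ.walkLength q₁.reverse) ^ 3 - φ ^ 3) / 6) ∧
    (let φ := r / 2 - t + τ;
      Γ.walkEnergy v q₂ ≤ φ * v p - (φ + Γ.walkLength q₂) * v (w i)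
        - ((φ + Γ.walkLength q₂) ^ 3 - φ ^ 3) / 6) ∧
    ∀ b, b ≠ i → (let φ := (r / 2 + t) / 2
      Γ.walkEnergy v (T.leg b) ≤ φ * v T.center - (φ + Γ.walkLength (T.leg b)) * v (w b)
        - ((φ + Γ.walkLength (T.leg b)) ^ 3 - φ ^ 3) / 6)) := by
  intro r t τ
  have h1 : -v p * T.restLength - T.restLength ^ 3 / 6 ≤ ∑ e ∈ T.rest, Γ.vertexEnergy v e := by
    rcases hM with hM | hM
    · exact T.rest_le hc hv hM
    · simp [restLength, hM]
  let α : Fin 3 → ℝ := fun b => if b = i then r / 2 - t else (r / 2 + t) / 2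
  have hαi : α i = r / 2 - t := if_pos rfl
  have hαj : α j = (r / 2 + t) / 2 := if_neg hij.symm
  have hαk : α k = (r / 2 + t) / 2 := if_neg hik.symm
  have hα : α i + α j + α k = T.restLength := by
    rw [hαi, hαj, hαk, hr]; simp only [r]; ring
  have hcost := cost_eq_heightBound hl h0 hw₀
  change r ^ 3 / 3 + (legCost (√3 / 2 - w₀) (r / 2 - t) + legCost (sideLength w₀) ((r / 2 + t) / 2)
      + legCost (sideLength w₀) ((r / 2 + t) / 2)) + r * t ^ 2 = heightBound l w₀ at hcost
  -- With the optimal fluxes the cost depends on the position of the Neumann edge only through the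
  -- penalty r(τ - t)². So equality forces τ = t when r > 0.
  have heq : T.restLength ^ 3 / 3 + (legCost (Γ.walkLength (T.leg i)) (α i)
        + legCost (Γ.walkLength (T.leg j)) (α j) + legCost (Γ.walkLength (T.leg k)) (α k))
        + T.restLength * (Γ.walkLength q₁ * (T.restLength - 2 * α i - Γ.walkLength q₁))
        = heightBound l w₀ - r * (τ - t) ^ 2 := by
    rw [← hcost, hαi, hαj, hαk, hr, hi, hj, hk]
    simp only [r, τ]; ring
  refine ⟨fun hrpos => ?_, fun hτ => ?_⟩
  · have h2 := cost_le_sum_vertexEnergy (α := α) hv hij hik hjk hvw hq h1 hα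
    rw [heq] at h2
    have h3 : r * (τ - t) ^ 2 ≤ 0 := by linarith
    have h4 : (τ - t) ^ 2 = 0 := by
      refine le_antisymm ?_ (sq_nonneg _)
      by_contra hlt
      rw [not_le] at hlt
      linarith [mul_pos hrpos hlt]
    linarith [pow_eq_zero_iff two_ne_zero |>.1 h4]
  · have h2 : r * (τ - t) ^ 2 = 0 := by
      rcases hτ with h | h
      · rw [h, zero_mul]
      · rw [h]; ring
    have h3 := tight_of_sum_vertexEnergy_le (α := α) hv hij hik hjk hvw hq h1 hα
      (by rw [heq, h2, sub_zero]; exact hle)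
    rw [hαi, hαj, hαk, hr] at h3
    obtain ⟨h4, h5, h6, h7, h8⟩ := h3
    refine ⟨by rw [hr]; exact h4, ?_, h6, ?_⟩
    · have : r - (r / 2 - t) - τ = r / 2 + t - τ := by ring
      rw [← this]; exact h5
    · intro b hb
      rcases Fin.eq_or_eq_of_ne i j k b hij hik hjk hb with rfl | rfl
      · exact h7
      · exact h8

end Tripod

end MetricGraph

theorem Fin.three_ne_add : ∀ i : Fin 3, i ≠ i + 1 ∧ i ≠ i + 2 ∧ i + 1 ≠ i + 2 := by decide

/-! ### Rigidity: the reduced solutions -/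

namespace MetricGraph

variable {N : ℕ} {Γ : MetricGraph N} {W : Set (Fin N)} {γ : Γ.Fun Plane}

theorem eq_edge_of_tight_of_nonneg {v : Fin N → ℝ} (hred : Γ.IsReduced W) (hvW : ∀ i ∈ W, v i = 0)
    {u z : Fin N} {p : Γ.graph.Walk u z} (hp : p.IsPath) {φ : ℝ}
    (htight : Γ.walkEnergy v p ≤
      φ * v u - (φ + Γ.walkLength p) * v z - ((φ + Γ.walkLength p) ^ 3 - φ ^ 3) / 6)
    (hint : ∀ y ∈ p.support, y ≠ u → y ≠ z → ∀ n, Γ.graph.Adj y n → s(y, n) ∈ p.edges)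
    (hφ : 0 ≤ φ) (hz : 0 ≤ v z) (hlen : 0 < Γ.walkLength p) :
    Γ.graph.Adj u z ∧ (Γ.len s(u, z) : ℝ) = Γ.walkLength p ∧ p.edges = [s(u, z)] ∧
      p.support = [u, z] :=
  eq_edge_of_tight hred hvW hp htight hint (fun L₁ L₂ h1 h2 _ => by positivity) hlen

/-- The remaining edges have total length 0, so in a reduced graph there are none. Tightness makes
each leg a single edge, and v > 0 at the centre shows that the centre is not Dirichlet. The leg of
length √3/2 - w₀ fixes the rotation. -/
theorem exists_isGamma1_of_le {l w₀ : ℝ} (hl : √3 ≤ l) (h0 : 0 ≤ w₀) (hw₀ : w₀ ≤ √3 / 6)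
    (hopt : ∀ m r, 1 / 2 ≤ m → 3 * m ≤ l → 0 ≤ r → r ≤ neumannLength l √(m ^ 2 - 1 / 4) →
        treeBound l m r ≤ heightBound l w₀ ∧
        (heightBound l w₀ ≤ treeBound l m r → m = sideLength w₀ ∧ r = neumannLength l w₀))
    (hr0 : neumannLength l w₀ = 0)
    (h : IsCompetitor (range triangle) l Γ W γ) (hred : Γ.IsReduced W)
    (hE : Γ.energy W ≤ -(1 / 2) * heightBound l w₀) :
    ∃ (e : Fin 4 ≃ Fin N) (k : ℕ), IsGamma1 (sideLength w₀) Γ W e ∧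
      γ.vert (e 0) = rot^[k] (triangle 0) ∧ γ.vert (e 1) = rot^[k] (triangle 1) ∧
      γ.vert (e 2) = rot^[k] (triangle 2) := by
  obtain ⟨w, hwW, hγw⟩ := h.exists_vertices
  obtain ⟨v, hvW, hvE⟩ := exists_minimizer h.1 ⟨w 0, hwW 0⟩ hred.1
  have hle := hvE.trans hE
  have hv : Γ.Compatible v := fun i j hij h0 => absurd h0 (hred.1 i j hij).ne'
  have hvw : ∀ i, v (w i) = 0 := fun i => hvW _ (hwW i)
  obtain ⟨T⟩ := exists_tripod h.1 w
  obtain ⟨p, i', q₁, q₂, hq, hM⟩ := T.exists_max v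
  obtain ⟨i, hi, hk, hr, -⟩ :=
    (Tripod.heightBound_le hopt h0 h.2.2.1 hγw h.2.1 h.1 hv hvw hq hM).2 hle
  have hrest : T.rest = ∅ := by
    rw [hr0, Tripod.restLength, Finset.sum_eq_zero_iff_of_nonneg fun _ _ => NNReal.coe_nonneg _]
      at hr
    rw [Finset.eq_empty_iff_forall_notMem]
    intro z hz
    have h1 := hr z hz
    induction z with | _ x y
    have := hred.1 x y (mem_edgeSet'.1 (T.rest_subset hz))
    exact absurd h1 (NNReal.coe_pos.2 this).ne'
  have hx0 := sideLength_pos w₀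
  obtain ⟨h1i, h2i, h12⟩ := Fin.three_ne_add i
  -- Without a Neumann edge the point p is arbitrary; with p the centre, the first part of the leg
  -- is trivial.
  have htight := (Tripod.tight_of_le_heightBound (T := T) (p := T.center) (q₁ := .nil)
    (q₂ := T.leg i) hl h0 hw₀ h.1 hv hvw h1i h2i h12 hi (hk _ h1i.symm)
    (hk _ h2i.symm) hr hle rfl (Or.inr hrest)).2 (Or.inl hr0)
  rw [hr0, walkLength_nil] at htight
  obtain ⟨-, -, h3, h4⟩ := htight
  have ht0 := half_add_bestShift_nonneg hl h0 hw₀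
  have ht1 := two_mul_bestShift_lt (a := √3 / 2 - w₀) hl h0 hw₀
  rw [hr0] at ht0
  have hint : ∀ b, ∀ y ∈ (T.leg b).support, y ≠ T.center → y ≠ w b → ∀ n, Γ.graph.Adj y n →
      s(y, n) ∈ (T.leg b).edges := fun b y hy hyc _ n hn =>
    Tripod.mem_edges_of_notMem_rest hy hyc hn (by simp [hrest])
  have hlegs : ∀ b, Γ.graph.Adj T.center (w b) ∧
      (Γ.len s(T.center, w b) : ℝ) = Γ.walkLength (T.leg b) ∧
      (T.leg b).edges = [s(T.center, w b)] ∧ (T.leg b).support = [T.center, w b] := by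
    intro b
    by_cases hb : b = i
    · subst hb
      refine eq_edge_of_tight hred hvW (T.isPath b) h3 (hint b) ?_ ?_
      -- The initial flux -t may be negative here, so positivity needs the length: the value is
      -- L₂(L₁ + L₂/2 - t), and L₁ + L₂/2 is at least half of the leg, which exceeds t.
      · intro L₁ L₂ hL₁ hL₂ hL
        rw [hvw, zero_add, hi] at *
        nlinarith
      · rw [hi]
        linarith [sqrt_three_pos]
    · refine eq_edge_of_tight_of_nonneg hred hvW (T.isPath b) (h4 b hb) (hint b) (by linarith)
        (hvw b).ge ?_
      rw [hk b hb]; exact hx0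
  have hvc : 0 < v T.center := by
    have := sub_eq_of_walkEnergy_le_flux hv (h4 _ h1i.symm)
    rw [hvw, sub_zero, hk _ h1i.symm] at this
    rw [this]
    have : 0 ≤ sideLength w₀ * ((0 / 2 + bestShift l (sideLength w₀) (√3 / 2 - w₀)) / 2) :=
      mul_nonneg hx0.le (by linarith)
    positivity
  have hverts : T.verts = univ := by
    by_contra hne
    obtain ⟨x, -, y, hy, hxy⟩ := exists_boundary_adj h.1 ⟨_, T.center_mem_verts⟩ hne
    have := T.mem_rest_of_notMem hxy.symm hy
    rw [hrest] at this
    simp at this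
  have hwinj : Function.Injective w := fun a b hab =>
    triangle_injective (by rw [← hγw, ← hγw, hab])
  have hwc : ∀ b, w b ≠ T.center := fun b hb => hvc.ne' (hb ▸ hvw b)
  let f : Fin 4 → Fin N := ![w i, w (i + 1), w (i + 2), T.center]
  have hf : Function.Bijective f := by
    have hn1 : w i ≠ w (i + 1) := hwinj.ne h1i
    have hn2 : w i ≠ w (i + 2) := hwinj.ne h2i
    have hn3 : w (i + 1) ≠ w (i + 2) := hwinj.ne h12
    constructor
    · intro a b hab
      fin_cases a <;> fin_cases b <;> simp [f] at hab ⊢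
      all_goals first
        | exact hwc _ hab | exact hwc _ hab.symm | exact hn1 hab | exact hn1 hab.symm
        | exact hn2 hab | exact hn2 hab.symm | exact hn3 hab | exact hn3 hab.symm
    · intro y
      obtain ⟨b, hb⟩ : y ∈ T.verts := hverts ▸ mem_univ y
      rw [(hlegs b).2.2.2, List.mem_pair] at hb
      rcases hb with rfl | rfl
      · exact ⟨3, rfl⟩
      · by_cases hb : b = i
        · exact ⟨0, by simp [f, hb]⟩
        · rcases Fin.eq_or_eq_of_ne i (i + 1) (i + 2) b h1i h2i h12 hb with rfl | rfl
          · exact ⟨1, rfl⟩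
          · exact ⟨2, rfl⟩
  refine ⟨Equiv.ofBijective f hf, i.val, ⟨?_, ?_, ?_, ?_, ?_⟩, ?_, ?_, ?_⟩
  · refine adj_iff_of_edgeSet' _ fun z => ?_
    rw [Tripod.mem_edgeSet'_iff (T := T), hrest]
    simp only [Finset.notMem_empty, false_or, mem_insert_iff, mem_singleton_iff, exists_eq_or_imp,
      exists_eq_left, Sym2.map_mk, (hlegs _).2.2.1, List.mem_singleton, Equiv.ofBijective_apply]
    change (∃ b, z = s(T.center, w b)) ↔
      (s(w i, T.center) = z ∨ s(w (i + 1), T.center) = z ∨ s(w (i + 2), T.center) = z)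
    constructor
    · rintro ⟨b, rfl⟩
      by_cases hb : b = i
      · exact Or.inl (hb ▸ Sym2.eq_swap)
      · rcases Fin.eq_or_eq_of_ne i (i + 1) (i + 2) b h1i h2i h12 hb with rfl | rfl
        · exact Or.inr (Or.inl Sym2.eq_swap)
        · exact Or.inr (Or.inr Sym2.eq_swap)
    · rintro (rfl | rfl | rfl)
      · exact ⟨_, Sym2.eq_swap⟩
      · exact ⟨_, Sym2.eq_swap⟩
      · exact ⟨_, Sym2.eq_swap⟩
  · change W = {w i, w (i + 1), w (i + 2)}
    ext y
    constructor
    · intro hy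
      obtain ⟨a, rfl⟩ := hf.2 y
      fin_cases a
      · exact Or.inl rfl
      · exact Or.inr (Or.inl rfl)
      · exact Or.inr (Or.inr rfl)
      · exact absurd (hvW _ hy) hvc.ne'
    · rintro (rfl | rfl | rfl)
      · exact hwW _
      · exact hwW _
      · exact hwW _
  · change (Γ.len s(w i, T.center) : ℝ) = _
    rw [Sym2.eq_swap, (hlegs i).2.1, hi, sqrt_sideLength h0]
  · change (Γ.len s(w (i + 1), T.center) : ℝ) = _
    rw [Sym2.eq_swap, (hlegs _).2.1, hk _ h1i.symm]
  · change (Γ.len s(w (i + 2), T.center) : ℝ) = _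
    rw [Sym2.eq_swap, (hlegs _).2.1, hk _ h2i.symm]
  · change γ.vert (w i) = _
    rw [hγw, ← triangle_eq_iterate, add_zero]
  · change γ.vert (w (i + 1)) = _
    rw [hγw, ← triangle_eq_iterate]
  · change γ.vert (w (i + 2)) = _
    rw [hγw, ← triangle_eq_iterate]

end MetricGraph

namespace MetricGraph

variable {N : ℕ} {Γ : MetricGraph N} {W : Set (Fin N)} {γ : Γ.Fun Plane}

/-- In the case of equality with a Neumann edge, the rest is a single edge at a maximal vertex of
the tripod. -/
theorem exists_neumann_edge {l w₀ : ℝ} (hl : √3 ≤ l) (h0 : 0 ≤ w₀) (hw₀ : w₀ < √3 / 6)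
    (hopt : ∀ m r, 1 / 2 ≤ m → 3 * m ≤ l → 0 ≤ r → r ≤ neumannLength l √(m ^ 2 - 1 / 4) →
        treeBound l m r ≤ heightBound l w₀ ∧
        (heightBound l w₀ ≤ treeBound l m r → m = sideLength w₀ ∧ r = neumannLength l w₀))
    (hr0 : 0 < neumannLength l w₀) (hγ : γ.IsImmersion) {w : Fin 3 → Fin N}
    (hγw : ∀ i, γ.vert (w i) = triangle i) (hlen : Γ.length = l) (hc : Γ.graph.Connected)
    (hred : Γ.IsReduced W) {v : Fin N → ℝ} (hvW : ∀ i ∈ W, v i = 0) (hvw : ∀ i, v (w i) = 0)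
    (hle : ∑ e ∈ Γ.edgeSet', Γ.vertexEnergy v e ≤ -(1 / 2) * heightBound l w₀)
    (T : Γ.Tripod w) :
    ∃ p i, ∃ (q₁ : Γ.graph.Walk T.center p) (q₂ : Γ.graph.Walk p (w i)), ∃ y ∉ T.verts,
      T.leg i = q₁.append q₂ ∧ (∀ x ∈ T.verts, v x ≤ v p) ∧ T.rest = {s(p, y)} ∧ v p < v y := by
  have hv : Γ.Compatible v := fun i j hij h0 => absurd h0 (hred.1 i j hij).ne'
  obtain ⟨p, i, q₁, q₂, hq, hM⟩ := T.exists_max v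
  obtain ⟨i', hi, hk, hr, hi'⟩ :=
    (Tripod.heightBound_le hopt h0 hγ hγw hlen hc hv hvw hq hM).2 hle
  obtain rfl := hi' (hr ▸ hr0) (bestShift_sideLength_pos hl h0 hw₀)
  obtain ⟨h1i, h2i, h12⟩ := Fin.three_ne_add i'
  obtain ⟨h1, h2⟩ := Tripod.tight_of_le_heightBound hl h0 hw₀.le hc hv hvw h1i h2i h12 hi
    (hk _ h1i.symm) (hk _ h2i.symm) hr hle hq (Or.inl hM)
  obtain ⟨h3, -, -, -⟩ := h2 (Or.inr (h1 hr0))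
  have hp0 : 0 ≤ v p := hvw 0 ▸ hM (w 0) ⟨0, SimpleGraph.Walk.end_mem_support _⟩
  have hrest := eq_singleton_of_sum_vertexEnergy_le hc hred.1 _ T.verts T.rest (v p) rfl
    ⟨_, T.center_mem_verts⟩ T.rest_subset (fun _ _ h hi => T.mem_rest_of_notMem h hi) hM hp0
    (fun i _ h => hvW i (hred.2 i h)) h3
  rcases hrest with hrest | ⟨x, ⟨b, hb⟩, y, hy, hrest, hvx, hvy⟩
  · rw [Tripod.restLength, hrest, Finset.sum_empty] at hr
    exact absurd hr hr0.ne
  -- The Neumann edge may start at a maximal vertex x other than the p chosen first; x now takes its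
  -- place.
  · obtain ⟨q₁', q₂', hq'⟩ := SimpleGraph.Walk.mem_support_iff_exists_append.1 hb
    exact ⟨x, b, q₁', q₂', y, hy, hq', hvx ▸ hM, hrest, hvx ▸ hvy⟩

-- The values increase strictly from the centre to p and on to the free end, so none of these three
-- vertices is Dirichlet. The paths from p to the centre, from p to its Dirichlet end and along the
-- other two legs are tight with nonnegative flux, hence single edges.
set_option maxHeartbeats 1000000 in
theorem exists_isGamma3_of_le {l w₀ : ℝ} (hl : √3 ≤ l) (h0 : 0 ≤ w₀) (hw₀ : w₀ < √3 / 6)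
    (hopt : ∀ m r, 1 / 2 ≤ m → 3 * m ≤ l → 0 ≤ r → r ≤ neumannLength l √(m ^ 2 - 1 / 4) →
        treeBound l m r ≤ heightBound l w₀ ∧
        (heightBound l w₀ ≤ treeBound l m r → m = sideLength w₀ ∧ r = neumannLength l w₀))
    (hr0 : 0 < neumannLength l w₀)
    (h : IsCompetitor (range triangle) l Γ W γ) (hred : Γ.IsReduced W)
    (hE : Γ.energy W ≤ -(1 / 2) * heightBound l w₀) :
    ∃ (e : Fin 6 ≃ Fin N) (k : ℕ), IsGamma3 l (sideLength w₀) Γ W e ∧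
      γ.vert (e 0) = rot^[k] (triangle 0) ∧ γ.vert (e 1) = rot^[k] (triangle 1) ∧
      γ.vert (e 2) = rot^[k] (triangle 2) := by
  obtain ⟨w, hwW, hγw⟩ := h.exists_vertices
  obtain ⟨v, hvW, hvE⟩ := exists_minimizer h.1 ⟨w 0, hwW 0⟩ hred.1
  have hle := hvE.trans hE
  have hv : Γ.Compatible v := fun i j hij h0 => absurd h0 (hred.1 i j hij).ne'
  have hvw : ∀ i, v (w i) = 0 := fun i => hvW _ (hwW i)
  obtain ⟨T⟩ := exists_tripod h.1 w
  obtain ⟨p, i', q₁, q₂, y', hy', hq, hM, hrest, hvy'⟩ := exists_neumann_edge hl h0 hw₀ hopt hr0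
    h.2.2.1 hγw h.2.1 h.1 hred hvW hvw hle T
  obtain ⟨i, hi, hk, hr, hii⟩ :=
    (Tripod.heightBound_le hopt h0 h.2.2.1 hγw h.2.1 h.1 hv hvw hq hM).2 hle
  have ht := bestShift_sideLength_pos hl h0 hw₀
  obtain rfl := hii (hr ▸ hr0) ht
  have hx0 := sideLength_pos w₀
  obtain ⟨h1i, h2i, h12⟩ := Fin.three_ne_add i
  obtain ⟨hτ, htight⟩ := Tripod.tight_of_le_heightBound hl h0 hw₀.le h.1 hv hvw h1i h2i h12 hi
    (hk _ h1i.symm) (hk _ h2i.symm) hr hle hq (Or.inl hM)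
  have hL₁ := hτ hr0
  obtain ⟨-, h2, h3, h4⟩ := htight (Or.inr hL₁)
  have ht0 := half_add_bestShift_nonneg hl h0 hw₀.le
  have ht1 := two_mul_bestShift_lt (a := √3 / 2 - w₀) hl h0 hw₀.le
  have hL₂ : Γ.walkLength q₂ =
      √3 / 2 - w₀ - bestShift l (sideLength w₀) (√3 / 2 - w₀) := by
    have := hi
    rw [hq, walkLength_append, hL₁] at this
    linarith
  have hLr : 0 < Γ.walkLength q₁.reverse := by rw [walkLength_reverse, hL₁]; exact ht
  set t := bestShift l (sideLength w₀) (√3 / 2 - w₀)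
  set r := neumannLength l w₀
  rw [hL₁, add_sub_cancel_right] at h2
  rw [hL₁, sub_add_cancel] at h3
  have hvc : 0 < v T.center := by
    have := sub_eq_of_walkEnergy_le_flux hv (h4 _ h1i.symm)
    rw [hvw, sub_zero, hk _ h1i.symm] at this
    rw [this]
    have : 0 ≤ sideLength w₀ * ((r / 2 + t) / 2) := mul_nonneg hx0.le (by linarith)
    positivity
  have hvp : v T.center < v p := by
    have := sub_eq_of_walkEnergy_le_flux hv h2
    have : 0 < Γ.walkLength q₁.reverse * (r / 2) + Γ.walkLength q₁.reverse ^ 2 / 2 := by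
      positivity
    linarith
  have hwc : ∀ b, w b ≠ T.center := fun b hb => hvc.ne' (hb ▸ hvw b)
  have hwp : ∀ b, w b ≠ p := fun b hb => (hvc.trans hvp).ne' (hb ▸ hvw b)
  have hcp : T.center ≠ p := fun h => hvp.ne (congrArg v h)
  have hnot : ∀ b, ∀ y ∈ (T.leg b).support, y ≠ p → ∀ n, s(y, n) ∉ T.rest := by
    intro b y hy hyp n hn
    rw [hrest, Finset.mem_singleton, Sym2.eq_iff] at hn
    rcases hn with h | h
    · exact hyp h.1
    · exact hy' ⟨b, h.1 ▸ hy⟩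
  have hpath : (q₁.append q₂).IsPath := hq ▸ T.isPath i
  have hpi : p ∈ (T.leg i).support := by rw [hq]; simp
  have hint : ∀ b, b ≠ i → ∀ y ∈ (T.leg b).support, y ≠ T.center → y ≠ w b →
      ∀ n, Γ.graph.Adj y n → s(y, n) ∈ (T.leg b).edges := fun b hb y hy hyc _ n hn =>
    Tripod.mem_edges_of_notMem_rest hy hyc hn <| hnot b y hy
      (fun hyp => hcp (T.eq_center b i hb p (hyp ▸ hy) hpi).symm) n
  have hinti : ∀ y ∈ (T.leg i).support, y ≠ T.center → y ≠ p → ∀ n, Γ.graph.Adj y n →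
      s(y, n) ∈ q₁.edges ∨ s(y, n) ∈ q₂.edges := fun y hy hyc hyp n hn => by
    have := Tripod.mem_edges_of_notMem_rest hy hyc hn (hnot i y hy hyp n)
    rwa [hq, SimpleGraph.Walk.edges_append, List.mem_append] at this
  obtain ⟨-, hA₁, hA₂, hA₃⟩ := eq_edge_of_tight_of_nonneg hred hvW hpath.of_append_left.reverse h2
    (fun y hy hyp hyc n hn => by
      rw [SimpleGraph.Walk.support_reverse, List.mem_reverse] at hy
      rw [SimpleGraph.Walk.edges_reverse, List.mem_reverse]
      rcases hinti y (by rw [hq, SimpleGraph.Walk.mem_support_append_iff]; exact Or.inl hy) hyc hyp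
        n hn with h | h
      · exact h
      · exact absurd rfl (hpath.ne_of_mem_support_of_append hyp hy
          (SimpleGraph.Walk.fst_mem_support_of_mem_edges _ h)))
    (by positivity) hvc.le hLr
  obtain ⟨-, hB₁, hB₂, hB₃⟩ := eq_edge_of_tight_of_nonneg hred hvW hpath.of_append_right h3
    (fun y hy hyp hyc n hn => by
      have hy1 : y ≠ T.center := fun h => hpath.ne_of_mem_support_of_append hyp
        (h.symm ▸ q₁.start_mem_support) hy rfl
      rcases hinti y (by rw [hq, SimpleGraph.Walk.mem_support_append_iff]; exact Or.inr hy) hy1 hyp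
        n hn with h | h
      · exact absurd rfl (hpath.ne_of_mem_support_of_append hyp
          (SimpleGraph.Walk.fst_mem_support_of_mem_edges _ h) hy)
      · exact h)
    (by positivity) (hvw i).ge (by rw [hL₂]; linarith)
  have hlegs : ∀ b, b ≠ i →  (Γ.len s(T.center, w b) : ℝ) = sideLength w₀ ∧
      (T.leg b).edges = [s(T.center, w b)] ∧ (T.leg b).support = [T.center, w b] := by
    intro b hb
    have := eq_edge_of_tight_of_nonneg hred hvW (T.isPath b) (h4 b hb) (hint b hb) (by linarith)
      (hvw b).ge (by rw [hk b hb]; exact hx0)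
    exact ⟨this.2.1.trans (hk b hb), this.2.2.1, this.2.2.2⟩
  rw [SimpleGraph.Walk.edges_reverse, List.reverse_eq_iff, List.reverse_singleton] at hA₂
  rw [SimpleGraph.Walk.support_reverse, List.reverse_eq_iff] at hA₃
  have hedges : (T.leg i).edges = [s(p, T.center), s(p, w i)] := by
    rw [hq, SimpleGraph.Walk.edges_append, hA₂, hB₂]; rfl
  have hsupp : ∀ y, y ∈ (T.leg i).support ↔ y = T.center ∨ y = p ∨ y = w i := by
    intro y
    rw [hq, SimpleGraph.Walk.mem_support_append_iff, hA₃, hB₃]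
    rw [List.mem_reverse, List.mem_pair, List.mem_pair]
    constructor
    · rintro ((h | h) | (h | h)) <;> simp only [h, true_or, or_true]
    · rintro (h | h | h) <;> simp only [h, true_or, or_true]
  have hverts : ∀ y, y ∈ T.verts ∨ y = y' := by
    by_contra! hne
    obtain ⟨z, hz, hzy⟩ := hne
    obtain ⟨x, hx, y, hy, hxy⟩ := exists_boundary_adj h.1 (X := T.verts ∪ {y'})
      ⟨_, Or.inl T.center_mem_verts⟩ (fun h => by
        have : z ∈ T.verts ∪ {y'} := h ▸ mem_univ z
        rcases this with h | h
        · exact hz h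
        · exact hzy h)
    have := T.mem_rest_of_notMem hxy.symm fun h => hy (Or.inl h)
    rw [hrest, Finset.mem_singleton, Sym2.eq_iff] at this
    rcases this with h | h
    · exact hy (Or.inl (h.1 ▸ ⟨i, hpi⟩))
    · exact hy (Or.inr h.1)
  have hwinj : Function.Injective w := fun a b hab =>
    triangle_injective (by rw [← hγw, ← hγw, hab])
  have hvy0 : v y' ≠ 0 := ((hvc.trans hvp).trans hvy').ne'
  have hwy : ∀ b, w b ≠ y' := fun b hb => hvy0 (hb ▸ hvw b)
  have hcy : T.center ≠ y' := fun h => hy' (h ▸ T.center_mem_verts)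
  have hpy : p ≠ y' := fun h => hvy'.ne (congrArg v h)
  let f : Fin 6 → Fin N := ![w i, w (i + 1), w (i + 2), T.center, p, y']
  have hf : Function.Bijective f := by
    have hn1 : w i ≠ w (i + 1) := hwinj.ne h1i
    have hn2 : w i ≠ w (i + 2) := hwinj.ne h2i
    have hn3 : w (i + 1) ≠ w (i + 2) := hwinj.ne h12
    constructor
    · intro a b hab
      have h01 : ∀ a b : Fin 6, a < b → f a ≠ f b := by
        intro a b hab
        fin_cases a <;> fin_cases b <;> simp at hab <;> simp [f]
        all_goals first
          | exact hwc _ | exact hwp _ | exact hwy _ | assumption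
      rcases lt_trichotomy a b with h | h | h
      · exact absurd hab (h01 a b h)
      · exact h
      · exact absurd hab.symm (h01 b a h)
    · intro y
      rcases hverts y with ⟨b, hb⟩ | rfl
      · by_cases hbi : b = i
        · subst hbi
          rw [hsupp] at hb
          rcases hb with rfl | rfl | rfl
          · exact ⟨3, rfl⟩
          · exact ⟨4, rfl⟩
          · exact ⟨0, rfl⟩
        · rw [(hlegs b hbi).2.2, List.mem_pair] at hb
          rcases hb with rfl | rfl
          · exact ⟨3, rfl⟩
          · rcases Fin.eq_or_eq_of_ne i (i + 1) (i + 2) b h1i h2i h12 hbi with rfl | rfl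
            · exact ⟨1, rfl⟩
            · exact ⟨2, rfl⟩
      · exact ⟨5, rfl⟩
  have htt := two_mul_bestShift l (sideLength w₀) (√3 / 2 - w₀)
  change 2 * t = _ at htt
  have hy2 := two_mul_sub_sideLength_pos hl h0 hw₀.le
  have hdd : l * sideLength w₀ / (2 * (2 * l - 3 * sideLength w₀))
      = (sideLength w₀ * l / (2 * l - 3 * sideLength w₀)) / 2 := by
    field_simp
  refine ⟨Equiv.ofBijective f hf, i.val, ⟨?_, ?_, ?_, ?_, ?_, ?_, ?_⟩, ?_, ?_, ?_⟩
  · refine adj_iff_of_edgeSet' _ fun z => ?_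
    rw [Tripod.mem_edgeSet'_iff (T := T), hrest]
    simp only [Finset.mem_singleton, mem_insert_iff, mem_singleton_iff, exists_eq_or_imp,
      exists_eq_left, Sym2.map_mk, Equiv.ofBijective_apply]
    change (z = s(p, y') ∨ ∃ b, z ∈ (T.leg b).edges) ↔
      (s(w i, p) = z ∨ s(w (i + 1), T.center) = z ∨ s(w (i + 2), T.center) = z ∨
        s(T.center, p) = z ∨ s(p, y') = z)
    constructor
    · rintro (rfl | ⟨b, hb⟩)
      · simp
      · by_cases hbi : b = i
        · subst hbi
          rw [hedges, List.mem_pair] at hb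
          rcases hb with rfl | rfl
          · exact Or.inr (Or.inr (Or.inr (Or.inl Sym2.eq_swap)))
          · exact Or.inl Sym2.eq_swap
        · rw [(hlegs b hbi).2.1, List.mem_singleton] at hb
          rcases Fin.eq_or_eq_of_ne i (i + 1) (i + 2) b h1i h2i h12 hbi with rfl | rfl
          · exact Or.inr (Or.inl (hb.trans Sym2.eq_swap).symm)
          · exact Or.inr (Or.inr (Or.inl (hb.trans Sym2.eq_swap).symm))
    · rintro (rfl | rfl | rfl | rfl | rfl)
      · exact Or.inr ⟨i, by rw [hedges, Sym2.eq_swap]; simp⟩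
      · exact Or.inr ⟨i + 1, by rw [(hlegs _ h1i.symm).2.1, Sym2.eq_swap]; simp⟩
      · exact Or.inr ⟨i + 2, by rw [(hlegs _ h2i.symm).2.1, Sym2.eq_swap]; simp⟩
      · exact Or.inr ⟨i, by rw [hedges, Sym2.eq_swap]; simp⟩
      · exact Or.inl rfl
  · change W = {w i, w (i + 1), w (i + 2)}
    ext y
    constructor
    · intro hy
      obtain ⟨a, rfl⟩ := hf.2 y
      fin_cases a
      · exact Or.inl rfl
      · exact Or.inr (Or.inl rfl)
      · exact Or.inr (Or.inr rfl)
      · exact absurd (hvW _ hy) hvc.ne'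
      · exact absurd (hvW _ hy) (hvc.trans hvp).ne'
      · exact absurd (hvW _ hy) hvy0
    · rintro (rfl | rfl | rfl)
      · exact hwW _
      · exact hwW _
      · exact hwW _
  · change (Γ.len s(w i, p) : ℝ) = _
    rw [Sym2.eq_swap, hB₁, hL₂, sqrt_four_mul_sideLength h0, hdd]
    linarith
  · change (Γ.len s(w (i + 1), T.center) : ℝ) = _
    rw [Sym2.eq_swap, (hlegs _ h1i.symm).1]
  · change (Γ.len s(w (i + 2), T.center) : ℝ) = _
    rw [Sym2.eq_swap, (hlegs _ h2i.symm).1]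
  · change (Γ.len s(T.center, p) : ℝ) = _
    rw [Sym2.eq_swap, hA₁, walkLength_reverse, hL₁, sqrt_four_mul_sideLength h0, hdd]
    linarith
  · change (Γ.len s(p, y') : ℝ) = _
    rw [Tripod.restLength, hrest, Finset.sum_singleton] at hr
    rw [hr, sqrt_four_mul_sideLength h0]
    simp only [r, neumannLength]
    ring
  · change γ.vert (w i) = _
    rw [hγw, ← triangle_eq_iterate, add_zero]
  · change γ.vert (w (i + 1)) = _
    rw [hγw, ← triangle_eq_iterate]
  · change γ.vert (w (i + 2)) = _
    rw [hγw, ← triangle_eq_iterate]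

end MetricGraph

/-! ### Straight drawings that attain the bound -/

theorem Isometry.hasUnitSpeedOn {E : Type*} [PseudoEMetricSpace E] {f : ℝ → E} (hf : Isometry f)
    (s : Set ℝ) : HasUnitSpeedOn f s := by
  intro x hx y hy
  have h1 : eVariationOn f (s ∩ Icc x y) = eVariationOn id (s ∩ Icc x y) := by
    unfold eVariationOn
    simp only [hf.edist_eq, id]
  rw [h1]
  rw [MonotoneOn.eVariationOn_eq (monotone_id.monotoneOn _) hx hy]
  simp

theorem isometry_lineMap_div {p q : Plane} (h : p ≠ q) :
    Isometry fun x : ℝ => AffineMap.lineMap p q (x / dist p q) := by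
  refine Isometry.of_dist_eq fun x y => ?_
  have hd : 0 < dist p q := dist_pos.2 h
  rw [dist_lineMap_lineMap, Real.dist_eq, Real.dist_eq, ← sub_div, abs_div, abs_of_pos hd,
    div_mul_cancel₀ _ hd.ne']

namespace MetricGraph

variable {N : ℕ}

/-- The metric graph drawn with straight edges between given points. -/
noncomputable def straight (G : SimpleGraph (Fin N)) (q : Fin N → Plane) : MetricGraph N where
  graph := G
  len := Sym2.lift ⟨fun i j => nndist (q i) (q j), fun _ _ => nndist_comm _ _⟩

variable {G : SimpleGraph (Fin N)} {q : Fin N → Plane}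

theorem straight_len (i j : Fin N) : ((straight G q).len s(i, j) : ℝ) = dist (q i) (q j) := rfl

/-- The straight drawing. -/
noncomputable def straightFun (G : SimpleGraph (Fin N)) {q : Fin N → Plane}
    (hq : Function.Injective q) : (straight G q).Fun Plane where
  vert := q
  edge i j x := AffineMap.lineMap (q i) (q j) (x / dist (q i) (q j))
  edge_zero i j _ := by simp
  edge_symm i j h x _ := by
    have hd : dist (q i) (q j) ≠ 0 := dist_ne_zero.2 (hq.ne h.ne)
    rw [straight_len, sub_div, div_self hd, AffineMap.lineMap_apply_one_sub, dist_comm]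

theorem isImmersion_straightFun (hq : Function.Injective q) : (straightFun G hq).IsImmersion :=
  fun i j h =>
    have h1 := isometry_lineMap_div (hq.ne (show i ≠ j from h.ne))
    ⟨h1.continuous.continuousOn, h1.injective.injOn, h1.hasUnitSpeedOn _⟩

theorem straightFun_mem_openSegment (hq : Function.Injective q) {i j : Fin N} (h : G.Adj i j) :
    (straightFun G hq).edge i j '' Ioo 0 ((straight G q).len s(i, j)) ⊆
      openSegment ℝ (q i) (q j) := by
  rintro _ ⟨x, hx, rfl⟩
  have hd : 0 < dist (q i) (q j) := dist_pos.2 (hq.ne h.ne)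
  rw [openSegment_eq_image_lineMap]
  exact ⟨_, ⟨div_pos hx.1 hd, (div_lt_one hd).2 hx.2⟩, rfl⟩

theorem straightFun_mem_segment (hq : Function.Injective q) {i j : Fin N} (h : G.Adj i j) :
    (straightFun G hq).edge i j '' Icc 0 ((straight G q).len s(i, j)) ⊆
      segment ℝ (q i) (q j) := by
  rintro _ ⟨x, hx, rfl⟩
  have hd : 0 < dist (q i) (q j) := dist_pos.2 (hq.ne h.ne)
  rw [segment_eq_image_lineMap]
  exact ⟨_, ⟨div_nonneg hx.1 hd.le, (div_le_one hd).2 hx.2⟩, rfl⟩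

/-- Listing each edge once, with chosen ends, reduces embeddedness to finitely many pairs of
segments. -/
theorem isEmbedding_straightFun (hq : Function.Injective q) {m : ℕ} {a b : Fin m → Fin N}
    (hG : ∀ i j, G.Adj i j → ∃ k, s(i, j) = s(a k, b k))
    (h : ∀ k k', k ≠ k' →
      Disjoint (openSegment ℝ (q (a k)) (q (b k))) (segment ℝ (q (a k')) (q (b k')))) :
    (straightFun G hq).IsEmbedding := by
  refine ⟨isImmersion_straightFun hq, ?_, hq⟩
  intro i j i' j' hij hij' hne
  refine Disjoint.mono (straightFun_mem_openSegment hq hij) (straightFun_mem_segment hq hij') ?_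
  obtain ⟨k, hk⟩ := hG i j hij
  obtain ⟨k', hk'⟩ := hG i' j' hij'
  have h1 := h k k' fun h => hne (by rw [hk, hk', h])
  have ho : openSegment ℝ (q i) (q j) = openSegment ℝ (q (a k)) (q (b k)) := by
    rcases Sym2.eq_iff.1 hk with ⟨rfl, rfl⟩ | ⟨rfl, rfl⟩
    · rfl
    · exact openSegment_symm _ _ _
  have hs : segment ℝ (q i') (q j') = segment ℝ (q (a k')) (q (b k')) := by
    rcases Sym2.eq_iff.1 hk' with ⟨rfl, rfl⟩ | ⟨rfl, rfl⟩
    · rfl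
    · exact segment_symm _ _ _
  rwa [ho, hs]

theorem straight_len_pos (hq : Function.Injective q) (i j : Fin N) (h : G.Adj i j) :
    0 < (straight G q).len s(i, j) := by
  rw [← NNReal.coe_pos, straight_len]
  exact dist_pos.2 (hq.ne h.ne)

end MetricGraph

theorem Plane.dist_eq (p q : Plane) : dist p q = √((p 0 - q 0) ^ 2 + (p 1 - q 1) ^ 2) := by
  rw [EuclideanSpace.dist_eq, Fin.sum_univ_two, Real.dist_eq, Real.dist_eq, sq_abs, sq_abs]

/-- The energy of an edge on which the flux is consistent with the values at the ends. -/
theorem edgeEnergy_eq_flux {L a b φ : ℝ} (hL : L ≠ 0) (h : a - b = L * φ + L ^ 2 / 2) :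
    edgeEnergy L a b = φ * a - (φ + L) * b - ((φ + L) ^ 3 - φ ^ 3) / 6 := by
  obtain rfl : a = b + (L * φ + L ^ 2 / 2) := by linarith
  unfold edgeEnergy
  field_simp
  ring

/-- The values at the Kirchhoff vertices which are computed along different paths agree. -/
theorem flux_consistent {l w : ℝ} (hl : √3 ≤ l) (h0 : 0 ≤ w) (hw : w ≤ √3 / 6) :
    let r := neumannLength l w
    let t := bestShift l (sideLength w) (√3 / 2 - w)
    let s := √3 / 2 - w - t
    s * (r / 2) + s ^ 2 / 2 - (t * (r / 2) + t ^ 2 / 2) =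
      sideLength w * ((r / 2 + t) / 2) + sideLength w ^ 2 / 2 := by
  intro r t s
  have hy := two_mul_sub_sideLength_pos hl h0 hw
  have ha : √3 / 2 - w = l - 2 * sideLength w - r := by simp only [r, neumannLength]; ring
  have h1 : r / 2 + t = (l - sideLength w) * (l - 3 * sideLength w) / (2 * l - 3 * sideLength w) :=
    half_add_bestShift hy (by linarith)
  have h2 : 2 * t = (√3 / 2 - w) - sideLength w * l / (2 * l - 3 * sideLength w) :=
    two_mul_bestShift _ _ _
  have h3 : s - t = sideLength w * l / (2 * l - 3 * sideLength w) := by simp only [s]; linarith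
  have h4 : r + s + t = l - 2 * sideLength w := by simp only [s]; linarith
  have h5 : s * (r / 2) + s ^ 2 / 2 - (t * (r / 2) + t ^ 2 / 2) = (s - t) * (r + s + t) / 2 := by
    ring
  rw [h5, h3, h4, h1]
  clear_value r
  clear h1 h2 h3 h4 h5 ha hl
  generalize sideLength w = x at hy ⊢
  obtain ⟨y, rfl⟩ : ∃ y, l = (y + 3 * x) / 2 := ⟨2 * l - 3 * x, by ring⟩
  have hyy : 2 * ((y + 3 * x) / 2) - 3 * x = y := by ring
  rw [hyy] at hy ⊢
  have := hy.ne'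
  field_simp
  ring

namespace MetricGraph

variable {N : ℕ} {q : Fin N → Plane}

theorem edgeSet'_straight {S : Finset (Sym2 (Fin N))} (hS : ∀ z ∈ S, ¬ z.IsDiag) :
    (straight (SimpleGraph.fromEdgeSet (S : Set (Sym2 (Fin N)))) q).edgeSet' = S := by
  ext z
  induction z with | _ i j
  rw [mem_edgeSet']
  change (SimpleGraph.fromEdgeSet _).Adj i j ↔ _
  rw [SimpleGraph.fromEdgeSet_adj, Finset.mem_coe]
  exact ⟨fun h => h.1, fun h => ⟨h, fun hij => hS _ h (by simp [hij])⟩⟩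

theorem fromEdgeSet_adj_iff {S : Finset (Sym2 (Fin N))} (hS : ∀ z ∈ S, ¬ z.IsDiag) (i j : Fin N) :
    (SimpleGraph.fromEdgeSet (S : Set (Sym2 (Fin N)))).Adj i j ↔ s(i, j) ∈ S := by
  rw [SimpleGraph.fromEdgeSet_adj, Finset.mem_coe]
  exact ⟨fun h => h.1, fun h => ⟨h, fun hij => hS _ h (by simp [hij])⟩⟩

end MetricGraph

theorem mem_segment_coord {p q P : Plane} (h : P ∈ segment ℝ p q) :
    ∃ a ∈ Icc (0 : ℝ) 1, P 0 = a * p 0 + (1 - a) * q 0 ∧ P 1 = a * p 1 + (1 - a) * q 1 := by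
  obtain ⟨a, b, ha, hb, hab, rfl⟩ := h
  obtain rfl : b = 1 - a := by linarith
  exact ⟨a, ⟨ha, by linarith⟩, by simp, by simp⟩

theorem mem_openSegment_coord {p q P : Plane} (h : P ∈ openSegment ℝ p q) :
    ∃ a ∈ Ioo (0 : ℝ) 1, P 0 = a * p 0 + (1 - a) * q 0 ∧ P 1 = a * p 1 + (1 - a) * q 1 := by
  obtain ⟨a, b, ha, hb, hab, rfl⟩ := h
  obtain rfl : b = 1 - a := by linarith
  exact ⟨a, ⟨ha, by linarith⟩, by simp, by simp⟩

theorem triangle_zero : triangle 0 = !₂[-(√3 / 3), 0] := rfl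

theorem triangle_one : triangle 1 = !₂[√3 / 6, -(1 / 2)] := rfl

theorem triangle_two : triangle 2 = !₂[√3 / 6, 1 / 2] := rfl

theorem range_triangle : range triangle = {triangle 0, triangle 1, triangle 2} := by
  ext P
  constructor
  · rintro ⟨i, rfl⟩
    fin_cases i <;> simp
  · rintro (rfl | rfl | rfl) <;> exact mem_range_self _

/-- The Kirchhoff vertex of the symmetric tripod of height `w`. -/
noncomputable def tripodCenter (w : ℝ) : Plane := !₂[√3 / 6 - w, 0]

theorem dist_triangle_zero_tripodCenter {w : ℝ} (hw : w ≤ √3 / 2) :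
    dist (triangle 0) (tripodCenter w) = √3 / 2 - w := by
  rw [Plane.dist_eq]
  simp only [triangle_zero, tripodCenter, PiLp.toLp_apply, Matrix.cons_val_zero, Matrix.cons_val_one]
  rw [show (-(√3 / 3) - (√3 / 6 - w)) ^ 2 + (0 - 0) ^ 2 = (√3 / 2 - w) ^ 2 by ring]
  exact Real.sqrt_sq (by linarith)

theorem dist_triangle_one_tripodCenter (w : ℝ) :
    dist (triangle 1) (tripodCenter w) = sideLength w := by
  rw [Plane.dist_eq]
  simp only [triangle_one, tripodCenter, PiLp.toLp_apply, Matrix.cons_val_zero, Matrix.cons_val_one]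
  unfold sideLength
  congr 1; ring

theorem dist_triangle_two_tripodCenter (w : ℝ) :
    dist (triangle 2) (tripodCenter w) = sideLength w := by
  rw [Plane.dist_eq]
  simp only [triangle_two, tripodCenter, PiLp.toLp_apply, Matrix.cons_val_zero, Matrix.cons_val_one]
  unfold sideLength
  congr 1; ring

/-- The tripod as a solution. -/
theorem exists_tripod_drawing {l w₀ : ℝ} (hl : √3 ≤ l) (h0 : 0 ≤ w₀) (hw₀ : w₀ ≤ √3 / 6)
    (hopt : ∀ m r, 1 / 2 ≤ m → 3 * m ≤ l → 0 ≤ r → r ≤ neumannLength l √(m ^ 2 - 1 / 4) →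
        treeBound l m r ≤ heightBound l w₀ ∧
        (heightBound l w₀ ≤ treeBound l m r → m = sideLength w₀ ∧ r = neumannLength l w₀))
    (hr0 : neumannLength l w₀ = 0) :
    ∃ (N : ℕ) (Γ : MetricGraph N) (W : Set (Fin N)) (γ : Γ.Fun Plane) (e : Fin 4 ≃ Fin N),
      IsGamma1 (sideLength w₀) Γ W e ∧ Γ.IsReduced W ∧
      IsCompetitor (range triangle) l Γ W γ ∧ Γ.energy W ≤ -(1 / 2) * heightBound l w₀ ∧
      γ.IsEmbedding ∧
      γ.vert (e 0) = triangle 0 ∧ γ.vert (e 1) = triangle 1 ∧ γ.vert (e 2) = triangle 2 := by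
  have h3 := sqrt_three_pos
  let q : Fin 4 → Plane := ![triangle 0, triangle 1, triangle 2, tripodCenter w₀]
  have hq0 : ∀ i, q i 0 = (![-(√3 / 3), √3 / 6, √3 / 6, √3 / 6 - w₀] : Fin 4 → ℝ) i := by
    intro i; fin_cases i <;> simp [q, triangle, tripodCenter]
  have hq1 : ∀ i, q i 1 = (![0, -(1 / 2), 1 / 2, 0] : Fin 4 → ℝ) i := by
    intro i; fin_cases i <;> simp [q, triangle, tripodCenter]
  have hq : Function.Injective q := by
    intro i j hij
    have e0 : q i 0 = q j 0 := by rw [hij]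
    have e1 : q i 1 = q j 1 := by rw [hij]
    rw [hq0, hq0] at e0
    rw [hq1, hq1] at e1
    fin_cases i <;> fin_cases j <;> first | rfl | skip
    all_goals
      exfalso
      simp at e0 e1 <;> linarith
  let S : Finset (Sym2 (Fin 4)) := {s(0, 3), s(1, 3), s(2, 3)}
  have hS : ∀ z ∈ S, ¬ z.IsDiag := by decide
  let G := SimpleGraph.fromEdgeSet (S : Set (Sym2 (Fin 4)))
  have hG : ∀ i j, G.Adj i j ↔ s(i, j) ∈ S := MetricGraph.fromEdgeSet_adj_iff hS
  let Γ := MetricGraph.straight G q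
  let W : Set (Fin 4) := {0, 1, 2}
  let γ : Γ.Fun Plane := MetricGraph.straightFun G hq
  have l0 : (Γ.len s(0, 3) : ℝ) = √3 / 2 - w₀ := dist_triangle_zero_tripodCenter (by linarith)
  have l1 : (Γ.len s(1, 3) : ℝ) = sideLength w₀ := dist_triangle_one_tripodCenter _
  have l2 : (Γ.len s(2, 3) : ℝ) = sideLength w₀ := dist_triangle_two_tripodCenter _
  have hpos : ∀ i j, Γ.graph.Adj i j → 0 < Γ.len s(i, j) := MetricGraph.straight_len_pos hq
  have hc : Γ.graph.Connected := by
    rw [SimpleGraph.connected_iff_exists_forall_reachable]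
    have : ∀ i : Fin 4, i = 3 ∨ s(3, i) ∈ S := by decide
    refine ⟨3, fun i => ?_⟩
    rcases this i with rfl | h
    · rfl
    · exact SimpleGraph.Adj.reachable ((hG _ _).2 h)
  have hedge : Γ.edgeSet' = S := MetricGraph.edgeSet'_straight hS
  have hsum : ∀ f : Sym2 (Fin 4) → ℝ,
      ∑ z ∈ Γ.edgeSet', f z = f s(0, 3) + (f s(1, 3) + f s(2, 3)) := by
    intro f
    rw [hedge, Finset.sum_insert (by decide), Finset.sum_insert (by decide), Finset.sum_singleton]
  have hlen : Γ.length = l := by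
    rw [Γ.length_eq, hsum, l0, l1, l2]
    unfold neumannLength at hr0
    linarith
  have hemb : γ.IsEmbedding := by
    refine MetricGraph.isEmbedding_straightFun hq (a := ![0, 1, 2]) (b := ![3, 3, 3]) ?_ ?_
    · intro i j hij
      rw [hG] at hij
      have : ∀ z ∈ S, ∃ k : Fin 3, z = s((![0, 1, 2] : Fin 3 → Fin 4) k,
        (![3, 3, 3] : Fin 3 → Fin 4) k) := by decide
      exact this _ hij
    · intro k k' hne
      rw [Set.disjoint_left]
      intro P hO hC
      obtain ⟨a, ⟨ha, ha'⟩, hO0, hO1⟩ := mem_openSegment_coord hO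
      obtain ⟨b, ⟨hb, hb'⟩, hC0, hC1⟩ := mem_segment_coord hC
      rw [hC0, hq0, hq0, hq0, hq0] at hO0
      rw [hC1, hq1, hq1, hq1, hq1] at hO1
      fin_cases k <;> fin_cases k' <;> first | exact hne rfl | skip
      all_goals
        simp at hO0 hO1
        nlinarith
  have hcomp : IsCompetitor (range triangle) l Γ W γ := by
    refine ⟨hc, hlen, hemb.1, ?_⟩
    rw [range_triangle]
    change q '' {0, 1, 2} = _
    rw [image_insert_eq, image_insert_eq, image_singleton]
    rfl
  refine ⟨4, Γ, W, γ, Equiv.refl _, ⟨?_, rfl, ?_, l1, l2⟩, ⟨hpos, ?_⟩, hcomp, ?_, hemb, rfl, rfl, rfl⟩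
  · intro a b
    change G.Adj a b ↔ _
    rw [hG]; simp [S]
  · rw [sqrt_sideLength h0]; exact l0
  · intro i hi
    have hns : ∀ i : Fin 4, i ∈ W ∨ i = 3 := by
      intro i; fin_cases i <;> simp [W]
    rcases hns i with h | rfl
    · exact h
    · exfalso
      have : Γ.graph.neighborSet 3 = ((Finset.univ.filter fun i => s(3, i) ∈ S : Finset (Fin 4))
          : Set (Fin 4)) := by
        ext i
        rw [SimpleGraph.mem_neighborSet]
        simp only [Finset.coe_filter, Finset.mem_univ, true_and, mem_ofPred_eq]
        exact hG _ _
      rw [this, Set.ncard_coe_finset] at hi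
      revert hi; decide
  · set t := bestShift l (sideLength w₀) (√3 / 2 - w₀) with ht
    have hcost := cost_eq_heightBound hl h0 hw₀
    have hflux := flux_consistent hl h0 hw₀
    simp only [← ht, hr0] at hcost hflux
    -- The value at the centre comes from integrating the flux t/2 + x along a leg of length
    -- `sideLength w₀`; by `flux_consistent` the third leg, with flux -t, gives the same value.
    let v : Fin 4 → ℝ := ![0, 0, 0, sideLength w₀ * (t / 2) + sideLength w₀ ^ 2 / 2]
    have hx := (sideLength_pos w₀).ne'
    have ha : √3 / 2 - w₀ ≠ 0 := by intro h; linarith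
    refine (MetricGraph.energy_le (c := -(1 / 2) * heightBound l w₀)
      (fun v hv hv0 => hcomp.heightBound_le_energy hopt h0 hv hv0) hpos v ?_).trans (le_of_eq ?_)
    · rintro i (rfl | rfl | rfl) <;> rfl
    · rw [hsum, Sym2.eq_swap (a := 0), Sym2.eq_swap (a := 1), Sym2.eq_swap (a := 2),
        MetricGraph.vertexEnergy_mk, MetricGraph.vertexEnergy_mk, MetricGraph.vertexEnergy_mk,
        Sym2.eq_swap (b := 0), Sym2.eq_swap (b := 1), Sym2.eq_swap (b := 2), l0, l1, l2,
        edgeEnergy_eq_flux (φ := -t) ha, edgeEnergy_eq_flux (φ := t / 2) hx,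
        edgeEnergy_eq_flux (φ := t / 2) hx]
      · rw [← hcost]
        simp [v]
        unfold legCost
        ring
      · simp [v]
      · simp [v]
      · simp [v]
        linarith

/-- The points `(-√3/3 + s, y)`: the images of the second Kirchhoff vertex and of the points on the
Neumann edge. -/
noncomputable def branchPoint (s y : ℝ) : Plane := !₂[-(√3 / 3) + s, y]

theorem dist_triangle_zero_branchPoint {s : ℝ} (hs : 0 ≤ s) :
    dist (triangle 0) (branchPoint s 0) = s := by
  rw [Plane.dist_eq]
  simp only [triangle_zero, branchPoint, PiLp.toLp_apply, Matrix.cons_val_zero, Matrix.cons_val_one]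
  rw [show (-(√3 / 3) - (-(√3 / 3) + s)) ^ 2 + (0 - 0) ^ 2 = s ^ 2 by ring]
  exact Real.sqrt_sq hs

theorem dist_tripodCenter_branchPoint {w s : ℝ} (hs : s ≤ √3 / 2 - w) :
    dist (tripodCenter w) (branchPoint s 0) = √3 / 2 - w - s := by
  rw [Plane.dist_eq]
  simp only [tripodCenter, branchPoint, PiLp.toLp_apply, Matrix.cons_val_zero, Matrix.cons_val_one]
  rw [show (√3 / 6 - w - (-(√3 / 3) + s)) ^ 2 + (0 - 0) ^ 2 = (√3 / 2 - w - s) ^ 2 by ring]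
  exact Real.sqrt_sq (by linarith)

theorem dist_branchPoint_branchPoint {s y : ℝ} (hy : 0 ≤ y) :
    dist (branchPoint s 0) (branchPoint s y) = y := by
  rw [Plane.dist_eq]
  simp only [branchPoint, PiLp.toLp_apply, Matrix.cons_val_zero, Matrix.cons_val_one]
  rw [show (-(√3 / 3) + s - (-(√3 / 3) + s)) ^ 2 + (0 - y) ^ 2 = y ^ 2 by ring]
  exact Real.sqrt_sq hy

set_option maxHeartbeats 1000000 in
/-- The tree with a Neumann edge as a solution. -/
theorem exists_neumann_drawing {l w₀ : ℝ} (hl : √3 ≤ l) (h0 : 0 ≤ w₀) (hw₀ : w₀ < √3 / 6)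
    (hopt : ∀ m r, 1 / 2 ≤ m → 3 * m ≤ l → 0 ≤ r → r ≤ neumannLength l √(m ^ 2 - 1 / 4) →
        treeBound l m r ≤ heightBound l w₀ ∧
        (heightBound l w₀ ≤ treeBound l m r → m = sideLength w₀ ∧ r = neumannLength l w₀))
    (hr0 : 0 < neumannLength l w₀) :
    ∃ (N : ℕ) (Γ : MetricGraph N) (W : Set (Fin N)) (γ : Γ.Fun Plane) (e : Fin 6 ≃ Fin N),
      IsGamma3 l (sideLength w₀) Γ W e ∧ Γ.IsReduced W ∧
      IsCompetitor (range triangle) l Γ W γ ∧ Γ.energy W ≤ -(1 / 2) * heightBound l w₀ ∧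
      γ.IsEmbedding ∧
      γ.vert (e 0) = triangle 0 ∧ γ.vert (e 1) = triangle 1 ∧ γ.vert (e 2) = triangle 2 := by
  have h3 := sqrt_three_pos
  have ht0 := bestShift_sideLength_pos hl h0 hw₀
  have ht1 := two_mul_bestShift_lt (a := √3 / 2 - w₀) hl h0 hw₀.le
  have hcost := cost_eq_heightBound hl h0 hw₀.le
  have hflux := flux_consistent hl h0 hw₀.le
  have htt := two_mul_bestShift l (sideLength w₀) (√3 / 2 - w₀)
  have hrr : neumannLength l w₀ = l - √3 / 2 - 2 * sideLength w₀ + w₀ := rfl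
  set t := bestShift l (sideLength w₀) (√3 / 2 - w₀) with ht
  set r := neumannLength l w₀ with hr
  simp only at hcost hflux
  obtain ⟨s, hs⟩ : ∃ s, s = √3 / 2 - w₀ - t := ⟨_, rfl⟩
  rw [← hs] at hflux
  have hs0 : 0 < s := by linarith
  let q : Fin 6 → Plane := ![triangle 0, triangle 1, triangle 2, tripodCenter w₀,
    branchPoint s 0, branchPoint s r]
  have hq0 : ∀ i, q i 0 = (![-(√3 / 3), √3 / 6, √3 / 6, √3 / 6 - w₀, -(√3 / 3) + s,
      -(√3 / 3) + s] : Fin 6 → ℝ) i := by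
    intro i; fin_cases i <;> simp [q, triangle, tripodCenter, branchPoint]
  have hq1 : ∀ i, q i 1 = (![0, -(1 / 2), 1 / 2, 0, 0, r] : Fin 6 → ℝ) i := by
    intro i; fin_cases i <;> simp [q, triangle, tripodCenter, branchPoint]
  have hq : Function.Injective q := by
    intro i j hij
    have e0 : q i 0 = q j 0 := by rw [hij]
    have e1 : q i 1 = q j 1 := by rw [hij]
    rw [hq0, hq0] at e0
    rw [hq1, hq1] at e1
    fin_cases i <;> fin_cases j <;> first | rfl | skip
    all_goals
      exfalso
      simp only [Fin.reduceFinMk, Matrix.cons_val, Fin.zero_eta, Fin.mk_one] at e0 e1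
      linarith
  let S : Finset (Sym2 (Fin 6)) := {s(0, 4), s(1, 3), s(2, 3), s(3, 4), s(4, 5)}
  have hS : ∀ z ∈ S, ¬ z.IsDiag := by decide
  let G := SimpleGraph.fromEdgeSet (S : Set (Sym2 (Fin 6)))
  have hG : ∀ i j, G.Adj i j ↔ s(i, j) ∈ S := MetricGraph.fromEdgeSet_adj_iff hS
  let Γ := MetricGraph.straight G q
  let W : Set (Fin 6) := {0, 1, 2}
  let γ : Γ.Fun Plane := MetricGraph.straightFun G hq
  have l0 : (Γ.len s(0, 4) : ℝ) = s := dist_triangle_zero_branchPoint hs0.le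
  have l1 : (Γ.len s(1, 3) : ℝ) = sideLength w₀ := dist_triangle_one_tripodCenter _
  have l2 : (Γ.len s(2, 3) : ℝ) = sideLength w₀ := dist_triangle_two_tripodCenter _
  have l3 : (Γ.len s(3, 4) : ℝ) = t :=
    (dist_tripodCenter_branchPoint (by linarith)).trans (by linarith)
  have l4 : (Γ.len s(4, 5) : ℝ) = r := dist_branchPoint_branchPoint hr0.le
  have hpos : ∀ i j, Γ.graph.Adj i j → 0 < Γ.len s(i, j) := MetricGraph.straight_len_pos hq
  have hc : Γ.graph.Connected := by
    rw [SimpleGraph.connected_iff_exists_forall_reachable]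
    have : ∀ i : Fin 6, i = 3 ∨ s(3, i) ∈ S ∨ s(4, i) ∈ S := by decide
    refine ⟨3, fun i => ?_⟩
    rcases this i with rfl | h | h
    · rfl
    · exact SimpleGraph.Adj.reachable ((hG _ _).2 h)
    · exact (SimpleGraph.Adj.reachable ((hG 3 4).2 (by decide))).trans
        (SimpleGraph.Adj.reachable ((hG _ _).2 h))
  have hedge : Γ.edgeSet' = S := MetricGraph.edgeSet'_straight hS
  have hsum : ∀ f : Sym2 (Fin 6) → ℝ, ∑ z ∈ Γ.edgeSet', f z =
      f s(0, 4) + (f s(1, 3) + (f s(2, 3) + (f s(3, 4) + f s(4, 5)))) := by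
    intro f
    rw [hedge, Finset.sum_insert (by decide), Finset.sum_insert (by decide),
      Finset.sum_insert (by decide), Finset.sum_insert (by decide), Finset.sum_singleton]
  have hlen : Γ.length = l := by
    rw [Γ.length_eq, hsum, l0, l1, l2, l3, l4]
    linarith
  have hemb : γ.IsEmbedding := by
    refine MetricGraph.isEmbedding_straightFun hq (a := ![0, 1, 2, 3, 4]) (b := ![4, 3, 3, 4, 5])
      ?_ ?_
    · intro i j hij
      rw [hG] at hij
      have : ∀ z ∈ S, ∃ k : Fin 5, z = s((![0, 1, 2, 3, 4] : Fin 5 → Fin 6) k,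
        (![4, 3, 3, 4, 5] : Fin 5 → Fin 6) k) := by decide
      exact this _ hij
    -- Each open edge (O) and closed edge (C) is enclosed in a set given by linear conditions on the
    -- coordinates, so that disjointness becomes linear arithmetic.
    · let O : Fin 5 → ℝ → ℝ → Prop := ![fun x y => y = 0 ∧ x < -(√3 / 3) + s,
        fun x y => y < 0 ∧ √3 / 6 - w₀ ≤ x, fun x y => 0 < y ∧ √3 / 6 - w₀ ≤ x,
        fun x y => y = 0 ∧ -(√3 / 3) + s < x ∧ x < √3 / 6 - w₀,
        fun x y => 0 < y ∧ x = -(√3 / 3) + s]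
      let C : Fin 5 → ℝ → ℝ → Prop := ![fun x y => y = 0 ∧ x ≤ -(√3 / 3) + s,
        fun x y => y ≤ 0 ∧ √3 / 6 - w₀ ≤ x, fun x y => 0 ≤ y ∧ √3 / 6 - w₀ ≤ x,
        fun x y => y = 0 ∧ -(√3 / 3) + s ≤ x ∧ x ≤ √3 / 6 - w₀,
        fun x y => 0 ≤ y ∧ x = -(√3 / 3) + s]
      have hxt : √3 / 6 - w₀ = -(√3 / 3) + s + t := by linarith
      have hx4 : -(√3 / 3) + s < √3 / 6 - w₀ := by linarith
      have hOC : ∀ k k', k ≠ k' → ∀ x y, O k x y → C k' x y → False := by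
        intro k k' hne x y h h'
        fin_cases k <;> fin_cases k' <;> first | exact hne rfl | skip
        all_goals
          simp only [O, C, Fin.reduceFinMk, Matrix.cons_val, Fin.zero_eta, Fin.mk_one] at h h'
          linarith [h.1, h.2, h'.1, h'.2]
      intro k k' hne
      rw [Set.disjoint_left]
      intro P hP hP'
      obtain ⟨a, ⟨ha, ha'⟩, hO0, hO1⟩ := mem_openSegment_coord hP
      obtain ⟨b, ⟨hb, hb'⟩, hC0, hC1⟩ := mem_segment_coord hP'
      rw [hq0, hq0] at hO0 hC0
      rw [hq1, hq1] at hO1 hC1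
      refine hOC k k' hne (P 0) (P 1) ?_ ?_
      · clear hC0 hC1
        fin_cases k <;>
          simp only [O, Fin.reduceFinMk, Matrix.cons_val, Fin.zero_eta, Fin.mk_one] at hO0 hO1 ⊢ <;>
          rw [hO0, hO1]
        · exact ⟨by ring, by linarith [mul_pos ha hs0]⟩
        · exact ⟨by linarith, by linarith [mul_nonneg ha.le h0]⟩
        · exact ⟨by linarith, by linarith [mul_nonneg ha.le h0]⟩
        · rw [hxt]
          exact ⟨by ring, by linarith [mul_pos ha ht0], by linarith [mul_pos (sub_pos.2 ha') ht0]⟩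
        · exact ⟨by linarith [mul_pos (sub_pos.2 ha') hr0], by ring⟩
      · clear hO0 hO1
        fin_cases k' <;>
          simp only [C, Fin.reduceFinMk, Matrix.cons_val, Fin.zero_eta, Fin.mk_one] at hC0 hC1 ⊢ <;>
          rw [hC0, hC1]
        · exact ⟨by ring, by linarith [mul_nonneg hb hs0.le]⟩
        · exact ⟨by linarith, by linarith [mul_nonneg hb h0]⟩
        · exact ⟨by linarith, by linarith [mul_nonneg hb h0]⟩
        · rw [hxt]
          exact ⟨by ring, by linarith [mul_nonneg hb ht0.le],
            by linarith [mul_nonneg (sub_nonneg.2 hb') ht0.le]⟩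
        · exact ⟨by linarith [mul_nonneg (sub_nonneg.2 hb') hr0.le], by ring⟩
  have hcomp : IsCompetitor (range triangle) l Γ W γ := by
    refine ⟨hc, hlen, hemb.1, ?_⟩
    rw [range_triangle]
    change q '' {0, 1, 2} = _
    rw [image_insert_eq, image_insert_eq, image_singleton]
    rfl
  have hdd : l * sideLength w₀ / (2 * (2 * l - 3 * sideLength w₀))
      = (sideLength w₀ * l / (2 * l - 3 * sideLength w₀)) / 2 := by
    have hy2 := (two_mul_sub_sideLength_pos hl h0 hw₀.le).ne'
    field_simp
  refine ⟨6, Γ, W, γ, Equiv.refl _, ⟨?_, rfl, ?_, l1, l2, ?_, ?_⟩, ⟨hpos, ?_⟩, hcomp, ?_, hemb,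
    rfl, rfl, rfl⟩
  · intro a b
    change G.Adj a b ↔ _
    rw [hG]; simp [S]
  · refine l0.trans ?_
    rw [sqrt_four_mul_sideLength h0, hdd]
    linarith
  · refine l3.trans ?_
    rw [sqrt_four_mul_sideLength h0, hdd]
    linarith
  · refine l4.trans ?_
    rw [sqrt_four_mul_sideLength h0, hrr]
    ring
  · intro i hi
    have hns : ∀ i : Fin 6, i ∈ W ∨ i = 3 ∨ i = 4 ∨ i = 5 := by
      intro i; fin_cases i <;> simp [W]
    have hcard : ((Finset.univ.filter fun j => s(i, j) ∈ S : Finset (Fin 6))).card = 2 := by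
      rw [← hi, ← Set.ncard_coe_finset]
      congr 1
      ext j
      rw [SimpleGraph.mem_neighborSet]
      simp only [Finset.coe_filter, Finset.mem_univ, true_and, mem_ofPred_eq]
      exact (hG _ _).symm
    rcases hns i with h | rfl | rfl | rfl
    · exact h
    all_goals
      exfalso
      revert hcard; decide
  -- The values integrate the optimal fluxes from the Dirichlet ends: (r/2 + t)/2 enters each side
  -- leg, r/2 enters the edge of length s, and the flux vanishes at the free end.
  · let v : Fin 6 → ℝ := ![0, 0, 0, sideLength w₀ * ((r / 2 + t) / 2) + sideLength w₀ ^ 2 / 2,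
      s * (r / 2) + s ^ 2 / 2, s * (r / 2) + s ^ 2 / 2 + r ^ 2 / 2]
    have hx := (sideLength_pos w₀).ne'
    refine (MetricGraph.energy_le (c := -(1 / 2) * heightBound l w₀)
      (fun v hv hv0 => hcomp.heightBound_le_energy hopt h0 hv hv0) hpos v ?_).trans (le_of_eq ?_)
    · rintro i (rfl | rfl | rfl) <;> rfl
    · have ha : √3 / 2 - w₀ = s + t := by linarith
      rw [hsum, MetricGraph.vertexEnergy_mk, MetricGraph.vertexEnergy_mk,
        MetricGraph.vertexEnergy_mk, MetricGraph.vertexEnergy_mk, MetricGraph.vertexEnergy_mk,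
        edgeEnergy_comm _ (v 0), edgeEnergy_comm _ (v 1), edgeEnergy_comm _ (v 2),
        edgeEnergy_comm _ (v 3) (v 4), edgeEnergy_comm _ (v 4) (v 5), l0, l1, l2, l3, l4,
        edgeEnergy_eq_flux (φ := r / 2) hs0.ne', edgeEnergy_eq_flux (φ := (r / 2 + t) / 2) hx,
        edgeEnergy_eq_flux (φ := (r / 2 + t) / 2) hx, edgeEnergy_eq_flux (φ := r / 2) ht0.ne',
        edgeEnergy_eq_flux (φ := 0) hr0.ne']
      · rw [← hcost, ha]
        simp only [v, Matrix.cons_val]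
        unfold legCost
        ring
      all_goals
        simp only [v, Matrix.cons_val]
        linarith

/-! ### Solutions and their parameter -/

/-- The parameter of a given solution might be 1/√3, so the height √3/6 has to be included; this
needs l > √3. -/
theorem bestShift_sideLength_pos_of_lt {l w : ℝ} (hl : √3 < l) (h0 : 0 ≤ w) (h : w ≤ √3 / 6) :
    0 < bestShift l (sideLength w) (√3 / 2 - w) := by
  rcases h.lt_or_eq with h | rfl
  · exact bestShift_sideLength_pos hl.le h0 h
  · have h3 := sqrt_three_pos
    unfold bestShift
    rw [sideLength_sqrt_three_div_six]
    have hy : 0 < 2 * l - 3 * (√3 / 3) := by linarith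
    refine half_pos (sub_pos.2 ?_)
    rw [div_lt_iff₀ hy]
    nlinarith

theorem rot_iterate_triangle (k : ℕ) : ∃ i, ∀ a, rot^[k] (triangle a) = triangle (a + i) := by
  induction k with
  | zero => exact ⟨0, fun a => by simp⟩
  | succ k ih =>
    obtain ⟨i, hi⟩ := ih
    exact ⟨i + 1, fun a => by rw [Function.iterate_succ_apply', hi, rot_triangle, add_assoc]⟩

theorem one_div_sqrt_three : 1 / √3 = √3 / 3 := by
  have := sqrt_three_pos
  rw [div_eq_div_iff this.ne' (by norm_num)]
  nlinarith [sqrt_three_sq]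

/-- The heights which correspond to the side lengths between `1 / 2` and `1 / √3`. -/
theorem exists_sideLength_eq {y : ℝ} (hy : y ∈ Icc (1 / 2 : ℝ) (1 / √3)) :
    ∃ w ∈ Icc 0 (√3 / 6), y = sideLength w := by
  refine ⟨√(y ^ 2 - 1 / 4), ⟨Real.sqrt_nonneg _, ?_⟩, (sideLength_sqrt hy.1).symm⟩
  rw [one_div_sqrt_three] at hy
  have h3 := sqrt_three_pos
  rw [Real.sqrt_le_left (by positivity)]
  nlinarith [sqrt_three_sq, hy.1, hy.2]

theorem sideLength_mem_Icc {w : ℝ} (hw : w ∈ Icc 0 (√3 / 6)) :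
    sideLength w ∈ Icc (1 / 2 : ℝ) (1 / √3) :=
  ⟨half_le_sideLength w, one_div_sqrt_three ▸ sideLength_le_of_le hw.1 hw.2⟩

theorem IsCompetitor.isSolution {l w₀ : ℝ}
    (hopt : ∀ m r, 1 / 2 ≤ m → 3 * m ≤ l → 0 ≤ r → r ≤ neumannLength l √(m ^ 2 - 1 / 4) →
        treeBound l m r ≤ heightBound l w₀ ∧
        (heightBound l w₀ ≤ treeBound l m r → m = sideLength w₀ ∧ r = neumannLength l w₀))
    (hw₀ : 0 ≤ w₀) {N : ℕ} {Γ : MetricGraph N} {W : Set (Fin N)} {γ : Γ.Fun Plane}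
    (h : IsCompetitor (range triangle) l Γ W γ) (hE : Γ.energy W ≤ -(1 / 2) * heightBound l w₀) :
    IsSolution (range triangle) l Γ W γ :=
  ⟨h, fun _ _ _ _ h' => hE.trans <| MetricGraph.le_energy fun _ hv hv0 =>
    h'.heightBound_le_energy hopt hw₀ hv hv0⟩

/-- The energy of a solution. -/
theorem IsSolution.energy_le {l w₀ : ℝ} (hl : √3 ≤ l) (h0 : 0 ≤ w₀) (hw₀ : w₀ ≤ √3 / 6)
    (hlt : √3 < l → w₀ < √3 / 6) (hr : 0 ≤ neumannLength l w₀)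
    (hopt : ∀ m r, 1 / 2 ≤ m → 3 * m ≤ l → 0 ≤ r → r ≤ neumannLength l √(m ^ 2 - 1 / 4) →
        treeBound l m r ≤ heightBound l w₀ ∧
        (heightBound l w₀ ≤ treeBound l m r → m = sideLength w₀ ∧ r = neumannLength l w₀))
    {N : ℕ} {Γ : MetricGraph N} {W : Set (Fin N)} {γ : Γ.Fun Plane}
    (h : IsSolution (range triangle) l Γ W γ) : Γ.energy W ≤ -(1 / 2) * heightBound l w₀ := by
  rcases hr.eq_or_lt with hr | hr
  · obtain ⟨N', Γ', W', γ', e, -, -, h1, h2, -⟩ := exists_tripod_drawing hl h0 hw₀ hopt hr.symm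
    exact (h.2 N' Γ' W' γ' h1).trans h2
  · have : w₀ < √3 / 6 := by
      -- A positive Neumann length is at most l - √3, which forces l > √3.
      refine hlt (lt_of_lt_of_le (b := neumannLength l w₀ + √3) (by linarith) ?_)
      linarith [neumannLength_le l w₀]
    obtain ⟨N', Γ', W', γ', e, -, -, h1, h2, -⟩ := exists_neumann_drawing hl h0 this hopt hr
    exact (h.2 N' Γ' W' γ' h1).trans h2

namespace IsGamma3

variable {l x : ℝ} {N : ℕ} {Γ : MetricGraph N} {W : Set (Fin N)} {e : Fin 6 ≃ Fin N}

theorem ncard_neighborSet (h : IsGamma3 l x Γ W e) (a : Fin 6) :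
    (Γ.graph.neighborSet (e a)).ncard = (Finset.univ.filter fun b => s(a, b) ∈
      ({s(0, 4), s(1, 3), s(2, 3), s(3, 4), s(4, 5)} : Finset (Sym2 (Fin 6)))).card := by
  rw [← Set.ncard_coe_finset, ← Set.ncard_image_of_injective _ e.injective]
  congr 1
  ext y
  obtain ⟨b, rfl⟩ := e.surjective y
  rw [SimpleGraph.mem_neighborSet, h.adj]
  simp

theorem mem_iff (h : IsGamma3 l x Γ W e) (a : Fin 6) : e a ∈ W ↔ a = 0 ∨ a = 1 ∨ a = 2 := by
  rw [h.dirichlet]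
  simp

theorem isReduced (h : IsGamma3 l x Γ W e)
    (hpos : ∀ z ∈ ({s(0, 4), s(1, 3), s(2, 3), s(3, 4), s(4, 5)} : Finset (Sym2 (Fin 6))),
      0 < Γ.len (z.map e)) : Γ.IsReduced W := by
  constructor
  · intro i j hij
    obtain ⟨a, rfl⟩ := e.surjective i
    obtain ⟨b, rfl⟩ := e.surjective j
    rw [h.adj] at hij
    exact hpos s(a, b) (by simpa using hij)
  · intro i hi
    obtain ⟨a, rfl⟩ := e.surjective i
    rw [h.ncard_neighborSet] at hi
    rw [h.mem_iff]
    revert a; decide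

/-- The Neumann edge is determined by the graph. -/
theorem len_neumann_eq {x' : ℝ} {e' : Fin 6 ≃ Fin N} (h : IsGamma3 l x Γ W e)
    (h' : IsGamma3 l x' Γ W e') : Γ.len s(e 4, e 5) = Γ.len s(e' 4, e' 5) := by
  have key : ∀ a : Fin 6, ¬ (a = 0 ∨ a = 1 ∨ a = 2) → (Finset.univ.filter fun b => s(a, b) ∈
      ({s(0, 4), s(1, 3), s(2, 3), s(3, 4), s(4, 5)} : Finset (Sym2 (Fin 6)))).card = 1 →
      a = 5 := by decide
  have key' : ∀ b : Fin 6, s(5, b) ∈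
      ({s(0, 4), s(1, 3), s(2, 3), s(3, 4), s(4, 5)} : Finset (Sym2 (Fin 6))) → b = 4 := by
    decide
  obtain ⟨a, ha⟩ := e'.surjective (e 5)
  have ha5 : a = 5 := by
    refine key a ?_ ?_
    · rw [← h'.mem_iff, ha, h.mem_iff]; decide
    · rw [← h'.ncard_neighborSet, ha, h.ncard_neighborSet]; decide
  obtain ⟨b, hb⟩ := e'.surjective (e 4)
  have hb4 : b = 4 := by
    refine key' b ?_
    have : Γ.graph.Adj (e' 5) (e' b) := by
      rw [← ha5, ha, hb, h.adj]; decide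
    rw [h'.adj] at this
    simpa using this
  rw [← ha, ← hb, ha5, hb4]

end IsGamma3

/-- The parameter of a solution with a Neumann edge is determined by the length. -/
theorem IsGamma3.eq_sideLength {l w₀ y : ℝ} (hl : 1 + √3 / 2 < l) (h0 : 0 ≤ w₀)
    (hw₀ : w₀ < √3 / 6) (hr : 0 < neumannLength l w₀)
    (hopt : ∀ m r, 1 / 2 ≤ m → 3 * m ≤ l → 0 ≤ r → r ≤ neumannLength l √(m ^ 2 - 1 / 4) →
        treeBound l m r ≤ heightBound l w₀ ∧
        (heightBound l w₀ ≤ treeBound l m r → m = sideLength w₀ ∧ r = neumannLength l w₀))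
    {N : ℕ} {Γ : MetricGraph N} {W : Set (Fin N)} {γ : Γ.Fun Plane} {e : Fin 6 ≃ Fin N}
    (hy : y ∈ Icc (1 / 2 : ℝ) (1 / √3)) (h : IsGamma3 l y Γ W e)
    (hs : IsSolution (range triangle) l Γ W γ) : y = sideLength w₀ := by
  obtain ⟨w, hw, rfl⟩ := exists_sideLength_eq hy
  have h3 := sqrt_three_lt
  have h3' := sqrt_three_pos
  have hl3 : √3 < l := by linarith
  have ht := bestShift_sideLength_pos_of_lt hl3 hw.1 hw.2
  have htt := two_mul_bestShift l (sideLength w) (√3 / 2 - w)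
  have hx := sideLength_pos w
  have hy2 := two_mul_sub_sideLength_pos hl3.le hw.1 hw.2
  have hdd : l * sideLength w / (2 * (2 * l - 3 * sideLength w))
      = (sideLength w * l / (2 * l - 3 * sideLength w)) / 2 := by
    field_simp
  have hd0 : 0 < sideLength w * l / (2 * l - 3 * sideLength w) :=
    div_pos (mul_pos hx (by linarith)) hy2
  have h56 : (Γ.len s(e 4, e 5) : ℝ) = neumannLength l w := by
    rw [h.len_56, sqrt_four_mul_sideLength hw.1]; unfold neumannLength; ring
  have hmono := (neumannLength_strictMonoOn l)
  have hn : 0 < neumannLength l w := by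
    have := hmono.monotoneOn ⟨le_rfl, by positivity⟩ hw hw.1
    rw [neumannLength_zero] at this
    linarith
  have hred : Γ.IsReduced W := by
    refine h.isReduced fun z hz => ?_
    simp only [Finset.mem_insert, Finset.mem_singleton] at hz
    have hw6 := hw.2
    rcases hz with rfl | rfl | rfl | rfl | rfl <;> rw [Sym2.map_mk, ← NNReal.coe_pos]
    · rw [h.len_15, sqrt_four_mul_sideLength hw.1, hdd]; linarith
    · rw [h.len_24]; exact hx
    · rw [h.len_34]; exact hx
    · rw [h.len_45, sqrt_four_mul_sideLength hw.1, hdd]; linarith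
    · rw [h56]; exact hn
  -- Rigidity gives a second labelling of the same graph, with parameter from w₀. The Neumann edge
  -- does not depend on the labelling, and its length determines the height by strict monotonicity.
  obtain ⟨e', k, h', -⟩ := MetricGraph.exists_isGamma3_of_le hl3.le h0 hw₀ hopt hr hs.1 hred
    (hs.energy_le hl3.le h0 hw₀.le (fun _ => hw₀) hr.le hopt)
  have h56' : (Γ.len s(e' 4, e' 5) : ℝ) = neumannLength l w₀ := by
    rw [h'.len_56, sqrt_four_mul_sideLength h0]; unfold neumannLength; ring
  rw [← h.len_neumann_eq h', h56] at h56'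
  rw [hmono.injOn hw ⟨h0, hw₀.le⟩ h56']

/-! ### No automorphism induces the rotation -/

section Automorphism

variable {N : ℕ} {Γ : MetricGraph N} {W : Set (Fin N)} {γ : Γ.Fun Plane}

theorem apply_eq_of_rot {w : Fin 3 → Fin N} {k : ℕ}
    (hW : W ⊆ range w) (hw : ∀ a, γ.vert (w a) = rot^[k] (triangle a)) {φ : Fin N → Fin N}
    (hφ : ∀ i ∈ W, φ i ∈ W ∧ γ.vert (φ i) = rot (γ.vert i)) (a : Fin 3) (ha : w a ∈ W) :
    φ (w a) = w (a + 1) := by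
  obtain ⟨h1, h2⟩ := hφ _ ha
  obtain ⟨b, hb⟩ := hW h1
  obtain ⟨i, hi⟩ := rot_iterate_triangle k
  rw [← hb, hw, hw, hi, hi, rot_triangle] at h2
  have := triangle_injective h2
  rw [← hb, show b = a + 1 by rw [add_right_comm] at this; exact add_right_cancel this]

/-- The automorphism would carry the edge at `e 0` to the edge at `e 1`, but for w₀ < √3/6 the
lengths satisfy √3/2 - w₀ > √3/3 > `sideLength w₀`. -/
theorem IsGamma1.not_automorphism {w₀ : ℝ} (h0 : 0 ≤ w₀) (hw₀ : w₀ < √3 / 6) {e : Fin 4 ≃ Fin N}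
    {k : ℕ} (h : IsGamma1 (sideLength w₀) Γ W e) (h0' : γ.vert (e 0) = rot^[k] (triangle 0))
    (h1 : γ.vert (e 1) = rot^[k] (triangle 1)) (h2 : γ.vert (e 2) = rot^[k] (triangle 2)) :
    ¬ ∃ φ : Γ.graph ≃g Γ.graph,
      (∀ i j, Γ.graph.Adj i j → Γ.len s(φ i, φ j) = Γ.len s(i, j)) ∧
      ∀ i ∈ W, φ i ∈ W ∧ γ.vert (φ i) = rot (γ.vert i) := by
  rintro ⟨φ, hlen, hφ⟩
  let w : Fin 3 → Fin N := ![e 0, e 1, e 2]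
  have hw : ∀ a, γ.vert (w a) = rot^[k] (triangle a) := by
    intro a; fin_cases a
    · exact h0'
    · exact h1
    · exact h2
  have hW : W ⊆ range w := by
    rw [h.dirichlet]
    rintro _ (rfl | rfl | rfl)
    · exact ⟨0, rfl⟩
    · exact ⟨1, rfl⟩
    · exact ⟨2, rfl⟩
  have hφ0 : φ (e 0) = e 1 := apply_eq_of_rot hW hw hφ 0 (by rw [h.dirichlet]; exact Or.inl rfl)
  have hadj : Γ.graph.Adj (e 0) (e 3) := (h.adj _ _).2 (by simp)
  have hφ3 : φ (e 3) = e 3 := by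
    obtain ⟨b, hb⟩ := e.surjective (φ (e 3))
    have := φ.map_rel_iff.2 hadj
    rw [hφ0, ← hb, h.adj] at this
    have key : ∀ b : Fin 4, s(1, b) ∈ ({s(0, 3), s(1, 3), s(2, 3)} : Finset (Sym2 (Fin 4))) →
        b = 3 := by decide
    rw [← hb, key b (by simpa using this)]
  have := congrArg NNReal.toReal (hlen _ _ hadj)
  rw [hφ0, hφ3] at this
  have h14 := h.len_14
  rw [sqrt_sideLength h0] at h14
  have h24 := h.len_24
  have := sideLength_lt_of_lt h0 hw₀
  have h3 := sqrt_three_pos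
  linarith

/-- Combinatorics suffices: `e 1` and `e 2` have a common neighbour, while their images `e 2` and `e
0` have none. -/
theorem IsGamma3.not_automorphism {l x : ℝ} {e : Fin 6 ≃ Fin N}
    {k : ℕ} (h : IsGamma3 l x Γ W e) (h0' : γ.vert (e 0) = rot^[k] (triangle 0))
    (h1 : γ.vert (e 1) = rot^[k] (triangle 1)) (h2 : γ.vert (e 2) = rot^[k] (triangle 2)) :
    ¬ ∃ φ : Γ.graph ≃g Γ.graph,
      (∀ i j, Γ.graph.Adj i j → Γ.len s(φ i, φ j) = Γ.len s(i, j)) ∧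
      ∀ i ∈ W, φ i ∈ W ∧ γ.vert (φ i) = rot (γ.vert i) := by
  rintro ⟨φ, -, hφ⟩
  let w : Fin 3 → Fin N := ![e 0, e 1, e 2]
  have hw : ∀ a, γ.vert (w a) = rot^[k] (triangle a) := by
    intro a; fin_cases a
    · exact h0'
    · exact h1
    · exact h2
  have hW : W ⊆ range w := by
    rw [h.dirichlet]
    rintro _ (rfl | rfl | rfl)
    · exact ⟨0, rfl⟩
    · exact ⟨1, rfl⟩
    · exact ⟨2, rfl⟩
  have hφ1 : φ (e 1) = e 2 := apply_eq_of_rot hW hw hφ 1 (by rw [h.dirichlet]; simp [w])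
  have hφ2 : φ (e 2) = e 0 := apply_eq_of_rot hW hw hφ 2 (by rw [h.dirichlet]; simp [w])
  obtain ⟨b, hb⟩ := e.surjective (φ (e 3))
  have hadj1 := φ.map_rel_iff.2 ((h.adj 1 3).2 (by simp))
  have hadj2 := φ.map_rel_iff.2 ((h.adj 2 3).2 (by simp))
  rw [hφ1, ← hb, h.adj] at hadj1
  rw [hφ2, ← hb, h.adj] at hadj2
  have key : ∀ b : Fin 6,
      s(2, b) ∈ ({s(0, 4), s(1, 3), s(2, 3), s(3, 4), s(4, 5)} : Finset (Sym2 (Fin 6))) →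
      s(0, b) ∉ ({s(0, 4), s(1, 3), s(2, 3), s(3, 4), s(4, 5)} : Finset (Sym2 (Fin 6))) := by
    decide
  exact key b (by simpa using hadj1) (by simpa using hadj2)

end Automorphism

/-! ### The image is not invariant under the rotation -/

theorem rot_smul (c : ℝ) (p : Plane) : rot (c • p) = c • rot p := by
  ext a; fin_cases a <;> simp [rot] <;> ring

theorem rot_lineMap (p q : Plane) (s : ℝ) :
    rot (AffineMap.lineMap p q s) = AffineMap.lineMap (rot p) (rot q) s := by
  ext a; fin_cases a <;> simp [rot, AffineMap.lineMap_apply] <;> ring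

theorem triangle_add_two (i : Fin 3) :
    triangle (i + 2) = -triangle i - triangle (i + 1) := by
  ext a; fin_cases i <;> fin_cases a <;> simp [triangle] <;> ring

theorem triangle_linearIndependent {i : Fin 3} {α β : ℝ}
    (h : α • triangle i + β • triangle (i + 1) = 0) : α = 0 ∧ β = 0 := by
  have h0 := congrFun (congrArg WithLp.ofLp h) 0
  have h1 := congrFun (congrArg WithLp.ofLp h) 1
  have h3 := sqrt_three_pos
  fin_cases i <;> simp [triangle] at h0 h1
  · obtain rfl : β = 0 := by linarith
    simp at h0
    exact ⟨h0, rfl⟩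
  · have h4 : √3 * (α + β) = 0 := by linarith
    have h5 := (mul_eq_zero.1 h4).resolve_left h3.ne'
    constructor <;> linarith
  · obtain rfl : α = 0 := by linarith
    simp at h0
    exact ⟨rfl, h0⟩

/-- The point whose distances from the vertices of the triangle are the lengths of the legs. -/
theorem eq_smul_triangle {P : Plane} {w₀ : ℝ} (h0 : 0 ≤ w₀) (hw₀ : w₀ ≤ √3 / 2) (i : Fin 3)
    (h1 : dist P (triangle i) ≤ √3 / 2 - w₀) (h2 : dist P (triangle (i + 1)) ≤ sideLength w₀)
    (h3 : dist P (triangle (i + 2)) ≤ sideLength w₀) : P = (√3 * w₀ - 1 / 2) • triangle i ∧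
      dist P (triangle i) = √3 / 2 - w₀ ∧ dist P (triangle (i + 1)) = sideLength w₀ ∧
      dist P (triangle (i + 2)) = sideLength w₀ := by
  obtain ⟨hi1, hi2, hi3⟩ := Fin.three_ne_add i
  obtain ⟨e, ζ, e1, e2, e3, hP⟩ := exists_coordinates P hi1 hi2 hi3
  have k1 := pow_le_pow_left₀ dist_nonneg h1 2
  have k2 := pow_le_pow_left₀ dist_nonneg h2 2
  have k3 := pow_le_pow_left₀ dist_nonneg h3 2
  rw [e1] at k1
  rw [e2, sideLength_sq] at k2
  rw [e3, sideLength_sq] at k3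
  -- The two side distances together give e ≤ w₀, and the third distance gives e ≥ w₀; so there is
  -- no slack and ζ = 0.
  have k4 : e ≤ w₀ := le_of_sq_le_sq (by nlinarith [sq_nonneg ζ]) h0
  have k5 : √3 / 2 - e ≤ √3 / 2 - w₀ :=
    le_of_sq_le_sq (by nlinarith [sq_nonneg ζ]) (by linarith)
  obtain rfl : e = w₀ := by linarith
  obtain rfl : ζ = 0 := pow_eq_zero_iff two_ne_zero |>.1
    (le_antisymm (by linarith) (sq_nonneg _))
  have hs := (sideLength_pos e).le
  refine ⟨?_, (sq_eq_sq₀ dist_nonneg (by linarith)).1 (by rw [e1]; ring),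
    (sq_eq_sq₀ dist_nonneg hs).1 (by rw [e2, sideLength_sq]; ring),
    (sq_eq_sq₀ dist_nonneg hs).1 (by rw [e3, sideLength_sq]; ring)⟩
  ext a
  rw [hP a]
  simp

/-- An edge whose length is the distance of its ends is a segment. -/
theorem MetricGraph.Fun.IsImmersion.edge_eq_lineMap {N : ℕ} {Γ : MetricGraph N} {γ : Γ.Fun Plane}
    (hγ : γ.IsImmersion) {i j : Fin N} (h : Γ.graph.Adj i j)
    (hd : dist (γ.vert i) (γ.vert j) = Γ.len s(i, j)) (hpos : 0 < Γ.len s(i, j)) {x : ℝ}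
    (hx : x ∈ Icc (0 : ℝ) (Γ.len s(i, j))) :
    γ.edge i j x = AffineMap.lineMap (γ.vert i) (γ.vert j) (x / Γ.len s(i, j)) := by
  have hL : (0 : ℝ) < Γ.len s(i, j) := hpos
  set L : ℝ := (Γ.len s(i, j) : ℝ)
  have hdist : ∀ a ∈ Icc 0 L, ∀ b ∈ Icc 0 L, a ≤ b →
      dist (γ.edge i j a) (γ.edge i j b) ≤ b - a := by
    intro a ha b hb hab
    have h1 := (hγ i j h).2.2 ha hb
    rw [NNReal.coe_one, one_mul] at h1
    have h2 := eVariationOn.edist_le (γ.edge i j)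
      (show a ∈ Icc 0 L ∩ Icc a b from ⟨ha, le_rfl, hab⟩) ⟨hb, hab, le_rfl⟩
    rw [h1, edist_dist] at h2
    exact (ENNReal.ofReal_le_ofReal_iff (by linarith)).1 h2
  have h1 := hdist 0 ⟨le_rfl, hL.le⟩ x hx hx.1
  have h2 := hdist x hx L ⟨hL.le, le_rfl⟩ hx.2
  rw [γ.edge_zero i j h] at h1
  rw [γ.edge_len h] at h2
  have h3 := dist_triangle (γ.vert i) (γ.edge i j x) (γ.vert j)
  have h4 : Wbtw ℝ (γ.vert i) (γ.edge i j x) (γ.vert j) :=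
    dist_add_dist_eq_iff.1 (by linarith)
  obtain ⟨s, hs, hsx⟩ := h4
  have h5 : dist (γ.vert i) (γ.edge i j x) = x := by linarith
  rw [← hsx, dist_left_lineMap, hd, Real.norm_of_nonneg hs.1] at h5
  rw [← hsx, ← h5, mul_div_assoc, div_self hL.ne', mul_one]

theorem MetricGraph.Fun.IsImmersion.image_edge_eq_segment {N : ℕ} {Γ : MetricGraph N}
    {γ : Γ.Fun Plane}
    (hγ : γ.IsImmersion) {i j : Fin N} (h : Γ.graph.Adj i j)
    (hd : dist (γ.vert i) (γ.vert j) = Γ.len s(i, j)) (hpos : 0 < Γ.len s(i, j)) :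
    γ.edge i j '' Icc 0 (Γ.len s(i, j)) = segment ℝ (γ.vert i) (γ.vert j) := by
  have hL : (0 : ℝ) < Γ.len s(i, j) := hpos
  rw [segment_eq_image_lineMap]
  ext P
  constructor
  · rintro ⟨x, hx, rfl⟩
    exact ⟨_, ⟨div_nonneg hx.1 hL.le, (div_le_one hL).2 hx.2⟩,
      (hγ.edge_eq_lineMap h hd hpos hx).symm⟩
  · rintro ⟨s, hs, rfl⟩
    have hx : s * Γ.len s(i, j) ∈ Icc (0 : ℝ) (Γ.len s(i, j)) :=
      ⟨mul_nonneg hs.1 hL.le, mul_le_of_le_one_left hL.le hs.2⟩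
    refine ⟨_, hx, ?_⟩
    rw [hγ.edge_eq_lineMap h hd hpos hx, mul_div_cancel_right₀ _ hL.ne']

theorem MetricGraph.Fun.image_edge_symm {N : ℕ} {Γ : MetricGraph N} {E : Type*} (γ : Γ.Fun E)
    {i j : Fin N} (h : Γ.graph.Adj i j) :
    γ.edge j i '' Icc 0 (Γ.len s(j, i)) = γ.edge i j '' Icc 0 (Γ.len s(i, j)) := by
  rw [Sym2.eq_swap (a := j)]
  ext P
  constructor
  · rintro ⟨x, hx, rfl⟩
    exact ⟨_, ⟨sub_nonneg.2 hx.2, sub_le_self _ hx.1⟩, (γ.edge_symm i j h x hx).symm⟩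
  · rintro ⟨x, hx, rfl⟩
    refine ⟨Γ.len s(i, j) - x, ⟨sub_nonneg.2 hx.2, sub_le_self _ hx.1⟩, ?_⟩
    rw [γ.edge_symm i j h _ ⟨sub_nonneg.2 hx.2, sub_le_self _ hx.1⟩, sub_sub_cancel]

/-- Three arcs with a common starting point and otherwise disjoint do not fit into an interval. -/
theorem not_triod_real {f : Fin 3 → ℝ → ℝ} {x₀ δ : ℝ} (hδ : 0 < δ)
    (hf : ∀ m, ContinuousOn (f m) (Icc 0 δ)) (h0 : ∀ m, f m 0 = x₀)
    (hne : ∀ m, f m δ ≠ x₀)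
    (hdisj : ∀ m m', m ≠ m' → ∀ s ∈ Ioc 0 δ, ∀ s' ∈ Ioc 0 δ, f m s ≠ f m' s') : False := by
  -- Two of the three ends lie on the same side of x₀, and two arcs ending on the same side share a
  -- value by the intermediate value theorem.
  have key : ∀ m m', m ≠ m' → x₀ < f m δ → x₀ < f m' δ → False := by
    intro m m' hm h1 h2
    obtain ⟨y, hy, hy'⟩ : ∃ y, x₀ < y ∧ y ≤ f m δ ∧ y ≤ f m' δ :=
      ⟨_, lt_min h1 h2, min_le_left _ _, min_le_right _ _⟩
    have lift : ∀ n, y ≤ f n δ → ∃ s ∈ Ioc 0 δ, f n s = y := by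
      intro n hn
      obtain ⟨s, hs, hsy⟩ := intermediate_value_Icc hδ.le (hf n) ⟨(h0 n).trans_le hy.le, hn⟩
      refine ⟨s, ⟨hs.1.lt_of_ne fun h => ?_, hs.2⟩, hsy⟩
      rw [← h, h0] at hsy
      exact hy.ne hsy
    obtain ⟨s, hs, hsy⟩ := lift m hy'.1
    obtain ⟨s', hs', hsy'⟩ := lift m' hy'.2
    exact hdisj m m' hm s hs s' hs' (hsy.trans hsy'.symm)
  have key' : ∀ m m', m ≠ m' → f m δ < x₀ → f m' δ < x₀ → False := by
    intro m m' hm h1 h2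
    obtain ⟨y, hy, hy'⟩ : ∃ y, y < x₀ ∧ f m δ ≤ y ∧ f m' δ ≤ y :=
      ⟨_, max_lt h1 h2, le_max_left _ _, le_max_right _ _⟩
    have lift : ∀ n, f n δ ≤ y → ∃ s ∈ Ioc 0 δ, f n s = y := by
      intro n hn
      obtain ⟨s, hs, hsy⟩ := intermediate_value_Icc' hδ.le (hf n) ⟨hn, hy.le.trans (h0 n).ge⟩
      refine ⟨s, ⟨hs.1.lt_of_ne fun h => ?_, hs.2⟩, hsy⟩
      rw [← h, h0] at hsy
      exact hy.ne' hsy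
    obtain ⟨s, hs, hsy⟩ := lift m hy'.1
    obtain ⟨s', hs', hsy'⟩ := lift m' hy'.2
    exact hdisj m m' hm s hs s' hs' (hsy.trans hsy'.symm)
  rcases (hne 0).lt_or_gt with a | a <;> rcases (hne 1).lt_or_gt with b | b <;>
    rcases (hne 2).lt_or_gt with c | c
  · exact key' 0 1 (by decide) a b
  · exact key' 0 1 (by decide) a b
  · exact key' 0 2 (by decide) a c
  · exact key 1 2 (by decide) b c
  · exact key' 1 2 (by decide) b c
  · exact key 0 2 (by decide) a c
  · exact key 0 1 (by decide) a b
  · exact key 0 1 (by decide) a b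

/-- Three arcs with a common starting point and otherwise disjoint do not fit into an arc. -/
theorem not_triod {E : Type*} [TopologicalSpace E] [T2Space E] {F : ℝ → E} {r : ℝ}
    (hF : ContinuousOn F (Icc 0 r)) (hFi : InjOn F (Icc 0 r)) {c : Fin 3 → ℝ → E} {P : E} {δ : ℝ}
    (hδ : 0 < δ) (hc : ∀ m, Continuous (c m)) (h0 : ∀ m, c m 0 = P)
    (hne : ∀ m, c m δ ≠ P)
    (hdisj : ∀ m m', m ≠ m' → ∀ s ∈ Ioc 0 δ, ∀ s' ∈ Ioc 0 δ, c m s ≠ c m' s')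
    (hmem : ∀ m, ∀ s ∈ Icc 0 δ, c m s ∈ F '' Icc 0 r) : False := by
  -- By compactness F is a homeomorphism onto its image, so the three arcs can be pulled back to the
  -- parameter interval.
  let F' : Icc 0 r → E := (Icc 0 r).domRestrict F
  have hemb : Topology.IsClosedEmbedding F' := (continuousOn_iff_continuous_domRestrict.1 hF).isClosedEmbedding
    (injOn_iff_injective.1 hFi)
  have : ∀ m, ∀ s : Icc 0 δ, ∃ x : Icc 0 r, F' x = c m s := fun m s => by
    obtain ⟨x, hx, h⟩ := hmem m s s.2
    exact ⟨⟨x, hx⟩, h⟩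
  choose g hg using this
  have hgc : ∀ m, Continuous (g m) := fun m => by
    rw [hemb.isInducing.continuous_iff]
    have : F' ∘ g m = fun s : Icc 0 δ => c m s := funext fun s => hg m s
    rw [this]
    exact (hc m).comp continuous_subtype_val
  have hδ' : δ ∈ Icc 0 δ := ⟨hδ.le, le_rfl⟩
  have hz : (0 : ℝ) ∈ Icc 0 δ := ⟨le_rfl, hδ.le⟩
  have hinj : ∀ {m m' : Fin 3} {s s' : Icc 0 δ}, c m s ≠ c m' s' →
      (g m s : ℝ) ≠ g m' s' := fun h h' => h (by rw [← hg, ← hg, Subtype.ext h'])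
  refine not_triod_real (f := fun m => IccExtend hδ.le fun s => (g m s : ℝ)) (δ := δ)
    (x₀ := g 0 ⟨0, hz⟩) hδ ?_ ?_ ?_ ?_
  · intro m
    exact (Continuous.Icc_extend' (continuous_subtype_val.comp (hgc m))).continuousOn
  · intro m
    rw [IccExtend_of_mem _ _ hz]
    exact congrArg Subtype.val (hemb.injective (by rw [hg, hg, h0, h0]))
  · intro m
    rw [IccExtend_of_mem _ _ hδ']
    exact hinj (by rw [h0]; exact hne m)
  · intro m m' hm s hs s' hs'
    rw [IccExtend_of_mem _ _ (Ioc_subset_Icc_self hs), IccExtend_of_mem _ _ (Ioc_subset_Icc_self hs')]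
    exact hinj (hdisj m m' hm s hs s' hs')

/-- In the basis D_i, D_{i+1} the point is (0, c) with c < 0. On the first two segments the second
coordinate is nonnegative. On the third, D_{i+2} = -D_i - D_{i+1}, and a negative second coordinate
entails a negative first one. -/
theorem smul_triangle_notMem_tripod {c : ℝ} (hc : c < 0) (i : Fin 3) :
    c • triangle (i + 1) ∉ segment ℝ (c • triangle i) (triangle i) ∪
      (segment ℝ (c • triangle i) (triangle (i + 1)) ∪
        segment ℝ (c • triangle i) (triangle (i + 2))) := by
  rintro (h | h | h)
  · obtain ⟨α, β, hα, hβ, hαβ, h⟩ := h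
    have := (triangle_linearIndependent (i := i) (α := α * c + β) (β := -c)
      (by rw [← sub_eq_zero.2 h]; module)).2
    linarith
  · obtain ⟨α, β, hα, hβ, hαβ, h⟩ := h
    obtain ⟨h1, h2⟩ := triangle_linearIndependent (i := i) (α := α * c) (β := β - c)
      (by rw [← sub_eq_zero.2 h]; module)
    linarith
  · obtain ⟨α, β, hα, hβ, hαβ, h⟩ := h
    rw [triangle_add_two] at h
    obtain ⟨h1, h2⟩ := triangle_linearIndependent (i := i) (α := α * c - β) (β := -β - c)
      (by rw [← sub_eq_zero.2 h]; module)
    have : α * c ≤ 0 := mul_nonpos_of_nonneg_of_nonpos hα hc.le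
    linarith

/-- The rays from a point of the axis of the triangle in three directions are disjoint. -/
theorem lineMap_ne_lineMap {c c' : ℝ} {i : Fin 3} {Y : Fin 3 → Plane}
    (hY : Y = ![c' • triangle i, triangle (i + 1), triangle (i + 2)]) (m m' : Fin 3)
    (hm : m ≠ m') {s s' : ℝ} (hs : 0 < s) (hs' : 0 < s') :
    AffineMap.lineMap (c • triangle i) (Y m) s ≠ AffineMap.lineMap (c • triangle i) (Y m') s' := by
  have h01 : ∀ {s s' : ℝ}, 0 < s → 0 < s' → (AffineMap.lineMap (c • triangle i) (Y 0) s : Plane) ≠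
      AffineMap.lineMap (c • triangle i) (Y 1) s' := by
    intro s s' hs hs' h
    simp only [hY, Matrix.cons_val, AffineMap.lineMap_apply_module] at h
    have := (triangle_linearIndependent (i := i) (α := (1 - s) * c + s * c' - (1 - s') * c)
      (β := -s') (by rw [← sub_eq_zero.2 h]; module)).2
    linarith
  have h02 : ∀ {s s' : ℝ}, 0 < s → 0 < s' → (AffineMap.lineMap (c • triangle i) (Y 0) s : Plane) ≠
      AffineMap.lineMap (c • triangle i) (Y 2) s' := by
    intro s s' hs hs' h
    simp only [hY, Matrix.cons_val, AffineMap.lineMap_apply_module, triangle_add_two] at h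
    have := (triangle_linearIndependent (i := i) (α := (1 - s) * c + s * c' - (1 - s') * c + s')
      (β := s') (by rw [← sub_eq_zero.2 h]; module)).2
    linarith
  have h12 : ∀ {s s' : ℝ}, 0 < s → 0 < s' → (AffineMap.lineMap (c • triangle i) (Y 1) s : Plane) ≠
      AffineMap.lineMap (c • triangle i) (Y 2) s' := by
    intro s s' hs hs' h
    simp only [hY, Matrix.cons_val, AffineMap.lineMap_apply_module, triangle_add_two] at h
    have := (triangle_linearIndependent (i := i) (α := (1 - s) * c - (1 - s') * c + s')
      (β := s + s') (by rw [← sub_eq_zero.2 h]; module)).2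
    linarith
  fin_cases m <;> fin_cases m' <;> first | exact absurd rfl hm | skip
  · exact h01 hs hs'
  · exact h02 hs hs'
  · exact (h01 hs' hs).symm
  · exact h12 hs hs'
  · exact (h02 hs' hs).symm
  · exact (h12 hs' hs).symm

theorem smul_triangle_ne {c c' : ℝ} (hc : c ≠ c') {i : Fin 3} {Y : Fin 3 → Plane}
    (hY : Y = ![c' • triangle i, triangle (i + 1), triangle (i + 2)]) (m : Fin 3) :
    c • triangle i ≠ Y m := by
  intro h
  rw [hY] at h
  fin_cases m <;> simp only [Fin.reduceFinMk, Matrix.cons_val, Fin.zero_eta, Fin.mk_one,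
    triangle_add_two] at h
  · have := (triangle_linearIndependent (i := i) (α := c - c') (β := 0)
      (by rw [← sub_eq_zero.2 h]; module)).1
    exact hc (sub_eq_zero.1 this)
  · have := (triangle_linearIndependent (i := i) (α := c) (β := -1)
      (by rw [← sub_eq_zero.2 h]; module)).2
    norm_num at this
  · have := (triangle_linearIndependent (i := i) (α := c + 1) (β := 1)
      (by rw [← sub_eq_zero.2 h]; module)).2
    norm_num at this

theorem rot_smul_triangle (c : ℝ) (i : Fin 3) : rot (c • triangle i) = c • triangle (i + 1) := by
  rw [rot_smul, rot_triangle]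

theorem sqrt_three_mul_sub_neg {w : ℝ} (hw : w < √3 / 6) : √3 * w - 1 / 2 < 0 := by
  nlinarith [sqrt_three_sq, sqrt_three_pos]

section

variable {N : ℕ} {Γ : MetricGraph N} {W : Set (Fin N)} {γ : Γ.Fun Plane}

theorem MetricGraph.Fun.IsImmersion.dist_le_len (hγ : γ.IsImmersion) {i j : Fin N}
    (h : Γ.graph.Adj i j) : dist (γ.vert j) (γ.vert i) ≤ Γ.len s(i, j) := by
  have := hγ.dist_le_walkLength (.cons h .nil)
  rw [dist_comm]
  simpa using this

theorem MetricGraph.Fun.mem_image_of_adj {E : Type*} {γ : Γ.Fun E} {i j : Fin N}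
    (h : Γ.graph.Adj i j) : γ.edge i j '' Icc 0 (Γ.len s(i, j)) ⊆ γ.image :=
  fun _ hP => ⟨i, j, h, hP⟩

/-- The edge lengths leave no slack: the centre is c • D_i with c = √3w₀ - 1/2 < 0, and the edges
are segments. The rotated centre c • D_{i+1} is not on this tripod. -/
theorem IsGamma1.rot_image_ne {w₀ : ℝ} (h0 : 0 ≤ w₀) (hw₀ : w₀ < √3 / 6) {e : Fin 4 ≃ Fin N}
    {k : ℕ} (h : IsGamma1 (sideLength w₀) Γ W e) (hred : Γ.IsReduced W) (hγ : γ.IsImmersion)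
    (h0' : γ.vert (e 0) = rot^[k] (triangle 0))
    (h1 : γ.vert (e 1) = rot^[k] (triangle 1)) (h2 : γ.vert (e 2) = rot^[k] (triangle 2)) :
    rot '' γ.image ≠ γ.image := by
  intro hrot
  obtain ⟨i, hi⟩ := rot_iterate_triangle k
  rw [hi] at h0' h1 h2
  rw [zero_add] at h0'
  rw [add_comm] at h1 h2
  have a0 : Γ.graph.Adj (e 0) (e 3) := (h.adj _ _).2 (by simp)
  have a1 : Γ.graph.Adj (e 1) (e 3) := (h.adj _ _).2 (by simp)
  have a2 : Γ.graph.Adj (e 2) (e 3) := (h.adj _ _).2 (by simp)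
  have l0 := h.len_14
  rw [sqrt_sideLength h0] at l0
  have hs3 := sqrt_three_pos
  obtain ⟨hP, d0, d1, d2⟩ := eq_smul_triangle (P := γ.vert (e 3)) h0 (by linarith) i
    (by rw [← h0', ← l0]; exact hγ.dist_le_len a0) (by rw [← h1, ← h.len_24]; exact hγ.dist_le_len a1)
    (by rw [← h2, ← h.len_34]; exact hγ.dist_le_len a2)
  have s0 := hγ.image_edge_eq_segment a0 (by rw [dist_comm, h0', d0, l0]) (hred.1 _ _ a0)
  have s1 := hγ.image_edge_eq_segment a1 (by rw [dist_comm, h1, d1, h.len_24]) (hred.1 _ _ a1)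
  have s2 := hγ.image_edge_eq_segment a2 (by rw [dist_comm, h2, d2, h.len_34]) (hred.1 _ _ a2)
  rw [segment_symm, h0', hP] at s0
  rw [segment_symm, h1, hP] at s1
  rw [segment_symm, h2, hP] at s2
  have hmem : γ.vert (e 3) ∈ γ.image := MetricGraph.Fun.mem_image_of_adj a0 <| by
    rw [s0, hP]; exact left_mem_segment _ _ _
  have hmem' : rot (γ.vert (e 3)) ∈ γ.image := hrot ▸ mem_image_of_mem _ hmem
  rw [hP, rot_smul_triangle] at hmem'
  refine smul_triangle_notMem_tripod (sqrt_three_mul_sub_neg hw₀) i ?_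
  obtain ⟨x, y, hxy, hmem'⟩ := hmem'
  obtain ⟨a, rfl⟩ := e.surjective x
  obtain ⟨b, rfl⟩ := e.surjective y
  have hab := (h.adj a b).1 hxy
  simp only [mem_insert_iff, mem_singleton_iff, Sym2.eq_iff] at hab
  rw [← s0, ← s1, ← s2]
  rcases hab with (⟨rfl, rfl⟩ | ⟨rfl, rfl⟩) | (⟨rfl, rfl⟩ | ⟨rfl, rfl⟩) |
    (⟨rfl, rfl⟩ | ⟨rfl, rfl⟩)
  · exact Or.inl hmem'
  · exact Or.inl (γ.image_edge_symm a0 ▸ hmem')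
  · exact Or.inr (Or.inl hmem')
  · exact Or.inr (Or.inl (γ.image_edge_symm a1 ▸ hmem'))
  · exact Or.inr (Or.inr hmem')
  · exact Or.inr (Or.inr (γ.image_edge_symm a2 ▸ hmem'))

/-- All edges except the Neumann edge are forced to be segments of the tripod T. If the image were
invariant, a neighbourhood of the rotated centre, which is off T, would put three arcs issuing from
one point on the Neumann edge, an injective curve. -/
theorem IsGamma3.rot_image_ne {l w₀ : ℝ} (h0 : 0 ≤ w₀) (hw₀ : w₀ < √3 / 6) {e : Fin 6 ≃ Fin N}
    {k : ℕ} (h : IsGamma3 l (sideLength w₀) Γ W e) (hred : Γ.IsReduced W) (hγ : γ.IsImmersion)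
    (h0' : γ.vert (e 0) = rot^[k] (triangle 0))
    (h1 : γ.vert (e 1) = rot^[k] (triangle 1)) (h2 : γ.vert (e 2) = rot^[k] (triangle 2)) :
    rot '' γ.image ≠ γ.image := by
  intro hrot
  obtain ⟨i, hi⟩ := rot_iterate_triangle k
  rw [hi] at h0' h1 h2
  rw [zero_add] at h0'
  rw [add_comm] at h1 h2
  have a0 : Γ.graph.Adj (e 0) (e 4) := (h.adj _ _).2 (by simp)
  have a1 : Γ.graph.Adj (e 1) (e 3) := (h.adj _ _).2 (by simp)
  have a2 : Γ.graph.Adj (e 2) (e 3) := (h.adj _ _).2 (by simp)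
  have a3 : Γ.graph.Adj (e 3) (e 4) := (h.adj _ _).2 (by simp)
  have a4 : Γ.graph.Adj (e 4) (e 5) := (h.adj _ _).2 (by simp)
  have hl : (Γ.len s(e 0, e 4) : ℝ) + Γ.len s(e 3, e 4) = √3 / 2 - w₀ := by
    rw [h.len_15, h.len_45, sqrt_four_mul_sideLength h0]; ring
  have hs3 := sqrt_three_pos
  have dq0 := hγ.dist_le_len a0
  have dq3 := hγ.dist_le_len a3
  have dtri := dist_triangle (γ.vert (e 3)) (γ.vert (e 4)) (γ.vert (e 0))
  rw [dist_comm (γ.vert (e 3)) (γ.vert (e 4))] at dtri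
  obtain ⟨hP, d0, d1, d2⟩ := eq_smul_triangle (P := γ.vert (e 3)) h0 (by linarith) i
    (by rw [← h0']; linarith)
    (by rw [← h1, ← h.len_24]; exact hγ.dist_le_len a1)
    (by rw [← h2, ← h.len_34]; exact hγ.dist_le_len a2)
  rw [← h0'] at d0
  have hQ : γ.vert (e 4) ∈ segment ℝ (γ.vert (e 3)) (γ.vert (e 0)) := by
    rw [mem_segment_iff_wbtw, ← dist_add_dist_eq_iff, dist_comm (γ.vert (e 3)) (γ.vert (e 4))]
    linarith
  have s0 := hγ.image_edge_eq_segment a0 (by rw [dist_comm]; linarith) (hred.1 _ _ a0)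
  have s1 := hγ.image_edge_eq_segment a1 (by rw [dist_comm, h1, d1, h.len_24]) (hred.1 _ _ a1)
  have s2 := hγ.image_edge_eq_segment a2 (by rw [dist_comm, h2, d2, h.len_34]) (hred.1 _ _ a2)
  have s3 := hγ.image_edge_eq_segment a3 (by rw [dist_comm]; linarith) (hred.1 _ _ a3)
  have hPQ : γ.vert (e 3) ≠ γ.vert (e 4) := by
    have : (0 : ℝ) < Γ.len s(e 3, e 4) := hred.1 _ _ a3
    intro hPQ
    rw [hPQ] at d0
    linarith
  set c := √3 * w₀ - 1 / 2
  have hc : c < 0 := sqrt_three_mul_sub_neg hw₀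
  obtain ⟨c', hc'⟩ : ∃ c' : ℝ, γ.vert (e 4) = c' • triangle i := by
    obtain ⟨α, β, -, -, -, h⟩ := hQ
    exact ⟨α * c + β, by rw [← h, hP, h0']; module⟩
  have t0 : segment ℝ (γ.vert (e 0)) (γ.vert (e 4)) ⊆ segment ℝ (c • triangle i) (triangle i) := by
    rw [← hP, ← h0']
    exact (convex_segment _ _).segment_subset (right_mem_segment _ _ _) hQ
  have t3 : segment ℝ (γ.vert (e 3)) (γ.vert (e 4)) ⊆ segment ℝ (c • triangle i) (triangle i) := by
    rw [← hP, ← h0']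
    exact (convex_segment _ _).segment_subset (left_mem_segment _ _ _) hQ
  rw [← s0] at t0
  rw [segment_symm, h1, hP] at s1
  rw [segment_symm, h2, hP] at s2
  set T := segment ℝ (c • triangle i) (triangle i) ∪ (segment ℝ (c • triangle i) (triangle (i + 1))
    ∪ segment ℝ (c • triangle i) (triangle (i + 2))) with hT
  have hcover : γ.image ⊆ T ∪ γ.edge (e 4) (e 5) '' Icc 0 (Γ.len s(e 4, e 5)) := by
    rintro P' ⟨x, y, hxy, hmem'⟩
    obtain ⟨a, rfl⟩ := e.surjective x
    obtain ⟨b, rfl⟩ := e.surjective y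
    have hab := (h.adj a b).1 hxy
    simp only [mem_insert_iff, mem_singleton_iff, Sym2.eq_iff] at hab
    rw [hT, ← s1, ← s2]
    rcases hab with (⟨rfl, rfl⟩ | ⟨rfl, rfl⟩) | (⟨rfl, rfl⟩ | ⟨rfl, rfl⟩) |
      (⟨rfl, rfl⟩ | ⟨rfl, rfl⟩) | (⟨rfl, rfl⟩ | ⟨rfl, rfl⟩) | (⟨rfl, rfl⟩ | ⟨rfl, rfl⟩)
    · exact Or.inl (Or.inl (t0 hmem'))
    · exact Or.inl (Or.inl (t0 (γ.image_edge_symm a0 ▸ hmem')))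
    · exact Or.inl (Or.inr (Or.inl hmem'))
    · exact Or.inl (Or.inr (Or.inl (γ.image_edge_symm a1 ▸ hmem')))
    · exact Or.inl (Or.inr (Or.inr hmem'))
    · exact Or.inl (Or.inr (Or.inr (γ.image_edge_symm a2 ▸ hmem')))
    · exact Or.inl (Or.inl (t3 (s3 ▸ hmem')))
    · exact Or.inl (Or.inl (t3 (s3 ▸ γ.image_edge_symm a3 ▸ hmem')))
    · exact Or.inr hmem'
    · exact Or.inr (γ.image_edge_symm a4 ▸ hmem')
  rw [hP, hc'] at s3
  let X : Fin 3 → Plane := ![c' • triangle i, triangle (i + 1), triangle (i + 2)]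
  let Y : Fin 3 → Plane := ![c' • triangle (i + 1), triangle (i + 1 + 1), triangle (i + 1 + 2)]
  have hXY : ∀ m, rot (X m) = Y m := by
    intro m
    fin_cases m
    · exact rot_smul_triangle _ _
    · exact rot_triangle (i + 1)
    · simp only [X, Y, Fin.reduceFinMk, Matrix.cons_val]
      rw [rot_triangle, add_right_comm]
  have hX : ∀ m, segment ℝ (c • triangle i) (X m) ⊆ γ.image := by
    intro m
    fin_cases m
    · exact s3 ▸ MetricGraph.Fun.mem_image_of_adj a3
    · exact s1 ▸ MetricGraph.Fun.mem_image_of_adj a1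
    · exact s2 ▸ MetricGraph.Fun.mem_image_of_adj a2
  have hTc : IsClosed T := by
    have : ∀ p q : Plane, IsClosed (segment ℝ p q) := fun p q => by
      rw [segment_eq_image_lineMap]
      exact (isCompact_Icc.image AffineMap.lineMap_continuous).isClosed
    exact (this _ _).union ((this _ _).union (this _ _))
  have hcont : ∀ m, Continuous fun s : ℝ => AffineMap.lineMap (c • triangle (i + 1)) (Y m) s :=
    fun m => AffineMap.lineMap_continuous
  -- The complement of T is open, so short initial pieces of the three rotated segments miss T and
  -- must lie on the Neumann edge.
  have hev : ∀ᶠ s in nhds (0 : ℝ), ∀ m,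
      AffineMap.lineMap (c • triangle (i + 1)) (Y m) s ∈ Tᶜ := by
    rw [Filter.eventually_all]
    intro m
    refine (hcont m).continuousAt.eventually_mem (hTc.isOpen_compl.mem_nhds ?_)
    rw [AffineMap.lineMap_apply_zero]
    exact smul_triangle_notMem_tripod hc i
  obtain ⟨ε, hε, hball⟩ := Metric.eventually_nhds_iff.1 hev
  have hδ : 0 < min (ε / 2) 1 := lt_min (by linarith) one_pos
  refine not_triod (hγ _ _ a4).1 (hγ _ _ a4).2.1
    (c := fun m s => AffineMap.lineMap (c • triangle (i + 1)) (Y m) s) hδ hcont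
    (fun m => AffineMap.lineMap_apply_zero _ _) ?_
    (fun m m' hm s hs s' hs' => lineMap_ne_lineMap rfl m m' hm hs.1 hs'.1) ?_
  · intro m hm
    rcases AffineMap.lineMap_eq_left_iff.1 hm with hm | hm
    · refine smul_triangle_ne (fun h => ?_) rfl m hm
      exact hPQ (by rw [hP, hc', h])
    · exact hδ.ne' hm
  · intro m s hs
    have h1 : AffineMap.lineMap (c • triangle (i + 1)) (Y m) s ∈ γ.image := by
      rw [← hrot, ← rot_smul_triangle, ← hXY, ← rot_lineMap]
      refine mem_image_of_mem _ (hX m ?_)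
      rw [segment_eq_image_lineMap]
      exact ⟨s, ⟨hs.1, hs.2.trans (min_le_right _ _)⟩, rfl⟩
    refine (hcover h1).resolve_left (hball ?_ m)
    rw [Real.dist_eq, sub_zero, abs_of_nonneg hs.1]
    linarith [hs.2, min_le_left (ε / 2) 1]

end

/-! ### The main theorem -/

theorem mainTheorem11 :
    -- short total length: the tripod, with no Neumann vertex
    (∀ l : ℝ, √3 ≤ l → l ≤ 1 + √3 / 2 →
      ∃ x ∈ Icc (1 / 2 : ℝ) (1 / √3),
        -- the parameter is determined by the length
        (∀ y ∈ Icc (1 / 2 : ℝ) (1 / √3), 2 * y + (√3 / 2 - √(y ^ 2 - 1 / 4)) = l ↔ y = x) ∧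
        -- the tree of this parameter is an optimal metric graph, and it is embedded
        (∃ (N : ℕ) (Γ : MetricGraph N) (W : Set (Fin N)) (γ : Γ.Fun Plane) (e : Fin 4 ≃ Fin N),
          IsGamma1 x Γ W e ∧ Γ.IsReduced W ∧
          IsSolution (range triangle) l Γ W γ ∧
          γ.IsEmbedding ∧ IsEmbeddedSolution (range triangle) l Γ W γ ∧
          γ.vert (e 0) = triangle 0 ∧ γ.vert (e 1) = triangle 1 ∧ γ.vert (e 2) = triangle 2) ∧
        -- uniqueness up to rotation
        (∀ (N : ℕ) (Γ : MetricGraph N) (W : Set (Fin N)) (γ : Γ.Fun Plane),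
          IsSolution (range triangle) l Γ W γ → Γ.IsReduced W →
          ∃ (e : Fin 4 ≃ Fin N) (k : ℕ), IsGamma1 x Γ W e ∧
            γ.vert (e 0) = rot^[k] (triangle 0) ∧ γ.vert (e 1) = rot^[k] (triangle 1) ∧
            γ.vert (e 2) = rot^[k] (triangle 2))) ∧
    -- large total length: two Kirchhoff vertices and a Neumann edge
    (∀ l : ℝ, 1 + √3 / 2 < l →
      ∃ x ∈ Icc (1 / 2 : ℝ) (1 / √3),
        -- the parameter of an optimal tree is determined by the length
        (∀ y ∈ Icc (1 / 2 : ℝ) (1 / √3),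
          (∃ (N : ℕ) (Γ : MetricGraph N) (W : Set (Fin N)) (γ : Γ.Fun Plane)
            (e : Fin 6 ≃ Fin N), IsGamma3 l y Γ W e ∧
              IsSolution (range triangle) l Γ W γ) ↔ y = x) ∧
        -- the tree of this parameter is an optimal metric graph, and it is embedded
        (∃ (N : ℕ) (Γ : MetricGraph N) (W : Set (Fin N)) (γ : Γ.Fun Plane) (e : Fin 6 ≃ Fin N),
          IsGamma3 l x Γ W e ∧ Γ.IsReduced W ∧
          IsSolution (range triangle) l Γ W γ ∧
          γ.IsEmbedding ∧ IsEmbeddedSolution (range triangle) l Γ W γ ∧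
          γ.vert (e 0) = triangle 0 ∧ γ.vert (e 1) = triangle 1 ∧ γ.vert (e 2) = triangle 2) ∧
        -- uniqueness up to rotation
        (∀ (N : ℕ) (Γ : MetricGraph N) (W : Set (Fin N)) (γ : Γ.Fun Plane),
          IsSolution (range triangle) l Γ W γ → Γ.IsReduced W →
          ∃ (e : Fin 6 ≃ Fin N) (k : ℕ), IsGamma3 l x Γ W e ∧
            γ.vert (e 0) = rot^[k] (triangle 0) ∧ γ.vert (e 1) = rot^[k] (triangle 1) ∧
            γ.vert (e 2) = rot^[k] (triangle 2))) ∧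
    -- symmetry breaking
    (∀ l : ℝ, √3 < l →
      ∀ (N : ℕ) (Γ : MetricGraph N) (W : Set (Fin N)) (γ : Γ.Fun Plane),
        IsSolution (range triangle) l Γ W γ → Γ.IsReduced W →
        (¬ ∃ φ : Γ.graph ≃g Γ.graph,
          (∀ i j, Γ.graph.Adj i j → Γ.len s(φ i, φ j) = Γ.len s(i, j)) ∧
          ∀ i ∈ W, φ i ∈ W ∧ γ.vert (φ i) = rot (γ.vert i)) ∧
        (γ.IsEmbedding → rot '' γ.image ≠ γ.image)) := by
  refine ⟨?_, ?_, ?_⟩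
  · intro l hl hl'
    obtain ⟨w₀, hw₀, hr, hr0, hlt, hopt⟩ := exists_optimal_height hl
    have hr' := hr hl'
    refine ⟨sideLength w₀, sideLength_mem_Icc hw₀, ?_, ?_, ?_⟩
    · intro y hy
      obtain ⟨w, hw, rfl⟩ := exists_sideLength_eq hy
      rw [sqrt_sideLength hw.1]
      constructor
      · intro h
        have : neumannLength l w = neumannLength l w₀ := by
          rw [hr']; unfold neumannLength; linarith
        rw [(neumannLength_strictMonoOn l).injOn hw hw₀ this]
      · intro h
        have h1 := sideLength_sq w
        rw [h, sideLength_sq, add_left_inj, sq_eq_sq₀ hw₀.1 hw.1] at h1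
        rw [← h1]
        unfold neumannLength at hr'
        linarith
    · obtain ⟨N, Γ, W, γ, e, h1, h2, h3, h4, h5, h6⟩ :=
        exists_tripod_drawing hl hw₀.1 hw₀.2 hopt hr'
      have hs := h3.isSolution hopt hw₀.1 h4
      exact ⟨N, Γ, W, γ, e, h1, h2, hs, h5, ⟨⟨h3, h5⟩, fun N' Γ' W' γ' h' _ => hs.2 N' Γ' W' γ' h'⟩,
        h6⟩
    · intro N Γ W γ hs hred
      exact MetricGraph.exists_isGamma1_of_le hl hw₀.1 hw₀.2 hopt hr' hs.1 hred
        (hs.energy_le hl hw₀.1 hw₀.2 hlt hr0 hopt)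
  · intro l hl'
    have hl : √3 < l := by linarith [sqrt_three_lt]
    obtain ⟨w₀, hw₀, hr, hr0, hlt, hopt⟩ := exists_optimal_height hl.le
    have hlt' := hlt hl
    have hr' : 0 < neumannLength l w₀ := by
      have := (neumannLength_strictMonoOn l).monotoneOn
        ⟨le_rfl, by linarith [sqrt_three_pos]⟩ hw₀ hw₀.1
      rw [neumannLength_zero] at this
      linarith
    obtain ⟨N, Γ, W, γ, e, h1, h2, h3, h4, h5, h6⟩ :=
      exists_neumann_drawing hl.le hw₀.1 hlt' hopt hr'
    have hs := h3.isSolution hopt hw₀.1 h4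
    refine ⟨sideLength w₀, sideLength_mem_Icc hw₀, ?_, ?_, ?_⟩
    · intro y hy
      constructor
      · rintro ⟨N, Γ, W, γ, e, h, hs⟩
        exact h.eq_sideLength hl' hw₀.1 hlt' hr' hopt hy hs
      · rintro rfl
        exact ⟨N, Γ, W, γ, e, h1, hs⟩
    · exact ⟨N, Γ, W, γ, e, h1, h2, hs, h5, ⟨⟨h3, h5⟩, fun N' Γ' W' γ' h' _ => hs.2 N' Γ' W' γ' h'⟩,
        h6⟩
    · intro N Γ W γ hs hred
      exact MetricGraph.exists_isGamma3_of_le hl.le hw₀.1 hlt' hopt hr' hs.1 hred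
        (hs.energy_le hl.le hw₀.1 hw₀.2 hlt hr0 hopt)
  · intro l hl N Γ W γ hs hred
    obtain ⟨w₀, hw₀, hr, hr0, hlt, hopt⟩ := exists_optimal_height hl.le
    have hE := hs.energy_le hl.le hw₀.1 hw₀.2 hlt hr0 hopt
    have hlt' := hlt hl
    -- The shape of the tree depends only on whether the optimal Neumann length is zero, so the two
    -- ranges of l need not be separated here.
    rcases hr0.eq_or_lt with hr' | hr'
    · obtain ⟨e, k, h, h0, h1, h2⟩ := MetricGraph.exists_isGamma1_of_le hl.le hw₀.1 hw₀.2 hopt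
        hr'.symm hs.1 hred hE
      exact ⟨h.not_automorphism hw₀.1 hlt' h0 h1 h2,
        fun hγ => h.rot_image_ne hw₀.1 hlt' hred hγ.1 h0 h1 h2⟩
    · obtain ⟨e, k, h, h0, h1, h2⟩ := MetricGraph.exists_isGamma3_of_le hl.le hw₀.1 hlt' hopt
        hr' hs.1 hred hE
      exact ⟨h.not_automorphism h0 h1 h2, fun hγ => h.rot_image_ne hw₀.1 hlt' hred hγ.1 h0 h1 h2⟩
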